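/- Identify the plane with $\mathbb{C}$. A finite set $P = H \cup \{w\}$ with $w \notin H$ is called a conowheel set (with extra point $w$) if no three points of $P$ lie on a common line and every point of $H$ is a vertex of the convex hull of $P$ (the point $w$ may or may not be one). A $w$-embracing triangle of $P$ is a three-element subset of $H$ whose convex hull contains $w$. A geometric graph on $P$ is a graph with vertex set $P$ whose edges are drawn as straight segments; it is crossing-free if no two distinct edges intersect in their relative interiors. Let $n \ge 1$, $c, z \in \mathbb{C}$ with $z \ne 0$, and let $H_{\mathrm{sym}} = \{c + z e^{2\pi i k/n} : 0 \le k < n\}$ be the vertex set of a regular $n$-gon with center $c$. Then there is $\varepsilon > 0$ such that for every $w \in \mathbb{C}$ with $|w - c| < \varepsilon$ for which no three points of $P_{\mathrm{sym}} = H_{\mathrm{sym}} \cup \{w\}$ are collinear (for odd $n$ one may take $w = c$; for even $n$ one perturbs the center slightly), the symmetric wheel set $P_{\mathrm{sym}}$ is a conowheel set with extra point $w$, and for every conowheel set $P' = H' \cup \{w'\}$ with extra point $w'$ and $|H'| = n$: 1. the number of $w'$-embracing triangles of $P'$ is at most the number of $w$-embracing triangles of $P_{\mathrm{sym}}$; 2.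 the number of crossing-free (not necessarily perfect) matchings on $P'$ is at most the number of crossing-free matchings on $P_{\mathrm{sym}}$; 3. the number of crossing-free spanning trees on $P'$ is at most the number of crossing-free spanning trees on $P_{\mathrm{sym}}$. -/

import Mathlib

open Filter Topology

noncomputable section

/-- A finite set of points in the plane `ℂ = ℝ²` is in general position if no three distinct points
of it lie on a common line. -/
def InGeneralPosition (P : Finset ℂ) : Prop :=
  ∀ a ∈ P, ∀ b ∈ P, ∀ c ∈ P, a ≠ b → a ≠ c → b ≠ c → ¬ Collinear ℝ ({a, b, c} : Set ℂ)

/-- `P = H ∪ {w}` is a conowheel set with extra point `w`: it is in general position and every point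
of `H` is a vertex of the convex hull of `P`. The point `w` may be extreme (convex position) or
not (wheel set). -/
structure IsConowheelSet (H : Finset ℂ) (w : ℂ) : Prop where
  notMem : w ∉ H
  generalPosition : InGeneralPosition (insert w H)
  extreme : ∀ h ∈ H, h ∈ (convexHull ℝ ((insert w H : Finset ℂ) : Set ℂ)).extremePoints ℝ

/-- The vertex set of the regular `n`-gon with center `c` that has `c + z` as one of its vertices. -/
def regularPolygon (n : ℕ) (c z : ℂ) : Finset ℂ :=
  Finset.univ.image fun k : Fin n =>
    c + z * Complex.exp (2 * Real.pi * Complex.I * ((k : ℕ) : ℂ) / (n : ℂ))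

/-- The number of `w`-embracing triangles: three-element subsets of `H` whose convex hull
contains `w`. -/
def numEmbracingTriangles (H : Finset ℂ) (w : ℂ) : ℕ :=
  Set.ncard {T : Finset ℂ | T ⊆ H ∧ T.card = 3 ∧ w ∈ convexHull ℝ (T : Set ℂ)}

/-- A geometric graph on `P` (a graph with vertex set `P` whose edges are drawn as straight segments)
is crossing-free if no two distinct edges intersect in their relative interiors. -/
def IsCrossingFree {P : Finset ℂ} (G : SimpleGraph P) : Prop :=
  ∀ a b c d : P, G.Adj a b → G.Adj c d → s(a, b) ≠ s(c, d) →
    Disjoint (openSegment ℝ (a : ℂ) (b : ℂ)) (openSegment ℝ (c : ℂ) (d : ℂ))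

/-- A graph is a (not necessarily perfect) matching if every vertex has at most one neighbor. -/
def IsMatchingGraph {V : Type*} (G : SimpleGraph V) : Prop :=
  ∀ v, (G.neighborSet v).Subsingleton

/-- The number of crossing-free (not necessarily perfect) matchings on `P`. -/
def numCrossingFreeMatchings (P : Finset ℂ) : ℕ :=
  Set.ncard {G : SimpleGraph P | IsCrossingFree G ∧ IsMatchingGraph G}

/-- The number of crossing-free spanning trees on `P`. -/
def numCrossingFreeSpanningTrees (P : Finset ℂ) : ℕ :=
  Set.ncard {G : SimpleGraph P | IsCrossingFree G ∧ G.IsTree}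

end

/-! Number the points of `H` counterclockwise by `0, …, n - 1` and let `S` be the set of pairs `a <
b` such that the extra point lies to the right of the directed line from `a` to `b`, the side of the
vertices between them. Because the points of `H` are extreme, two segments without a common end
cross as soon as the ends of one, with both ends in `H`, are separated by the line of the other two;
no second separation test is needed. Hence `S` alone determines all crossings and all embracing
triangles, and the three counts become functions of `S`. What is used of `S` is only that it is an
up-set of intervals in which no two members lie side by side (`IsPosition`).

Let `(a, b)` be an inclusion-minimal member of `S`. Erasing it means pushing the extra point across
the diagonal `ab`, and it yields another position. Graphs without the edge `ab` keep their
crossings. A graph with the edge `ab` is cut by it into two parts, and minimality makes the extra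
point so close to `ab` that both parts behave like points in convex position. So the change of each
count is a number `Δ (b - a)` (`embracingTriples_jump`, `matchCount_jump`, `treeCount_jump`).
Erasing minimal pairs until nothing is left gives `F S = F ∅ + ∑ Δ (b - a)` over the members of `S`
(`eq_add_sum_of_jump`); the path runs through combinatorial positions, so no motion of points has to
be realized.

For all three counts `Δ d ≥ 0` if `2 * d ≥ n` and `Δ d ≤ 0` if `2 * d ≤ n`. The sum is therefore
largest when `S` contains all pairs with `2 * d > n` and none with `2 * d < n`, and this is the
position of a point near the center of the regular polygon (`le_of_isBalanced`,
`eventually_isBalanced`).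

The sign of `Δ` is immediate for triangles, where `Δ d = 2 * d - n`. For matchings it is
log-convexity of the Motzkin numbers (`convexMatchings_mul_le`), obtained from nonnegative
two-by-two minors of the array of Motzkin prefixes. For trees it is the monotonicity of a ratio of
two forest numbers (`rootedForests_mul_le`). These are coefficients of powers of the series `T = 1 +
X * T ^ 3`, which the Fuss-Catalan formula makes explicit. -/

namespace WheelSet

open Finset
open scoped Classical

/-! ### Graphs on sets of natural numbers as finite edge sets. -/

/-- The edge sets of the graphs with vertex set `U`. -/
def graphsOn (U : Finset ℕ) : Finset (Finset (Sym2 ℕ)) :=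
  (U.sym2.filter fun e => ¬ e.IsDiag).powerset

lemma mem_graphsOn {U : Finset ℕ} {E : Finset (Sym2 ℕ)} :
    E ∈ graphsOn U ↔ ∀ a b, s(a, b) ∈ E → a ∈ U ∧ b ∈ U ∧ a ≠ b := by
  simp only [graphsOn, mem_powerset, subset_iff, mem_filter, Sym2.forall, mk_mem_sym2_iff,
    Sym2.mk_isDiag_iff, and_assoc]

/-- No two edges of `E` are in the crossing relation `X`. -/
def CrossingFree (X : ℕ → ℕ → ℕ → ℕ → Prop) (E : Finset (Sym2 ℕ)) : Prop :=
  ∀ a b c d, s(a, b) ∈ E → s(c, d) ∈ E → ¬ X a b c d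

/-- Every cut of the vertex set `U` is crossed by an edge. -/
def CutConnected (U : Finset ℕ) (E : Finset (Sym2 ℕ)) : Prop :=
  ∀ A : Set ℕ, ∀ x ∈ U, x ∈ A → ∀ y ∈ U, y ∉ A → ∃ u v, s(u, v) ∈ E ∧ u ∈ A ∧ v ∉ A

/-- `E` is the edge set of a tree with vertex set `U`. -/
def IsTreeOn (U : Finset ℕ) (E : Finset (Sym2 ℕ)) : Prop :=
  CutConnected U E ∧ E.card + 1 = U.card

/-- `E` is the edge set of a matching. -/
def IsMatchingSet (E : Finset (Sym2 ℕ)) : Prop :=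
  ∀ a b c, s(a, b) ∈ E → s(a, c) ∈ E → b = c

/-- The number of crossing-free matchings on `U`. -/
noncomputable def matchCount (X : ℕ → ℕ → ℕ → ℕ → Prop) (U : Finset ℕ) : ℕ :=
  #{E ∈ graphsOn U | CrossingFree X E ∧ IsMatchingSet E}

/-- The number of crossing-free spanning trees on `U`. -/
noncomputable def treeCount (X : ℕ → ℕ → ℕ → ℕ → Prop) (U : Finset ℕ) : ℕ :=
  #{E ∈ graphsOn U | CrossingFree X E ∧ IsTreeOn U E}

/-- The number of crossing-free spanning trees on `U` that contain the edge `e`. -/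
noncomputable def treeCountWith (X : ℕ → ℕ → ℕ → ℕ → Prop) (U : Finset ℕ) (e : Sym2 ℕ) : ℕ :=
  #{E ∈ graphsOn U | CrossingFree X E ∧ IsTreeOn U E ∧ e ∈ E}

lemma CrossingFree.mono {X : ℕ → ℕ → ℕ → ℕ → Prop} {E F : Finset (Sym2 ℕ)}
    (h : CrossingFree X F) (hEF : E ⊆ F) : CrossingFree X E :=
  fun a b c d h1 h2 => h a b c d (hEF h1) (hEF h2)

lemma IsMatchingSet.mono {E F : Finset (Sym2 ℕ)}
    (h : IsMatchingSet F) (hEF : E ⊆ F) : IsMatchingSet E :=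
  fun a b c h1 h2 => h a b c (hEF h1) (hEF h2)

lemma graphsOn_mono {U U' : Finset ℕ} (h : U ⊆ U') {E : Finset (Sym2 ℕ)} (hE : E ∈ graphsOn U) :
    E ∈ graphsOn U' := by
  rw [mem_graphsOn] at *
  exact fun a b hab => ⟨h (hE a b hab).1, h (hE a b hab).2.1, (hE a b hab).2.2⟩

lemma graphsOn_subset {U : Finset ℕ} {E F : Finset (Sym2 ℕ)} (h : E ⊆ F) (hF : F ∈ graphsOn U) :
    E ∈ graphsOn U := by
  rw [mem_graphsOn] at *
  exact fun a b hab => hF a b (h hab)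

lemma graphsOn_union {U : Finset ℕ} {E F : Finset (Sym2 ℕ)} (hE : E ∈ graphsOn U)
    (hF : F ∈ graphsOn U) : E ∪ F ∈ graphsOn U := by
  rw [mem_graphsOn] at *
  intro a b hab
  rcases mem_union.1 hab with h | h
  exacts [hE a b h, hF a b h]

/-! ### Transport along injective maps -/

section Transport

variable {U : Finset ℕ} {f : ℕ → ℕ}

lemma mem_image_map (hf : Set.InjOn f U) {E : Finset (Sym2 ℕ)} (hE : E ∈ graphsOn U) {a b : ℕ}
    (ha : a ∈ U) (hb : b ∈ U) : s(f a, f b) ∈ E.image (Sym2.map f) ↔ s(a, b) ∈ E := by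
  rw [mem_graphsOn] at hE
  constructor
  · intro h
    obtain ⟨e, he, heq⟩ := mem_image.1 h
    induction e using Sym2.ind with
    | _ x y =>
      obtain ⟨hx, hy, -⟩ := hE x y he
      rw [Sym2.map_mk, Sym2.eq_iff] at heq
      rcases heq with ⟨h1, h2⟩ | ⟨h1, h2⟩
      · rwa [← hf hx ha h1, ← hf hy hb h2]
      · rw [← hf hx hb h1, ← hf hy ha h2, Sym2.eq_swap]
        exact he
  · intro h
    exact mem_image.2 ⟨_, h, rfl⟩

lemma exists_of_mem_image_map {E : Finset (Sym2 ℕ)} (hE : E ∈ graphsOn U) {x y : ℕ}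
    (h : s(x, y) ∈ E.image (Sym2.map f)) :
    ∃ a b, a ∈ U ∧ b ∈ U ∧ x = f a ∧ y = f b ∧ s(a, b) ∈ E := by
  rw [mem_graphsOn] at hE
  obtain ⟨e, he, heq⟩ := mem_image.1 h
  induction e using Sym2.ind with
  | _ a b =>
    obtain ⟨ha, hb, -⟩ := hE a b he
    rw [Sym2.map_mk, Sym2.eq_iff] at heq
    rcases heq with ⟨h1, h2⟩ | ⟨h1, h2⟩
    · exact ⟨a, b, ha, hb, h1.symm, h2.symm, he⟩
    · exact ⟨b, a, hb, ha, h2.symm, h1.symm, Sym2.eq_swap ▸ he⟩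

lemma image_mem_graphsOn (hf : Set.InjOn f U) {E : Finset (Sym2 ℕ)} (hE : E ∈ graphsOn U) :
    E.image (Sym2.map f) ∈ graphsOn (U.image f) := by
  rw [mem_graphsOn]
  intro x y hxy
  obtain ⟨a, b, ha, hb, rfl, rfl, hab⟩ := exists_of_mem_image_map hE hxy
  refine ⟨mem_image_of_mem f ha, mem_image_of_mem f hb, fun h => ?_⟩
  exact (mem_graphsOn.1 hE a b hab).2.2 (hf ha hb h)

lemma image_injOn (hf : Set.InjOn f U) {E F : Finset (Sym2 ℕ)} (hE : E ∈ graphsOn U)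
    (hF : F ∈ graphsOn U) (h : E.image (Sym2.map f) = F.image (Sym2.map f)) : E = F := by
  ext e
  induction e using Sym2.ind with
  | _ a b =>
    constructor
    · intro he
      obtain ⟨ha, hb, -⟩ := mem_graphsOn.1 hE a b he
      rw [← mem_image_map hf hF ha hb, ← h, mem_image_map hf hE ha hb]
      exact he
    · intro he
      obtain ⟨ha, hb, -⟩ := mem_graphsOn.1 hF a b he
      rw [← mem_image_map hf hE ha hb, h, mem_image_map hf hF ha hb]
      exact he

lemma exists_image_eq {F : Finset (Sym2 ℕ)} (hf : Set.InjOn f U)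
    (hF : F ∈ graphsOn (U.image f)) : ∃ E ∈ graphsOn U, E.image (Sym2.map f) = F := by
  have key : (U.sym2.filter fun e => Sym2.map f e ∈ F) ∈ graphsOn U := by
    rw [mem_graphsOn]
    intro a b hab
    rw [mem_filter, mk_mem_sym2_iff] at hab
    refine ⟨hab.1.1, hab.1.2, ?_⟩
    rintro rfl
    exact (mem_graphsOn.1 hF _ _ hab.2).2.2 rfl
  refine ⟨_, key, ?_⟩
  ext e
  induction e using Sym2.ind with
  | _ x y =>
    constructor
    · intro h
      obtain ⟨a, b, ha, hb, rfl, rfl, hab⟩ := exists_of_mem_image_map key h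
      exact (mem_filter.1 hab).2
    · intro h
      obtain ⟨hx, hy, -⟩ := mem_graphsOn.1 hF x y h
      obtain ⟨a, ha, rfl⟩ := mem_image.1 hx
      obtain ⟨b, hb, rfl⟩ := mem_image.1 hy
      rw [mem_image_map hf key ha hb, mem_filter]
      exact ⟨mk_mem_sym2_iff.2 ⟨ha, hb⟩, h⟩

lemma card_image_map (hf : Set.InjOn f U) {E : Finset (Sym2 ℕ)} (hE : E ∈ graphsOn U) :
    (E.image (Sym2.map f)).card = E.card := by
  apply card_image_of_injOn
  intro e he e' he' h
  induction e using Sym2.ind with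
  | _ a b =>
    induction e' using Sym2.ind with
    | _ c d =>
      obtain ⟨ha, hb, -⟩ := mem_graphsOn.1 hE a b he
      obtain ⟨hc, hd, -⟩ := mem_graphsOn.1 hE c d he'
      rw [Sym2.map_mk, Sym2.map_mk, Sym2.eq_iff] at h
      rcases h with ⟨h1, h2⟩ | ⟨h1, h2⟩
      · rw [hf ha hc h1, hf hb hd h2]
      · rw [hf ha hd h1, hf hb hc h2, Sym2.eq_swap]

lemma crossingFree_image {X Y : ℕ → ℕ → ℕ → ℕ → Prop} {E : Finset (Sym2 ℕ)}
    (hE : E ∈ graphsOn U)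
    (hX : ∀ a b c d, s(a, b) ∈ E → s(c, d) ∈ E → (X a b c d ↔ Y (f a) (f b) (f c) (f d))) :
    CrossingFree Y (E.image (Sym2.map f)) ↔ CrossingFree X E := by
  constructor
  · intro h a b c d hab hcd hx
    exact h _ _ _ _ (mem_image_of_mem (Sym2.map f) hab) (mem_image_of_mem (Sym2.map f) hcd)
      ((hX a b c d hab hcd).1 hx)
  · intro h x y z t hxy hzt hx
    obtain ⟨a, b, ha, hb, rfl, rfl, hab⟩ := exists_of_mem_image_map hE hxy
    obtain ⟨c, d, hc, hd, rfl, rfl, hcd⟩ := exists_of_mem_image_map hE hzt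
    exact h a b c d hab hcd ((hX a b c d hab hcd).2 hx)

lemma isMatchingSet_image (hf : Set.InjOn f U) {E : Finset (Sym2 ℕ)} (hE : E ∈ graphsOn U) :
    IsMatchingSet (E.image (Sym2.map f)) ↔ IsMatchingSet E := by
  constructor
  · intro h a b c hab hac
    exact hf (mem_graphsOn.1 hE _ _ hab).2.1 (mem_graphsOn.1 hE _ _ hac).2.1
      (h _ _ _ (mem_image_of_mem (Sym2.map f) hab) (mem_image_of_mem (Sym2.map f) hac))
  · intro h x y z hxy hxz
    obtain ⟨a, b, ha, hb, rfl, rfl, hab⟩ := exists_of_mem_image_map hE hxy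
    obtain ⟨c, d, hc, hd, h1, rfl, hcd⟩ := exists_of_mem_image_map hE hxz
    obtain rfl := hf ha hc h1
    rw [h _ _ _ hab hcd]

lemma isTreeOn_image (hf : Set.InjOn f U) {E : Finset (Sym2 ℕ)} (hE : E ∈ graphsOn U) :
    IsTreeOn (U.image f) (E.image (Sym2.map f)) ↔ IsTreeOn U E := by
  unfold IsTreeOn
  rw [card_image_map hf hE, card_image_of_injOn hf]
  refine and_congr ⟨fun h A x hx hxA y hy hyA => ?_, fun h A x hx hxA y hy hyA => ?_⟩ Iff.rfl
  · obtain ⟨u, v, huv, hu, hv⟩ := h (f '' (A ∩ U)) (f x) (mem_image_of_mem f hx)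
      ⟨x, ⟨hxA, hx⟩, rfl⟩ (f y) (mem_image_of_mem f hy) (by
        rintro ⟨z, ⟨hzA, hz⟩, hzy⟩
        rw [hf hz hy hzy] at hzA
        exact hyA hzA)
    obtain ⟨a, b, ha, hb, rfl, rfl, hab⟩ := exists_of_mem_image_map hE huv
    refine ⟨a, b, hab, ?_, fun hbA => hv ⟨b, ⟨hbA, hb⟩, rfl⟩⟩
    obtain ⟨z, ⟨hzA, hz⟩, hza⟩ := hu
    rwa [hf hz ha hza] at hzA
  · obtain ⟨a, ha, rfl⟩ := mem_image.1 hx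
    obtain ⟨b, hb, rfl⟩ := mem_image.1 hy
    obtain ⟨u, v, huv, hu, hv⟩ := h (f ⁻¹' A) a ha hxA b hb hyA
    exact ⟨f u, f v, mem_image_of_mem (Sym2.map f) huv, hu, hv⟩

lemma card_filter_graphsOn_image (hf : Set.InjOn f U) {P Q : Finset (Sym2 ℕ) → Prop}
    [DecidablePred P] [DecidablePred Q] (h : ∀ E ∈ graphsOn U, (P E ↔ Q (E.image (Sym2.map f)))) :
    #{E ∈ graphsOn U | P E} = #{E ∈ graphsOn (U.image f) | Q E} := by
  refine card_nbij (fun E => E.image (Sym2.map f)) ?_ ?_ ?_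
  · intro E hE
    rw [mem_coe, mem_filter] at hE ⊢
    exact ⟨image_mem_graphsOn hf hE.1, (h E hE.1).1 hE.2⟩
  · intro E hE F hF hEF
    rw [mem_coe, mem_filter] at hE hF
    exact image_injOn hf hE.1 hF.1 hEF
  · intro F hF
    rw [mem_coe, mem_filter] at hF
    obtain ⟨E, hE, rfl⟩ := exists_image_eq hf hF.1
    refine ⟨E, ?_, rfl⟩
    rw [mem_coe, mem_filter]
    exact ⟨hE, (h E hE).2 hF.2⟩

/-- Lets one count on a piece of the wheel set be replaced by a count in convex position once the
labels are chosen well. -/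
lemma matchCount_image {X Y : ℕ → ℕ → ℕ → ℕ → Prop} (hf : Set.InjOn f U)
    (hX : ∀ a ∈ U, ∀ b ∈ U, ∀ c ∈ U, ∀ d ∈ U, (X a b c d ↔ Y (f a) (f b) (f c) (f d))) :
    matchCount X U = matchCount Y (U.image f) := by
  refine card_filter_graphsOn_image hf fun E hE => ?_
  rw [isMatchingSet_image hf hE, crossingFree_image hE]
  intro a b c d hab hcd
  obtain ⟨ha, hb, -⟩ := mem_graphsOn.1 hE a b hab
  obtain ⟨hc, hd, -⟩ := mem_graphsOn.1 hE c d hcd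
  exact hX a ha b hb c hc d hd

lemma treeCount_image {X Y : ℕ → ℕ → ℕ → ℕ → Prop} (hf : Set.InjOn f U)
    (hX : ∀ a ∈ U, ∀ b ∈ U, ∀ c ∈ U, ∀ d ∈ U, (X a b c d ↔ Y (f a) (f b) (f c) (f d))) :
    treeCount X U = treeCount Y (U.image f) := by
  refine card_filter_graphsOn_image hf fun E hE => ?_
  rw [isTreeOn_image hf hE, crossingFree_image hE]
  intro a b c d hab hcd
  obtain ⟨ha, hb, -⟩ := mem_graphsOn.1 hE a b hab
  obtain ⟨hc, hd, -⟩ := mem_graphsOn.1 hE c d hcd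
  exact hX a ha b hb c hc d hd

end Transport

/-! ### Gluing -/

lemma CutConnected.mono {U : Finset ℕ} {E F : Finset (Sym2 ℕ)} (h : CutConnected U E)
    (hEF : E ⊆ F) : CutConnected U F := by
  intro A x hx hxA y hy hyA
  obtain ⟨u, v, huv, h1, h2⟩ := h A x hx hxA y hy hyA
  exact ⟨u, v, hEF huv, h1, h2⟩

lemma CutConnected.union {U₁ U₂ : Finset ℕ} {E₁ E₂ : Finset (Sym2 ℕ)} (h₁ : CutConnected U₁ E₁)
    (h₂ : CutConnected U₂ E₂) (h : (U₁ ∩ U₂).Nonempty) : CutConnected (U₁ ∪ U₂) (E₁ ∪ E₂) := by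
  obtain ⟨v, hv⟩ := h
  obtain ⟨hv1, hv2⟩ := mem_inter.1 hv
  have h₁' := h₁.mono (subset_union_left (s₂ := E₂))
  have h₂' := h₂.mono (subset_union_right (s₁ := E₁))
  intro A x hx hxA y hy hyA
  by_cases hvA : v ∈ A
  · rcases mem_union.1 hy with hy | hy
    · exact h₁' A v hv1 hvA y hy hyA
    · exact h₂' A v hv2 hvA y hy hyA
  · rcases mem_union.1 hx with hx | hx
    · exact h₁' A x hx hxA v hv1 hvA
    · exact h₂' A x hx hxA v hv2 hvA

/-- A cut of `U₁` that `E₁` misses is missed by `E₁ ∩ E₂` too, so the connected intersection lies on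
one side of it. Putting the rest of `U₂` on that same side extends it to a cut of the union that no
edge crosses. -/
lemma CutConnected.left_of_union {U₁ U₂ : Finset ℕ} {E₁ E₂ : Finset (Sym2 ℕ)}
    (hE₁ : E₁ ∈ graphsOn U₁) (hE₂ : E₂ ∈ graphsOn U₂) (hI : CutConnected (U₁ ∩ U₂) (E₁ ∩ E₂))
    (h : CutConnected (U₁ ∪ U₂) (E₁ ∪ E₂)) : CutConnected U₁ E₁ := by
  intro A x hx hxA y hy hyA
  by_contra! hcon
  by_cases hIA : ∃ v ∈ U₁ ∩ U₂, v ∈ A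
  · obtain ⟨v, hv, hvA⟩ := hIA
    have hall : ∀ u ∈ U₁ ∩ U₂, u ∈ A := by
      intro u hu
      by_contra huA
      obtain ⟨p, q, hpq, hp, hq⟩ := hI A v hv hvA u hu huA
      exact hq (hcon p q (mem_inter.1 hpq).1 hp)
    -- The intersection is inside `A`, so everything outside `U₁` joins the side of `A`; in the
    -- other case below it joins the complement.
    obtain ⟨p, q, hpq, hp, hq⟩ := h (A ∪ (U₁ : Set ℕ)ᶜ) x (mem_union_left _ hx) (Or.inl hxA) y
      (mem_union_left _ hy) (by simp [hyA, hy])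
    simp only [Set.mem_union, Set.mem_compl_iff, mem_coe, not_or, not_not] at hp hq
    rcases mem_union.1 hpq with h1 | h1
    · exact hq.1 (hcon p q h1 (hp.resolve_right (fun h => h (mem_graphsOn.1 hE₁ p q h1).1)))
    · exact hq.1 (hall q (mem_inter.2 ⟨hq.2, (mem_graphsOn.1 hE₂ p q h1).2.1⟩))
  · push Not at hIA
    obtain ⟨p, q, hpq, hp, hq⟩ := h (A ∩ (U₁ : Set ℕ)) x (mem_union_left _ hx) ⟨hxA, hx⟩ y
      (mem_union_left _ hy) (by simp [hyA])
    rcases mem_union.1 hpq with h1 | h1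
    · exact hq ⟨hcon p q h1 hp.1, (mem_graphsOn.1 hE₁ p q h1).2.1⟩
    · exact hIA p (mem_inter.2 ⟨hp.2, (mem_graphsOn.1 hE₂ p q h1).1⟩) hp.1

/-! ### Edge sets of simple graphs -/

section Bridge

variable {P : Type*} [Fintype P] {lab : P → ℕ}

/-- The edge set of a simple graph whose vertices are labelled by natural numbers. -/
noncomputable def edgeImage (lab : P → ℕ) (G : SimpleGraph P) : Finset (Sym2 ℕ) :=
  G.edgeFinset.image (Sym2.map lab)

lemma mem_edgeImage (hlab : Function.Injective lab) {G : SimpleGraph P} {x y : P} :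
    s(lab x, lab y) ∈ edgeImage lab G ↔ G.Adj x y := by
  rw [edgeImage, mem_image]
  constructor
  · rintro ⟨e, he, h⟩
    rw [← Sym2.map_mk] at h
    rw [Sym2.map.injective hlab h] at he
    simpa using he
  · intro h
    exact ⟨s(x, y), by simpa using h, rfl⟩

lemma exists_of_mem_edgeImage {G : SimpleGraph P} {a b : ℕ} (h : s(a, b) ∈ edgeImage lab G) :
    ∃ x y, a = lab x ∧ b = lab y ∧ G.Adj x y := by
  obtain ⟨e, he, h⟩ := mem_image.1 h
  induction e using Sym2.ind with
  | _ x y =>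
    rw [SimpleGraph.mem_edgeFinset, SimpleGraph.mem_edgeSet] at he
    rw [Sym2.map_mk, Sym2.eq_iff] at h
    rcases h with ⟨h1, h2⟩ | ⟨h1, h2⟩
    · exact ⟨x, y, h1.symm, h2.symm, he⟩
    · exact ⟨y, x, h2.symm, h1.symm, he.symm⟩

lemma edgeImage_mem_graphsOn (hlab : Function.Injective lab) (G : SimpleGraph P) :
    edgeImage lab G ∈ graphsOn (univ.image lab) := by
  rw [mem_graphsOn]
  intro a b hab
  obtain ⟨x, y, rfl, rfl, h⟩ := exists_of_mem_edgeImage hab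
  exact ⟨mem_image_of_mem _ (mem_univ _), mem_image_of_mem _ (mem_univ _), hlab.ne h.ne⟩

lemma edgeImage_injective (hlab : Function.Injective lab) :
    Function.Injective (edgeImage lab) := by
  intro G G' h
  ext x y
  rw [← mem_edgeImage hlab, h, mem_edgeImage hlab]

lemma exists_edgeImage_eq (hlab : Function.Injective lab) {E : Finset (Sym2 ℕ)}
    (hE : E ∈ graphsOn (univ.image lab)) : ∃ G, edgeImage lab G = E := by
  rw [mem_graphsOn] at hE
  let G : SimpleGraph P :=
    { Adj := fun x y => s(lab x, lab y) ∈ E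
      symm := ⟨fun x y h => by rw [Sym2.eq_swap]; exact h⟩
      loopless := ⟨fun x h => (hE _ _ h).2.2 rfl⟩ }
  refine ⟨G, ?_⟩
  ext e
  induction e using Sym2.ind with
  | _ a b =>
    constructor
    · intro h
      obtain ⟨x, y, rfl, rfl, h⟩ := exists_of_mem_edgeImage h
      exact ((mem_edgeImage (G := G) hlab).1 h : G.Adj x y)
    · intro h
      obtain ⟨ha, hb, -⟩ := hE a b h
      obtain ⟨x, -, rfl⟩ := mem_image.1 ha
      obtain ⟨y, -, rfl⟩ := mem_image.1 hb
      exact (mem_edgeImage hlab).2 h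

lemma connected_iff_cutConnected [Nonempty P] (hlab : Function.Injective lab)
    (G : SimpleGraph P) :
    G.Connected ↔ CutConnected (univ.image lab) (edgeImage lab G) := by
  constructor
  · intro h A x hx hxA y hy hyA
    obtain ⟨x, -, rfl⟩ := mem_image.1 hx
    obtain ⟨y, -, rfl⟩ := mem_image.1 hy
    obtain ⟨p⟩ := h.preconnected x y
    obtain ⟨d, -, h1, h2⟩ := p.exists_boundary_dart (lab ⁻¹' A) hxA hyA
    exact ⟨_, _, (mem_edgeImage hlab).2 d.adj, h1, h2⟩
  · intro h
    refine ⟨fun x y => ?_⟩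
    by_contra hxy
    obtain ⟨u, v, huv, ⟨u', hu, rfl⟩, hv⟩ := h (lab '' {z | G.Reachable x z}) (lab x)
      (mem_image_of_mem _ (mem_univ _)) ⟨x, SimpleGraph.Reachable.refl x, rfl⟩ (lab y)
      (mem_image_of_mem _ (mem_univ _)) (by
        rintro ⟨z, hz, hzy⟩
        rw [hlab hzy] at hz
        exact hxy hz)
    obtain ⟨a, b, ha, rfl, hab⟩ := exists_of_mem_edgeImage huv
    rw [hlab ha] at hu
    exact hv ⟨b, SimpleGraph.Reachable.trans hu hab.reachable, rfl⟩

lemma card_edgeImage (hlab : Function.Injective lab) (G : SimpleGraph P) :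
    (edgeImage lab G).card = Nat.card G.edgeSet := by
  rw [edgeImage, card_image_of_injective _ (Sym2.map.injective hlab), Nat.card_eq_fintype_card,
    SimpleGraph.edgeFinset, Set.toFinset_card]

lemma isTree_iff_isTreeOn [Nonempty P] (hlab : Function.Injective lab) (G : SimpleGraph P) :
    G.IsTree ↔ IsTreeOn (univ.image lab) (edgeImage lab G) := by
  rw [SimpleGraph.isTree_iff_connected_and_card, IsTreeOn, connected_iff_cutConnected hlab,
    card_edgeImage hlab, card_image_of_injective _ hlab, Nat.card_eq_fintype_card (α := P),
    card_univ]

lemma isMatchingGraph_iff (hlab : Function.Injective lab) (G : SimpleGraph P) :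
    IsMatchingGraph G ↔ IsMatchingSet (edgeImage lab G) := by
  constructor
  · intro h a b c hab hac
    obtain ⟨x, y, rfl, rfl, hxy⟩ := exists_of_mem_edgeImage hab
    obtain ⟨x', z, hx, rfl, hxz⟩ := exists_of_mem_edgeImage hac
    obtain rfl := hlab hx
    rw [h x hxy hxz]
  · intro h x y hy z hz
    exact hlab (h _ _ _ ((mem_edgeImage hlab).2 hy) ((mem_edgeImage hlab).2 hz))

/-- The bridge from the counts of the statement to counts of labelled edge sets: graphs correspond
bijectively to members of `graphsOn`. -/
lemma ncard_simpleGraph (hlab : Function.Injective lab) {Q : SimpleGraph P → Prop}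
    {R : Finset (Sym2 ℕ) → Prop} [DecidablePred R] (h : ∀ G, Q G ↔ R (edgeImage lab G)) :
    Set.ncard {G | Q G} = #{E ∈ graphsOn (univ.image lab) | R E} := by
  rw [← Set.ncard_coe_finset, ← Set.ncard_image_of_injective _ (edgeImage_injective hlab)]
  congr 1
  ext E
  rw [mem_coe, mem_filter]
  constructor
  · rintro ⟨G, hG, rfl⟩
    exact ⟨edgeImage_mem_graphsOn hlab G, (h G).1 hG⟩
  · rintro ⟨hE, hR⟩
    obtain ⟨G, rfl⟩ := exists_edgeImage_eq hlab hE
    exact ⟨G, (h G).2 hR, rfl⟩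

end Bridge

/-! ### Unions of trees. -/

lemma CutConnected.card_le {U : Finset ℕ} {E : Finset (Sym2 ℕ)} (hE : E ∈ graphsOn U)
    (h : CutConnected U E) : U.card ≤ E.card + 1 := by
  rcases U.eq_empty_or_nonempty with rfl | hU
  · simp
  have : Nonempty U := hU.to_subtype
  have hlab : Function.Injective (Subtype.val : U → ℕ) := Subtype.val_injective
  have himg : univ.image (Subtype.val : U → ℕ) = U := by ext; simp
  rw [← himg] at hE h
  obtain ⟨G, rfl⟩ := exists_edgeImage_eq hlab hE
  have := ((connected_iff_cutConnected hlab G).2 h).card_vert_le_card_edgeSet_add_one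
  rw [card_edgeImage hlab]
  simpa using this

/-- Inclusion-exclusion for vertices and edges makes the excess `#E + 1 - #U` additive, with excess
`0` on the intersection. For connected parts both excesses are nonnegative, so their sum vanishes
only if each does. -/
lemma isTreeOn_union {U₁ U₂ : Finset ℕ} {E₁ E₂ : Finset (Sym2 ℕ)}
    (hE₁ : E₁ ∈ graphsOn U₁) (hE₂ : E₂ ∈ graphsOn U₂) (hI : IsTreeOn (U₁ ∩ U₂) (E₁ ∩ E₂)) :
    IsTreeOn (U₁ ∪ U₂) (E₁ ∪ E₂) ↔ IsTreeOn U₁ E₁ ∧ IsTreeOn U₂ E₂ := by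
  have hU := card_union_add_card_inter U₁ U₂
  have hE := card_union_add_card_inter E₁ E₂
  have hI2 := hI.2
  constructor
  · rintro ⟨hc, hcard⟩
    have c1 := CutConnected.left_of_union hE₁ hE₂ hI.1 hc
    have c2 := CutConnected.left_of_union hE₂ hE₁ (by rw [inter_comm, inter_comm E₂]; exact hI.1)
      (by rw [union_comm, union_comm E₂]; exact hc)
    have k1 := c1.card_le hE₁
    have k2 := c2.card_le hE₂
    exact ⟨⟨c1, by omega⟩, ⟨c2, by omega⟩⟩
  · rintro ⟨⟨c1, k1⟩, ⟨c2, k2⟩⟩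
    refine ⟨c1.union c2 ?_, by omega⟩
    rw [← card_pos]
    omega

/-! ### Product formulas -/

/-- The symmetries of a crossing relation. -/
structure IsCrossing (X : ℕ → ℕ → ℕ → ℕ → Prop) : Prop where
  swap : ∀ {a b c d}, X a b c d → X b a c d
  symm : ∀ {a b c d}, X a b c d → X c d a b
  ne : ∀ {a b c d}, X a b c d → a ≠ c

lemma mem_inter_sym2 {E : Finset (Sym2 ℕ)} {U : Finset ℕ} {a b : ℕ} :
    s(a, b) ∈ E ∩ U.sym2 ↔ s(a, b) ∈ E ∧ a ∈ U ∧ b ∈ U := by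
  rw [mem_inter, mk_mem_sym2_iff]

lemma inter_sym2_mem_graphsOn {E : Finset (Sym2 ℕ)} {U U' : Finset ℕ} (hE : E ∈ graphsOn U) :
    E ∩ U'.sym2 ∈ graphsOn U' := by
  rw [mem_graphsOn] at *
  intro a b h
  rw [mem_inter_sym2] at h
  exact ⟨h.2.1, h.2.2, (hE a b h.1).2.2⟩

/-- The common form of all product formulas: `C` holds the edges that are fixed in advance and lie
in neither part, and the rest is restricted to `U₁` and to `U₂`. -/
lemma card_eq_mul {U U₁ U₂ : Finset ℕ} {Q Q₁ Q₂ : Finset (Sym2 ℕ) → Prop} [DecidablePred Q]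
    [DecidablePred Q₁] [DecidablePred Q₂] (C : Finset (Sym2 ℕ))
    (hsplit : ∀ E ∈ graphsOn U, Q E → Q₁ (E ∩ U₁.sym2) ∧ Q₂ (E ∩ U₂.sym2) ∧
      C ∪ (E ∩ U₁.sym2 ∪ E ∩ U₂.sym2) = E)
    (hglue : ∀ E₁ ∈ graphsOn U₁, ∀ E₂ ∈ graphsOn U₂, Q₁ E₁ → Q₂ E₂ →
      C ∪ (E₁ ∪ E₂) ∈ graphsOn U ∧ Q (C ∪ (E₁ ∪ E₂)) ∧ (C ∪ (E₁ ∪ E₂)) ∩ U₁.sym2 = E₁ ∧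
        (C ∪ (E₁ ∪ E₂)) ∩ U₂.sym2 = E₂) :
    #{E ∈ graphsOn U | Q E} = #{E ∈ graphsOn U₁ | Q₁ E} * #{E ∈ graphsOn U₂ | Q₂ E} := by
  rw [← card_product]
  refine card_nbij' (fun E => (E ∩ U₁.sym2, E ∩ U₂.sym2)) (fun p => C ∪ (p.1 ∪ p.2)) ?_ ?_ ?_ ?_
  · intro E hE
    rw [mem_coe, mem_filter] at hE
    obtain ⟨h1, h2, -⟩ := hsplit E hE.1 hE.2
    rw [mem_coe, mem_product, mem_filter, mem_filter]
    exact ⟨⟨inter_sym2_mem_graphsOn hE.1, h1⟩, ⟨inter_sym2_mem_graphsOn hE.1, h2⟩⟩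
  · rintro ⟨E₁, E₂⟩ h
    rw [mem_coe, mem_product, mem_filter, mem_filter] at h
    obtain ⟨h1, h2, -⟩ := hglue E₁ h.1.1 E₂ h.2.1 h.1.2 h.2.2
    rw [mem_coe, mem_filter]
    exact ⟨h1, h2⟩
  · intro E hE
    rw [mem_coe, mem_filter] at hE
    exact (hsplit E hE.1 hE.2).2.2
  · rintro ⟨E₁, E₂⟩ h
    rw [mem_coe, mem_product, mem_filter, mem_filter] at h
    obtain ⟨-, -, h3, h4⟩ := hglue E₁ h.1.1 E₂ h.2.1 h.1.2 h.2.2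
    exact Prod.ext h3 h4

lemma crossingFree_union {X : ℕ → ℕ → ℕ → ℕ → Prop} (hX : IsCrossing X) {E F : Finset (Sym2 ℕ)}
    (hE : CrossingFree X E) (hF : CrossingFree X F)
    (h : ∀ a b c d, s(a, b) ∈ E → s(c, d) ∈ F → ¬ X a b c d) : CrossingFree X (E ∪ F) := by
  intro a b c d hab hcd hx
  rcases mem_union.1 hab with h1 | h1 <;> rcases mem_union.1 hcd with h2 | h2
  · exact hE a b c d h1 h2 hx
  · exact h a b c d h1 h2 hx
  · exact h c d a b h2 h1 (hX.symm hx)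
  · exact hF a b c d h1 h2 hx

lemma IsCrossing.not_self {X : ℕ → ℕ → ℕ → ℕ → Prop} (hX : IsCrossing X) (a b : ℕ) :
    CrossingFree X {s(a, b)} := by
  intro x y z t h1 h2 hx
  rw [mem_singleton, Sym2.eq_iff] at h1 h2
  rcases h1 with ⟨rfl, rfl⟩ | ⟨rfl, rfl⟩ <;> rcases h2 with ⟨rfl, rfl⟩ | ⟨rfl, rfl⟩
  · exact hX.ne hx rfl
  · exact hX.ne (hX.swap hx) rfl
  · exact hX.ne (hX.swap hx) rfl
  · exact hX.ne hx rfl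

lemma sym2_forall_of_mem_iff {E F : Finset (Sym2 ℕ)}
    (h : ∀ a b, s(a, b) ∈ E ↔ s(a, b) ∈ F) : E = F := by
  ext e
  induction e using Sym2.ind with
  | _ a b => exact h a b

/-- Crossing-free matchings that contain a separating edge. -/
lemma card_matchings_with {X : ℕ → ℕ → ℕ → ℕ → Prop} (hX : IsCrossing X) {U₁ U₂ : Finset ℕ}
    {a b : ℕ} (hab : a ≠ b) (ha₁ : a ∉ U₁) (ha₂ : a ∉ U₂) (hb₁ : b ∉ U₁) (hb₂ : b ∉ U₂)
    (hd : Disjoint U₁ U₂) (hsep : ∀ x ∈ U₁, ∀ y ∈ U₂, X a b x y)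
    (h₁ : ∀ x ∈ U₁, ∀ y ∈ U₁, ¬ X a b x y) (h₂ : ∀ x ∈ U₂, ∀ y ∈ U₂, ¬ X a b x y)
    (h₁₂ : ∀ x ∈ U₁, ∀ y ∈ U₁, ∀ z ∈ U₂, ∀ t ∈ U₂, ¬ X x y z t) :
    #{E ∈ graphsOn (insert a (insert b (U₁ ∪ U₂))) |
      (CrossingFree X E ∧ IsMatchingSet E) ∧ s(a, b) ∈ E} =
      matchCount X U₁ * matchCount X U₂ := by
  have hd' := disjoint_left.1 hd
  refine card_eq_mul {s(a, b)} ?_ ?_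
  · rintro E hE ⟨⟨hc, hm⟩, habE⟩
    refine ⟨⟨hc.mono inter_subset_left, hm.mono inter_subset_left⟩,
      ⟨hc.mono inter_subset_left, hm.mono inter_subset_left⟩, ?_⟩
    refine sym2_forall_of_mem_iff fun x y => ?_
    rw [mem_union, mem_union, mem_inter_sym2, mem_inter_sym2, mem_singleton]
    constructor
    · rintro (h | h | h)
      · rwa [h]
      · exact h.1
      · exact h.1
    · intro h
      have hba : s(b, a) ∈ E := by rwa [Sym2.eq_swap]
      have h' : s(y, x) ∈ E := by rwa [Sym2.eq_swap]
      obtain ⟨hx, hy, -⟩ := mem_graphsOn.1 hE x y h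
      simp only [mem_insert, mem_union] at hx hy
      -- The vertices `a` and `b` are already matched to each other, and an edge from `U₁` to `U₂`
      -- would cross `ab`.
      rcases hx with rfl | rfl | hx
      · rw [hm _ _ _ h habE]; exact Or.inl rfl
      · rw [hm _ _ _ h hba]; exact Or.inl Sym2.eq_swap
      rcases hy with rfl | rfl | hy
      · rw [hm _ _ _ h' habE]; exact Or.inl Sym2.eq_swap
      · rw [hm _ _ _ h' hba]; exact Or.inl rfl
      rcases hx with hx | hx <;> rcases hy with hy | hy
      · exact Or.inr (Or.inl ⟨h, hx, hy⟩)
      · exact absurd (hsep x hx y hy) (hc _ _ _ _ habE h)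
      · exact absurd (hsep y hy x hx) (hc _ _ _ _ habE h')
      · exact Or.inr (Or.inr ⟨h, hx, hy⟩)
  · rintro E₁ hE₁ E₂ hE₂ ⟨hc₁, hm₁⟩ ⟨hc₂, hm₂⟩
    have g₁ := mem_graphsOn.1 hE₁
    have g₂ := mem_graphsOn.1 hE₂
    have hE : {s(a, b)} ∪ (E₁ ∪ E₂) ∈ graphsOn (insert a (insert b (U₁ ∪ U₂))) := by
      rw [mem_graphsOn]
      intro x y h
      rw [mem_union, mem_union, mem_singleton, Sym2.eq_iff] at h
      simp only [mem_insert, mem_union]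
      rcases h with (⟨rfl, rfl⟩ | ⟨rfl, rfl⟩) | h | h
      · simp [hab]
      · simp [hab.symm]
      · have := g₁ x y h; tauto
      · have := g₂ x y h; tauto
    refine ⟨hE, ⟨⟨?_, ?_⟩, by simp⟩, ?_, ?_⟩
    · refine crossingFree_union hX (hX.not_self a b) (crossingFree_union hX hc₁ hc₂ ?_) ?_
      · intro x y z t h h'
        obtain ⟨hx, hy, -⟩ := g₁ x y h
        obtain ⟨hz, ht, -⟩ := g₂ z t h'
        exact h₁₂ x hx y hy z hz t ht
      · intro x y z t h h' hx
        have : X a b z t := by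
          rw [mem_singleton, Sym2.eq_iff] at h
          rcases h with ⟨rfl, rfl⟩ | ⟨rfl, rfl⟩
          exacts [hx, hX.swap hx]
        rcases mem_union.1 h' with h' | h'
        · exact h₁ z (g₁ z t h').1 t (g₁ z t h').2.1 this
        · exact h₂ z (g₂ z t h').1 t (g₂ z t h').2.1 this
    · intro x y z h h'
      simp only [mem_union, mem_singleton, Sym2.eq_iff] at h h'
      have k₁ := fun y h => g₁ x y h
      have k₂ := fun y h => g₂ x y h
      rcases h with h | h | h <;> rcases h' with h' | h' | h'
      · rcases h with ⟨rfl, rfl⟩ | ⟨rfl, rfl⟩ <;> rcases h' with ⟨h1, h2⟩ | ⟨h1, h2⟩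
        exacts [h2.symm, absurd h1 hab, absurd h1.symm hab, h2.symm]
      · have := k₁ _ h'; rcases h with ⟨rfl, rfl⟩ | ⟨rfl, rfl⟩ <;> tauto
      · have := k₂ _ h'; rcases h with ⟨rfl, rfl⟩ | ⟨rfl, rfl⟩ <;> tauto
      · have := k₁ _ h; rcases h' with ⟨rfl, rfl⟩ | ⟨rfl, rfl⟩ <;> tauto
      · exact hm₁ _ _ _ h h'
      · exact absurd (k₂ _ h').1 (hd' (k₁ _ h).1)
      · have := k₂ _ h; rcases h' with ⟨rfl, rfl⟩ | ⟨rfl, rfl⟩ <;> tauto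
      · exact absurd (k₂ _ h).1 (hd' (k₁ _ h').1)
      · exact hm₂ _ _ _ h h'
    · refine sym2_forall_of_mem_iff fun x y => ?_
      rw [mem_inter_sym2, mem_union, mem_union, mem_singleton, Sym2.eq_iff]
      constructor
      · rintro ⟨(⟨rfl, rfl⟩ | ⟨rfl, rfl⟩) | h | h, hx, hy⟩
        exacts [absurd hx ha₁, absurd hx hb₁, h, absurd (g₂ x y h).1 (hd' hx)]
      · intro h
        exact ⟨Or.inr (Or.inl h), (g₁ x y h).1, (g₁ x y h).2.1⟩
    · refine sym2_forall_of_mem_iff fun x y => ?_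
      rw [mem_inter_sym2, mem_union, mem_union, mem_singleton, Sym2.eq_iff]
      constructor
      · rintro ⟨(⟨rfl, rfl⟩ | ⟨rfl, rfl⟩) | h | h, hx, hy⟩
        exacts [absurd hx ha₂, absurd hx hb₂, absurd hx (hd' (g₁ x y h).1), h]
      · intro h
        exact ⟨Or.inr (Or.inr h), (g₂ x y h).1, (g₂ x y h).2.1⟩

lemma isTreeOn_pair {a b : ℕ} (hab : a ≠ b) : IsTreeOn {a, b} {s(a, b)} := by
  refine ⟨?_, by rw [card_pair hab, card_singleton]⟩
  intro A x hx hxA y hy hyA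
  simp only [mem_insert, mem_singleton] at hx hy ⊢
  rcases hx with rfl | rfl <;> rcases hy with rfl | rfl
  exacts [absurd hxA hyA, ⟨_, _, rfl, hxA, hyA⟩, ⟨_, _, Sym2.eq_swap, hxA, hyA⟩, absurd hxA hyA]

lemma isTreeOn_singleton (v : ℕ) : IsTreeOn {v} ∅ := by
  refine ⟨?_, by simp⟩
  intro A x hx hxA y hy hyA
  rw [mem_singleton] at hx hy
  subst hx hy
  exact absurd hxA hyA

/-- Crossing-free spanning trees that contain a separating edge. -/
lemma treeCountWith_union {X : ℕ → ℕ → ℕ → ℕ → Prop} (hX : IsCrossing X) {U₁ U₂ : Finset ℕ}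
    {a b : ℕ} (hab : a ≠ b) (hI : U₁ ∩ U₂ = {a, b})
    (hsep : ∀ x ∈ U₁, x ∉ U₂ → ∀ y ∈ U₂, y ∉ U₁ → X a b x y)
    (h₁₂ : ∀ x ∈ U₁, ∀ y ∈ U₁, ∀ z ∈ U₂, ∀ t ∈ U₂, ¬ X x y z t) :
    treeCountWith X (U₁ ∪ U₂) s(a, b) =
      treeCountWith X U₁ s(a, b) * treeCountWith X U₂ s(a, b) := by
  have haI : a ∈ U₁ ∩ U₂ := by rw [hI]; simp
  have hbI : b ∈ U₁ ∩ U₂ := by rw [hI]; simp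
  have hIe : ∀ {x y}, x ∈ U₁ → x ∈ U₂ → y ∈ U₁ → y ∈ U₂ → x ≠ y → s(x, y) = s(a, b) := by
    intro x y hx1 hx2 hy1 hy2 hxy
    have hx : x ∈ U₁ ∩ U₂ := mem_inter.2 ⟨hx1, hx2⟩
    have hy : y ∈ U₁ ∩ U₂ := mem_inter.2 ⟨hy1, hy2⟩
    rw [hI, mem_insert, mem_singleton] at hx hy
    rw [Sym2.eq_iff]
    rcases hx with rfl | rfl <;> rcases hy with rfl | rfl <;> tauto
  have hinter : ∀ E₁ ∈ graphsOn U₁, ∀ E₂ ∈ graphsOn U₂, s(a, b) ∈ E₁ → s(a, b) ∈ E₂ →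
      E₁ ∩ E₂ = {s(a, b)} := by
    intro E₁ hE₁ E₂ hE₂ h1 h2
    refine sym2_forall_of_mem_iff fun x y => ?_
    rw [mem_inter, mem_singleton]
    constructor
    · rintro ⟨k1, k2⟩
      obtain ⟨hx1, hy1, hxy⟩ := mem_graphsOn.1 hE₁ x y k1
      obtain ⟨hx2, hy2, -⟩ := mem_graphsOn.1 hE₂ x y k2
      exact hIe hx1 hx2 hy1 hy2 hxy
    · intro h
      rw [h]
      exact ⟨h1, h2⟩
  have htree : ∀ E₁ ∈ graphsOn U₁, ∀ E₂ ∈ graphsOn U₂, s(a, b) ∈ E₁ → s(a, b) ∈ E₂ →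
      (IsTreeOn (U₁ ∪ U₂) (E₁ ∪ E₂) ↔ IsTreeOn U₁ E₁ ∧ IsTreeOn U₂ E₂) := by
    intro E₁ hE₁ E₂ hE₂ h1 h2
    refine isTreeOn_union hE₁ hE₂ ?_
    rw [hinter E₁ hE₁ E₂ hE₂ h1 h2, hI]
    exact isTreeOn_pair hab
  refine card_eq_mul ∅ ?_ ?_
  · rintro E hE ⟨hc, ht, habE⟩
    -- An edge from `U₁ \ U₂` to `U₂ \ U₁` would cross `ab`, so each edge lies within one part.
    have hEe : E ∩ U₁.sym2 ∪ E ∩ U₂.sym2 = E := by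
      refine sym2_forall_of_mem_iff fun x y => ?_
      rw [mem_union, mem_inter_sym2, mem_inter_sym2]
      refine ⟨fun h => h.elim And.left And.left, fun h => ?_⟩
      obtain ⟨hx, hy, -⟩ := mem_graphsOn.1 hE x y h
      have k1 := hsep x
      have k2 := hsep y
      have k3 := hc a b x y habE h
      have k4 := hc a b y x habE (by rwa [Sym2.eq_swap])
      rw [mem_union] at hx hy
      grind
    have e1 : s(a, b) ∈ E ∩ U₁.sym2 :=
      mem_inter_sym2.2 ⟨habE, (mem_inter.1 haI).1, (mem_inter.1 hbI).1⟩
    have e2 : s(a, b) ∈ E ∩ U₂.sym2 :=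
      mem_inter_sym2.2 ⟨habE, (mem_inter.1 haI).2, (mem_inter.1 hbI).2⟩
    have ht' := (htree _ (inter_sym2_mem_graphsOn hE) _ (inter_sym2_mem_graphsOn hE) e1 e2).1
      (by rw [hEe]; exact ht)
    refine ⟨⟨hc.mono inter_subset_left, ht'.1, e1⟩, ⟨hc.mono inter_subset_left, ht'.2, e2⟩, ?_⟩
    rw [empty_union, hEe]
  · rintro E₁ hE₁ E₂ hE₂ ⟨hc₁, ht₁, e₁⟩ ⟨hc₂, ht₂, e₂⟩
    have g₁ := mem_graphsOn.1 hE₁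
    have g₂ := mem_graphsOn.1 hE₂
    rw [empty_union]
    refine ⟨graphsOn_union (graphsOn_mono subset_union_left hE₁)
      (graphsOn_mono subset_union_right hE₂),
      ⟨crossingFree_union hX hc₁ hc₂ ?_, (htree E₁ hE₁ E₂ hE₂ e₁ e₂).2 ⟨ht₁, ht₂⟩,
        mem_union_left _ e₁⟩, ?_, ?_⟩
    · intro x y z t h h'
      exact h₁₂ x (g₁ x y h).1 y (g₁ x y h).2.1 z (g₂ z t h').1 t (g₂ z t h').2.1
    · refine sym2_forall_of_mem_iff fun x y => ?_
      rw [mem_inter_sym2, mem_union]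
      constructor
      · rintro ⟨h | h, hx, hy⟩
        · exact h
        · rw [hIe hx (g₂ x y h).1 hy (g₂ x y h).2.1 (g₂ x y h).2.2]
          exact e₁
      · intro h
        exact ⟨Or.inl h, (g₁ x y h).1, (g₁ x y h).2.1⟩
    · refine sym2_forall_of_mem_iff fun x y => ?_
      rw [mem_inter_sym2, mem_union]
      constructor
      · rintro ⟨h | h, hx, hy⟩
        · rw [hIe (g₁ x y h).1 hx (g₁ x y h).2.1 hy (g₁ x y h).2.2]
          exact e₂
        · exact h
      · intro h
        exact ⟨Or.inr h, (g₂ x y h).1, (g₂ x y h).2.1⟩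

lemma isTreeOn_union_of_inter_singleton {U₁ U₂ : Finset ℕ} {v : ℕ} (hI : U₁ ∩ U₂ = {v})
    {E₁ E₂ : Finset (Sym2 ℕ)} (hE₁ : E₁ ∈ graphsOn U₁) (hE₂ : E₂ ∈ graphsOn U₂) :
    IsTreeOn (U₁ ∪ U₂) (E₁ ∪ E₂) ↔ IsTreeOn U₁ E₁ ∧ IsTreeOn U₂ E₂ := by
  refine isTreeOn_union hE₁ hE₂ ?_
  have : E₁ ∩ E₂ = ∅ := by
    refine sym2_forall_of_mem_iff fun x y => ⟨fun h => ?_, fun h => absurd h (notMem_empty _)⟩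
    obtain ⟨h1, h2⟩ := mem_inter.1 h
    obtain ⟨hx1, hy1, hxy⟩ := mem_graphsOn.1 hE₁ x y h1
    obtain ⟨hx2, hy2, -⟩ := mem_graphsOn.1 hE₂ x y h2
    have hx : x ∈ U₁ ∩ U₂ := mem_inter.2 ⟨hx1, hx2⟩
    have hy : y ∈ U₁ ∩ U₂ := mem_inter.2 ⟨hy1, hy2⟩
    rw [hI, mem_singleton] at hx hy
    exact absurd (hx.trans hy.symm) hxy
  rw [this, hI]
  exact isTreeOn_singleton v

/-- Crossing-free spanning trees that are glued from two trees at a vertex. -/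
lemma card_trees_glue_vertex {X : ℕ → ℕ → ℕ → ℕ → Prop} (hX : IsCrossing X) {U₁ U₂ : Finset ℕ}
    {v : ℕ} (hI : U₁ ∩ U₂ = {v}) {e : Sym2 ℕ} (he : e ∈ U₁.sym2)
    (h₁₂ : ∀ x ∈ U₁, ∀ y ∈ U₁, ∀ z ∈ U₂, ∀ t ∈ U₂, ¬ X x y z t) :
    #{E ∈ graphsOn (U₁ ∪ U₂) | CrossingFree X E ∧ IsTreeOn (U₁ ∪ U₂) E ∧ e ∈ E ∧
      ∀ x y, s(x, y) ∈ E → (x ∈ U₁ ∧ y ∈ U₁) ∨ (x ∈ U₂ ∧ y ∈ U₂)} =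
      treeCountWith X U₁ e * treeCount X U₂ := by
  have hIe : ∀ {x y}, x ∈ U₁ → x ∈ U₂ → y ∈ U₁ → y ∈ U₂ → x = y := by
    intro x y hx1 hx2 hy1 hy2
    have hx : x ∈ U₁ ∩ U₂ := mem_inter.2 ⟨hx1, hx2⟩
    have hy : y ∈ U₁ ∩ U₂ := mem_inter.2 ⟨hy1, hy2⟩
    rw [hI, mem_singleton] at hx hy
    rw [hx, hy]
  refine card_eq_mul ∅ ?_ ?_
  · rintro E hE ⟨hc, ht, heE, hno⟩
    have hEe : E ∩ U₁.sym2 ∪ E ∩ U₂.sym2 = E := by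
      refine sym2_forall_of_mem_iff fun x y => ?_
      rw [mem_union, mem_inter_sym2, mem_inter_sym2]
      refine ⟨fun h => h.elim And.left And.left, fun h => ?_⟩
      have := hno x y h
      tauto
    have ht' := (isTreeOn_union_of_inter_singleton hI (inter_sym2_mem_graphsOn hE)
      (inter_sym2_mem_graphsOn hE)).1 (by rw [hEe]; exact ht)
    refine ⟨⟨hc.mono inter_subset_left, ht'.1, mem_inter.2 ⟨heE, he⟩⟩,
      ⟨hc.mono inter_subset_left, ht'.2⟩, ?_⟩
    rw [empty_union, hEe]
  · rintro E₁ hE₁ E₂ hE₂ ⟨hc₁, ht₁, e₁⟩ ⟨hc₂, ht₂⟩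
    have g₁ := mem_graphsOn.1 hE₁
    have g₂ := mem_graphsOn.1 hE₂
    rw [empty_union]
    refine ⟨graphsOn_union (graphsOn_mono subset_union_left hE₁)
      (graphsOn_mono subset_union_right hE₂),
      ⟨crossingFree_union hX hc₁ hc₂ ?_,
        (isTreeOn_union_of_inter_singleton hI hE₁ hE₂).2 ⟨ht₁, ht₂⟩,
        mem_union_left _ e₁, ?_⟩, ?_, ?_⟩
    · intro x y z t h h'
      exact h₁₂ x (g₁ x y h).1 y (g₁ x y h).2.1 z (g₂ z t h').1 t (g₂ z t h').2.1
    · intro x y h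
      rcases mem_union.1 h with h | h
      · exact Or.inl ⟨(g₁ x y h).1, (g₁ x y h).2.1⟩
      · exact Or.inr ⟨(g₂ x y h).1, (g₂ x y h).2.1⟩
    · refine sym2_forall_of_mem_iff fun x y => ?_
      rw [mem_inter_sym2, mem_union]
      constructor
      · rintro ⟨h | h, hx, hy⟩
        · exact h
        · exact absurd (hIe hx (g₂ x y h).1 hy (g₂ x y h).2.1) (g₂ x y h).2.2
      · intro h
        exact ⟨Or.inl h, (g₁ x y h).1, (g₁ x y h).2.1⟩
    · refine sym2_forall_of_mem_iff fun x y => ?_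
      rw [mem_inter_sym2, mem_union]
      constructor
      · rintro ⟨h | h, hx, hy⟩
        · exact absurd (hIe (g₁ x y h).1 hx (g₁ x y h).2.1 hy) (g₁ x y h).2.2
        · exact h
      · intro h
        exact ⟨Or.inr h, (g₂ x y h).1, (g₂ x y h).2.1⟩

/-- Joining two trees on disjoint vertex sets by an edge. -/
lemma isTreeOn_insert_union {U₁ U₂ : Finset ℕ} (hd : Disjoint U₁ U₂) {a b : ℕ} (ha : a ∈ U₁)
    (hb : b ∈ U₂) {E₁ E₂ : Finset (Sym2 ℕ)} (hE₁ : E₁ ∈ graphsOn U₁) (hE₂ : E₂ ∈ graphsOn U₂) :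
    IsTreeOn (U₁ ∪ U₂) (insert s(a, b) (E₁ ∪ E₂)) ↔ IsTreeOn U₁ E₁ ∧ IsTreeOn U₂ E₂ := by
  have hd' := disjoint_left.1 hd
  have hab : a ≠ b := fun h => hd' ha (h ▸ hb)
  have hp : ({s(a, b)} : Finset (Sym2 ℕ)) ∈ graphsOn {a, b} := by
    rw [mem_graphsOn]
    intro x y h
    rw [mem_singleton, Sym2.eq_iff] at h
    simp only [mem_insert, mem_singleton]
    rcases h with ⟨rfl, rfl⟩ | ⟨rfl, rfl⟩
    · simp [hab]
    · simp [hab.symm]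
  have hI1 : U₁ ∩ {a, b} = {a} := by
    ext x
    simp only [mem_inter, mem_insert, mem_singleton]
    constructor
    · rintro ⟨h1, rfl | rfl⟩
      exacts [rfl, absurd hb (hd' h1)]
    · rintro rfl
      exact ⟨ha, Or.inl rfl⟩
  have hI2 : (U₁ ∪ {a, b}) ∩ U₂ = {b} := by
    ext x
    simp only [mem_inter, mem_union, mem_insert, mem_singleton]
    constructor
    · rintro ⟨h1 | rfl | rfl, h⟩
      exacts [absurd h (hd' h1), absurd h (hd' ha), rfl]
    · rintro rfl
      exact ⟨Or.inr (Or.inr rfl), hb⟩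
  have hU : U₁ ∪ {a, b} ∪ U₂ = U₁ ∪ U₂ := by
    ext x
    simp only [mem_union, mem_insert, mem_singleton]
    constructor
    · rintro ((h | rfl | rfl) | h) <;> tauto
    · tauto
  have hE : insert s(a, b) (E₁ ∪ E₂) = (E₁ ∪ {s(a, b)}) ∪ E₂ := by
    ext e
    simp only [mem_insert, mem_union, mem_singleton]
    tauto
  rw [hE, ← hU, isTreeOn_union_of_inter_singleton hI2 (graphsOn_union
    (graphsOn_mono subset_union_left hE₁) (graphsOn_mono subset_union_right hp)) hE₂,
    isTreeOn_union_of_inter_singleton hI1 hE₁ hp]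
  have := isTreeOn_pair hab
  tauto

/-! ### Convex position -/

/-- `x` lies strictly between `a` and `b`. -/
def Between (a b x : ℕ) : Prop := (a < x ∧ x < b) ∨ (b < x ∧ x < a)

/-- The crossing relation of the diagonals of a convex polygon. -/
def DiagonalsCross (a b c d : ℕ) : Prop :=
  a ≠ c ∧ a ≠ d ∧ b ≠ c ∧ b ≠ d ∧ (Between a b c ↔ ¬ Between a b d)

lemma isCrossing_diagonalsCross : IsCrossing DiagonalsCross where
  swap := by unfold DiagonalsCross Between; intros; omega
  symm := by unfold DiagonalsCross Between; intros; omega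
  ne := fun h => h.1

lemma card_filter_exists {α ι : Type*} [DecidableEq α] {s : Finset α} {I : Finset ι}
    {p : ι → α → Prop} [∀ i, DecidablePred (p i)] {q : α → Prop} [DecidablePred q]
    (hq : ∀ x ∈ s, q x ↔ ∃ i ∈ I, p i x)
    (h : ∀ x ∈ s, ∀ i ∈ I, ∀ j ∈ I, p i x → p j x → i = j) :
    #{x ∈ s | q x} = ∑ i ∈ I, #{x ∈ s | p i x} := by
  rw [← card_biUnion]
  · congr 1
    ext x
    simp only [mem_filter, mem_biUnion]
    constructor
    · rintro ⟨hx, h⟩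
      obtain ⟨i, hi, hp⟩ := (hq x hx).1 h
      exact ⟨i, hi, hx, hp⟩
    · rintro ⟨i, hi, hx, hp⟩
      exact ⟨hx, (hq x hx).2 ⟨i, hi, hp⟩⟩
  · intro i hi j hj hij
    rw [Function.onFun, disjoint_left]
    intro x hx hx'
    rw [mem_filter] at hx hx'
    exact hij (h x hx.1 i hi j hj hx.2 hx'.2)

/-- The number of crossing-free matchings of `N` points in convex position. -/
noncomputable def convexMatchings (N : ℕ) : ℕ := matchCount DiagonalsCross (range N)

/-- The number of crossing-free spanning trees of `N` points in convex position. -/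
noncomputable def convexTrees (N : ℕ) : ℕ := treeCount DiagonalsCross (range N)

/-- Crossing of diagonals depends only on the order of the labels. The label of `x` is its rank, the
number of elements of `U` below `x`. -/
lemma exists_relabelling (U : Finset ℕ) : ∃ f : ℕ → ℕ, Set.InjOn f U ∧ U.image f = range #U ∧
    ∀ a ∈ U, ∀ b ∈ U, ∀ c ∈ U, ∀ d ∈ U,
      (DiagonalsCross a b c d ↔ DiagonalsCross (f a) (f b) (f c) (f d)) := by
  have hmono : ∀ x ∈ U, ∀ y ∈ U, x < y → #{z ∈ U | z < x} < #{z ∈ U | z < y} := by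
    intro x hx y hy hxy
    refine card_lt_card ⟨fun z hz => ?_, fun h => ?_⟩
    · rw [mem_filter] at hz ⊢
      exact ⟨hz.1, hz.2.trans hxy⟩
    · exact absurd (mem_filter.1 (h (mem_filter.2 ⟨hx, hxy⟩))).2 (lt_irrefl x)
  have hlt : ∀ x ∈ U, ∀ y ∈ U, (x < y ↔ #{z ∈ U | z < x} < #{z ∈ U | z < y}) := by
    intro x hx y hy
    refine ⟨hmono x hx y hy, fun h => ?_⟩
    by_contra! hle
    rcases hle.eq_or_lt with rfl | hlt
    · exact lt_irrefl _ h
    · exact lt_asymm h (hmono y hy x hx hlt)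
  have hinj : Set.InjOn (fun x => #{z ∈ U | z < x}) U := by
    intro x hx y hy h
    have h1 := hlt x hx y hy
    have h2 := hlt y hy x hx
    dsimp only at h
    omega
  refine ⟨fun x => #{z ∈ U | z < x}, hinj, ?_, ?_⟩
  · refine eq_of_subset_of_card_le ?_ (by rw [card_range, card_image_of_injOn hinj])
    intro i hi
    obtain ⟨x, hx, rfl⟩ := mem_image.1 hi
    rw [mem_range]
    refine card_lt_card ⟨filter_subset _ _, fun h => ?_⟩
    exact absurd (mem_filter.1 (h hx)).2 (lt_irrefl x)
  · intro a ha b hb c hc d hd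
    have hne : ∀ x ∈ U, ∀ y ∈ U, (x ≠ y ↔ #{z ∈ U | z < x} ≠ #{z ∈ U | z < y}) :=
      fun x hx y hy => (hinj.ne_iff hx hy).symm
    unfold DiagonalsCross Between
    rw [hne a ha c hc, hne a ha d hd, hne b hb c hc, hne b hb d hd, hlt a ha c hc, hlt c hc b hb,
      hlt b hb c hc, hlt c hc a ha, hlt a ha d hd, hlt d hd b hb, hlt b hb d hd, hlt d hd a ha]

lemma matchCount_diagonalsCross (U : Finset ℕ) :
    matchCount DiagonalsCross U = convexMatchings #U := by
  obtain ⟨f, hf, hU, h⟩ := exists_relabelling U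
  rw [matchCount_image hf h, hU, convexMatchings]

lemma treeCount_diagonalsCross (U : Finset ℕ) :
    treeCount DiagonalsCross U = convexTrees #U := by
  obtain ⟨f, hf, hU, h⟩ := exists_relabelling U
  rw [treeCount_image hf h, hU, convexTrees]

lemma card_range_sdiff_Icc {N i j : ℕ} (hij : i ≤ j) (hj : j < N) :
    #(range N \ Icc i j) = N - (j - i + 1) := by
  rw [card_sdiff_of_subset fun x hx => mem_range.2 ((mem_Icc.1 hx).2.trans_lt hj), card_range,
    Nat.card_Icc]
  omega

lemma graphsOn_empty : graphsOn ∅ = {∅} := by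
  ext E
  rw [mem_graphsOn, mem_singleton]
  constructor
  · intro h
    exact sym2_forall_of_mem_iff fun a b => ⟨fun hab => absurd (h a b hab).1 (notMem_empty _),
      fun hab => absurd hab (notMem_empty _)⟩
  · rintro rfl a b h
    exact absurd h (notMem_empty _)

/-! ### The Motzkin recursion for matchings. -/

lemma convexMatchings_zero : convexMatchings 0 = 1 := by
  rw [convexMatchings, matchCount, range_zero, graphsOn_empty, filter_true_of_mem, card_singleton]
  intro E hE
  rw [mem_singleton] at hE
  subst hE
  exact ⟨fun a b c d h => absurd h (notMem_empty _), fun a b c h => absurd h (notMem_empty _)⟩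

/-- The last vertex is either unmatched or matched to some `i`; that edge separates the `i` vertices
before `i` from the `N - 1 - i` after it. -/
lemma convexMatchings_succ (N : ℕ) : convexMatchings (N + 1) =
    convexMatchings N + ∑ i ∈ range N, convexMatchings i * convexMatchings (N - 1 - i) := by
  rw [convexMatchings, matchCount,
    ← card_filter_add_card_filter_not (p := fun E => ∃ i ∈ range N, s(N, i) ∈ E), add_comm]
  congr 1
  · rw [filter_filter, convexMatchings, matchCount]
    congr 1
    ext E
    simp only [mem_filter, mem_graphsOn]
    constructor
    · rintro ⟨hE, ⟨hc, hm⟩, hN⟩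
      refine ⟨fun a b hab => ?_, hc, hm⟩
      obtain ⟨ha, hb, hne⟩ := hE a b hab
      simp only [mem_range] at ha hb ⊢
      have h1 : a ≠ N := by
        rintro rfl
        exact hN ⟨b, by rw [mem_range]; omega, hab⟩
      have h2 : b ≠ N := by
        rintro rfl
        exact hN ⟨a, by rw [mem_range]; omega, by rwa [Sym2.eq_swap]⟩
      omega
    · rintro ⟨hE, hc, hm⟩
      refine ⟨fun a b hab => ?_, ⟨hc, hm⟩, ?_⟩
      · obtain ⟨ha, hb, hne⟩ := hE a b hab
        simp only [mem_range] at ha hb ⊢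
        omega
      · rintro ⟨i, -, hi⟩
        exact absurd (mem_range.1 (hE _ _ hi).1) (lt_irrefl _)
  · rw [filter_filter, card_filter_exists (I := range N)
      (p := fun i E => (CrossingFree DiagonalsCross E ∧ IsMatchingSet E) ∧ s(N, i) ∈ E)]
    · refine sum_congr rfl fun i hi => ?_
      rw [mem_range] at hi
      have hU : range (N + 1) = insert N (insert i (range i ∪ Ico (i + 1) N)) := by
        ext x
        simp only [mem_range, mem_insert, mem_union, mem_Ico]
        omega
      rw [hU, card_matchings_with isCrossing_diagonalsCross, matchCount_diagonalsCross,
        matchCount_diagonalsCross, card_range, Nat.card_Ico]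
      · congr 2
        omega
      · omega
      · simp; omega
      · simp
      · simp
      · simp
      · rw [disjoint_left]; simp; omega
      all_goals
        simp only [mem_range, mem_Ico, DiagonalsCross, Between]
        intros
        omega
    · intro E hE
      constructor
      · rintro ⟨h, i, hi, hE⟩
        exact ⟨i, hi, h, hE⟩
      · rintro ⟨i, hi, h, hE⟩
        exact ⟨h, i, hi, hE⟩
    · intro E hE i hi j hj h1 h2
      exact h1.1.2 _ _ _ h1.2 h2.2

/-! ### Two-component forests and the recursion for trees. -/

/-- The number of crossing-free forests on `N` points in convex position that become a tree when
the edge between `0` and `q` is added. -/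
noncomputable def rootedForests (N q : ℕ) : ℕ :=
  #{E ∈ graphsOn (range N) | CrossingFree DiagonalsCross E ∧ s(0, q) ∉ E ∧
    IsTreeOn (range N) (insert s(0, q) E)}

/-- The interval is the component of `q` in the forest. A missing vertex between two of its vertices
would be enclosed by an edge of the component, and its own connection to `0` would have to cross
that edge. -/
lemma exists_interval {N q : ℕ} (hq : 0 < q) (hqN : q < N) {E : Finset (Sym2 ℕ)}
    (hE : E ∈ graphsOn (range N)) (hc : CrossingFree DiagonalsCross E) (h0q : s(0, q) ∉ E)
    (ht : IsTreeOn (range N) (insert s(0, q) E)) :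
    ∃ i j, 1 ≤ i ∧ i ≤ q ∧ q ≤ j ∧ j < N ∧
      ∀ x y, s(x, y) ∈ E → (x ∈ Icc i j ↔ y ∈ Icc i j) := by
  obtain ⟨A, hqA, h0A, hA⟩ : ∃ A : Set ℕ, q ∈ A ∧ 0 ∉ A ∧ ∀ x y, s(x, y) ∈ E → x ∈ A → y ∈ A := by
    -- `E` has one edge too few to be connected. The cut it misses must be crossed by the edge from
    -- `0` to `q`, so it separates these two; `A` is the side of `q`.
    have hcon : ¬ CutConnected (range N) E := by
      intro h
      have h1 := h.card_le hE
      have h2 := ht.2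
      rw [card_insert_of_notMem h0q] at h2
      omega
    unfold CutConnected at hcon
    push Not at hcon
    obtain ⟨A, x, hx, hxA, y, hy, hyA, h⟩ := hcon
    obtain ⟨u, v, huv, hu, hv⟩ := ht.1 A x hx hxA y hy hyA
    rw [mem_insert, Sym2.eq_iff] at huv
    rcases huv with (⟨rfl, rfl⟩ | ⟨rfl, rfl⟩) | huv
    · refine ⟨Aᶜ, hv, fun h => h hu, fun x y hxy hx hy => hx ?_⟩
      rw [Sym2.eq_swap] at hxy
      exact h y x hxy hy
    · exact ⟨A, hu, hv, h⟩
    · exact absurd (h u v huv hu) hv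
  have hA' : ∀ x y, s(x, y) ∈ E → x ∉ A → y ∉ A := by
    intro x y hxy hx hy
    rw [Sym2.eq_swap] at hxy
    exact hx (hA y x hxy hy)
  have hconv : ∀ u x v, u ∈ A → v ∈ A → u < x → x < v → v < N → x ∈ A := by
    intro u x v hu hv hux hxv hvN
    by_contra hxA
    have hqx : q ≠ x := fun h => hxA (h ▸ hqA)
    -- An edge within `A` that jumps over `x`: on the side of `x` away from `q`, the part of `A`
    -- must be linked to the rest, and the added edge cannot do this since `0 ∉ A`.
    obtain ⟨p, r, hpr, hpA, hrA, hpx, hxr⟩ : ∃ p r, s(p, r) ∈ E ∧ p ∈ A ∧ r ∈ A ∧ p < x ∧ x < r := by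
      rcases lt_or_gt_of_ne hqx with hlt | hlt
      · obtain ⟨p, r, hpr, hp, hr⟩ := ht.1 {a | a ∈ A ∧ x < a} v (mem_range.2 hvN) ⟨hv, hxv⟩ q
          (mem_range.2 hqN) (fun h => absurd h.2 (by omega))
        rw [mem_insert, Sym2.eq_iff] at hpr
        rcases hpr with (⟨rfl, rfl⟩ | ⟨rfl, rfl⟩) | hpr
        · exact absurd hp.1 h0A
        · exact absurd hp.2 (by omega)
        · have hrA := hA p r hpr hp.1
          have hrx : r ≠ x := fun h => hxA (h ▸ hrA)
          have : ¬ x < r := fun h => hr ⟨hrA, h⟩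
          rw [Sym2.eq_swap] at hpr
          exact ⟨r, p, hpr, hrA, hp.1, by omega, hp.2⟩
      · obtain ⟨p, r, hpr, hp, hr⟩ := ht.1 {a | a ∈ A ∧ a < x} u (mem_range.2 (by omega)) ⟨hu, hux⟩ q
          (mem_range.2 hqN) (fun h => absurd h.2 (by omega))
        rw [mem_insert, Sym2.eq_iff] at hpr
        rcases hpr with (⟨rfl, rfl⟩ | ⟨rfl, rfl⟩) | hpr
        · exact absurd hp.1 h0A
        · exact absurd hp.2 (by omega)
        · have hrA := hA p r hpr hp.1
          have hrx : r ≠ x := fun h => hxA (h ▸ hrA)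
          have : ¬ r < x := fun h => hr ⟨hrA, h⟩
          exact ⟨p, r, hpr, hp.1, hrA, hp.2, by omega⟩
    -- The vertices outside `A` that are enclosed by `pr` must be linked to `0`, which lies outside;
    -- since the linking edge stays outside `A`, it crosses `pr`.
    obtain ⟨y, z, hyz, hy, hz⟩ := ht.1 {a | a ∉ A ∧ p < a ∧ a < r} x (mem_range.2 (by omega))
      ⟨hxA, hpx, hxr⟩ 0 (mem_range.2 (by omega)) (fun h => absurd h.2.1 (by omega))
    rw [mem_insert, Sym2.eq_iff] at hyz
    rcases hyz with (⟨rfl, rfl⟩ | ⟨rfl, rfl⟩) | hyz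
    · exact absurd hy.2.1 (by omega)
    · exact absurd hqA hy.1
    · have hzA := hA' y z hyz hy.1
      have hz' : ¬ (p < z ∧ z < r) := fun h => hz ⟨hzA, h⟩
      have hpz : p ≠ z := fun h => hzA (h ▸ hpA)
      have hrz : r ≠ z := fun h => hzA (h ▸ hrA)
      obtain ⟨-, h1, h2⟩ := hy
      refine hc p r y z hpr hyz ?_
      unfold DiagonalsCross Between
      omega
  have hne : ({x ∈ range N | x ∈ A}).Nonempty := ⟨q, mem_filter.2 ⟨mem_range.2 hqN, hqA⟩⟩
  set B := {x ∈ range N | x ∈ A} with hB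
  have hmin := mem_filter.1 (B.min'_mem hne)
  have hmax := mem_filter.1 (B.max'_mem hne)
  have hqB : q ∈ B := mem_filter.2 ⟨mem_range.2 hqN, hqA⟩
  have hBA : ∀ x ∈ range N, x ∈ Icc (B.min' hne) (B.max' hne) ↔ x ∈ A := by
    intro x hx
    rw [mem_Icc]
    constructor
    · rintro ⟨h1, h2⟩
      rcases h1.eq_or_lt with h1 | h1
      · rw [← h1]; exact hmin.2
      rcases h2.eq_or_lt with h2 | h2
      · rw [h2]; exact hmax.2
      exact hconv _ x _ hmin.2 hmax.2 h1 h2 (mem_range.1 hmax.1)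
    · intro h
      have : x ∈ B := mem_filter.2 ⟨hx, h⟩
      exact ⟨B.min'_le x this, B.le_max' x this⟩
  refine ⟨B.min' hne, B.max' hne, ?_, B.min'_le q hqB, B.le_max' q hqB, mem_range.1 hmax.1, ?_⟩
  · rw [Nat.one_le_iff_ne_zero]
    intro h
    rw [h] at hmin
    exact h0A hmin.2
  · intro x y hxy
    obtain ⟨hx, hy, -⟩ := mem_graphsOn.1 hE x y hxy
    rw [hBA x hx, hBA y hy]
    exact ⟨hA x y hxy, fun h => by_contra fun h' => hA' x y hxy h' h⟩

/-- The vertices of the first interval outside the second would form a cut crossed neither by `E`,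
which respects both intervals, nor by the edge from `0` to `q`, as it contains neither end. Applied
in both directions, the inclusion gives equality. -/
lemma interval_unique {N q i j i' j' : ℕ} (hqN : q < N) (hi : 1 ≤ i) (hiq : i ≤ q)
    (hqj : q ≤ j) (hjN : j < N) (hiq' : i' ≤ q) (hqj' : q ≤ j') {E : Finset (Sym2 ℕ)}
    (ht : IsTreeOn (range N) (insert s(0, q) E))
    (h : ∀ x y, s(x, y) ∈ E → (x ∈ Icc i j ↔ y ∈ Icc i j))
    (h' : ∀ x y, s(x, y) ∈ E → (x ∈ Icc i' j' ↔ y ∈ Icc i' j')) : i' ≤ i ∧ j ≤ j' := by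
  by_contra hcon
  obtain ⟨x, hx, hx'⟩ : ∃ x, x ∈ Icc i j ∧ x ∉ Icc i' j' := by
    simp only [mem_Icc]
    by_cases hii : i' ≤ i
    · exact ⟨j, by omega, by omega⟩
    · exact ⟨i, by omega, by omega⟩
  have hxN : x < N := by rw [mem_Icc] at hx; omega
  obtain ⟨u, v, huv, hu, hv⟩ := ht.1 {a | a ∈ Icc i j ∧ a ∉ Icc i' j'} x (mem_range.2 hxN)
    ⟨hx, hx'⟩ q (mem_range.2 hqN) (fun h => h.2 (mem_Icc.2 ⟨hiq', hqj'⟩))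
  rw [mem_insert, Sym2.eq_iff] at huv
  rcases huv with (⟨rfl, rfl⟩ | ⟨rfl, rfl⟩) | huv
  · exact absurd (mem_Icc.1 hu.1).1 (by omega)
  · exact hu.2 (mem_Icc.2 ⟨hiq', hqj'⟩)
  · exact hv ⟨(h u v huv).1 hu.1, fun hv' => hu.2 ((h' u v huv).2 hv')⟩

/-- The component of `q` is an interval `[i, j]` with `1 ≤ i ≤ q ≤ j`. Independent trees on this
interval and on its complement make up the forest; the two vertex sets are separated on the circle,
so no crossings arise between them. -/
lemma rootedForests_eq {N q : ℕ} (hq : 0 < q) (hqN : q < N) :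
    rootedForests N q = ∑ p ∈ Icc 1 q ×ˢ Ico q N,
      convexTrees (N - (p.2 - p.1 + 1)) * convexTrees (p.2 - p.1 + 1) := by
  rw [rootedForests, card_filter_exists (I := Icc 1 q ×ˢ Ico q N) (p := fun p E =>
    CrossingFree DiagonalsCross E ∧ (∀ x y, s(x, y) ∈ E → (x ∈ Icc p.1 p.2 ↔ y ∈ Icc p.1 p.2)) ∧
      IsTreeOn (range N) (insert s(0, q) E))]
  · refine sum_congr rfl ?_
    rintro ⟨i, j⟩ hij
    simp only [mem_product, mem_Icc, mem_Ico] at hij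
    dsimp only
    have hcount : treeCount DiagonalsCross (Icc i j) = convexTrees (j - i + 1) := by
      rw [treeCount_diagonalsCross, Nat.card_Icc]
      congr 1
      omega
    have hU : range N \ Icc i j ∪ Icc i j = range N := by
      refine sdiff_union_of_subset fun x hx => ?_
      rw [mem_Icc] at hx
      rw [mem_range]
      omega
    have hd : Disjoint (range N \ Icc i j) (Icc i j) := sdiff_disjoint
    have h0 : 0 ∈ range N \ Icc i j := by simp only [Finset.mem_sdiff, mem_range, mem_Icc]; omega
    have hqI : q ∈ Icc i j := mem_Icc.2 ⟨hij.1.2, hij.2.1⟩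
    rw [← card_range_sdiff_Icc (by omega) hij.2.2, ← treeCount_diagonalsCross, ← hcount, treeCount, treeCount]
    refine card_eq_mul ∅ ?_ ?_
    · rintro E hE ⟨hc, hI, ht⟩
      have hEe : E ∩ (range N \ Icc i j).sym2 ∪ E ∩ (Icc i j).sym2 = E := by
        refine sym2_forall_of_mem_iff fun x y => ?_
        rw [mem_union, mem_inter_sym2, mem_inter_sym2]
        refine ⟨fun h => h.elim And.left And.left, fun h => ?_⟩
        obtain ⟨hx, hy, -⟩ := mem_graphsOn.1 hE x y h
        have := hI x y h
        simp only [Finset.mem_sdiff]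
        tauto
      have ht' := (isTreeOn_insert_union hd h0 hqI (inter_sym2_mem_graphsOn hE)
        (inter_sym2_mem_graphsOn hE)).1 (by rw [hEe, hU]; exact ht)
      rw [empty_union]
      exact ⟨⟨hc.mono inter_subset_left, ht'.1⟩, ⟨hc.mono inter_subset_left, ht'.2⟩, hEe⟩
    · rintro E₁ hE₁ E₂ hE₂ ⟨hc₁, ht₁⟩ ⟨hc₂, ht₂⟩
      have g₁ := mem_graphsOn.1 hE₁
      have g₂ := mem_graphsOn.1 hE₂
      have hd' := disjoint_left.1 hd
      rw [empty_union]
      refine ⟨?_, ⟨crossingFree_union isCrossing_diagonalsCross hc₁ hc₂ ?_, ?_, ?_⟩, ?_, ?_⟩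
      · rw [← hU]
        exact graphsOn_union (graphsOn_mono subset_union_left hE₁)
          (graphsOn_mono subset_union_right hE₂)
      · intro x y z t h h'
        have h1 := g₁ x y h
        have h2 := g₂ z t h'
        simp only [Finset.mem_sdiff, mem_Icc, mem_range] at h1 h2
        unfold DiagonalsCross Between
        omega
      · intro x y h
        rcases mem_union.1 h with h | h
        · have h1 := g₁ x y h
          exact iff_of_false (hd' h1.1) (hd' h1.2.1)
        · have h2 := g₂ x y h
          exact iff_of_true h2.1 h2.2.1
      · have := (isTreeOn_insert_union hd h0 hqI hE₁ hE₂).2 ⟨ht₁, ht₂⟩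
        rwa [hU] at this
      · refine sym2_forall_of_mem_iff fun x y => ?_
        rw [mem_inter_sym2, mem_union]
        constructor
        · rintro ⟨h | h, hx, hy⟩
          exacts [h, absurd (g₂ x y h).1 (hd' hx)]
        · intro h
          exact ⟨Or.inl h, (g₁ x y h).1, (g₁ x y h).2.1⟩
      · refine sym2_forall_of_mem_iff fun x y => ?_
        rw [mem_inter_sym2, mem_union]
        constructor
        · rintro ⟨h | h, hx, hy⟩
          exacts [absurd hx (hd' (g₁ x y h).1), h]
        · intro h
          exact ⟨Or.inr h, (g₂ x y h).1, (g₂ x y h).2.1⟩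
  · intro E hE
    constructor
    · rintro ⟨hc, h0q, ht⟩
      obtain ⟨i, j, h1, h2, h3, h4, h5⟩ := exists_interval hq hqN hE hc h0q ht
      refine ⟨(i, j), ?_, hc, h5, ht⟩
      simp only [mem_product, mem_Icc, mem_Ico]
      omega
    · rintro ⟨⟨i, j⟩, hij, hc, hI, ht⟩
      simp only [mem_product, mem_Icc, mem_Ico] at hij hI
      refine ⟨hc, fun h => ?_, ht⟩
      have := hI _ _ h
      omega
  · rintro E hE ⟨i, j⟩ hij ⟨i', j'⟩ hij' ⟨-, hI, ht⟩ ⟨-, hI', -⟩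
    simp only [mem_product, mem_Icc, mem_Ico] at hij hij'
    have k1 := interval_unique hqN hij.1.1 hij.1.2 hij.2.1 hij.2.2 hij'.1.2 hij'.2.1 ht
      hI hI'
    have k2 := interval_unique hqN hij'.1.1 hij'.1.2 hij'.2.1 hij'.2.2 hij.1.2 hij.2.1 ht
      hI' hI
    rw [Prod.mk.injEq]
    omega

/-- Trees through a given edge that crosses nothing, counted in convex position. -/
lemma treeCountWith_eq_rootedForests {X : ℕ → ℕ → ℕ → ℕ → Prop} (hX : IsCrossing X)
    {U : Finset ℕ} {f : ℕ → ℕ} (hf : Set.InjOn f U) {a b N q : ℕ} (ha : a ∈ U) (hb : b ∈ U)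
    (hab : a ≠ b) (hU : U.image f = range N) (hfa : f a = 0) (hfb : f b = q)
    (hno : ∀ z ∈ U, ∀ t ∈ U, ¬ X a b z t)
    (hXf : ∀ x ∈ U, ∀ y ∈ U, ∀ z ∈ U, ∀ t ∈ U, s(x, y) ≠ s(a, b) → s(z, t) ≠ s(a, b) →
      (X x y z t ↔ DiagonalsCross (f x) (f y) (f z) (f t))) :
    treeCountWith X U s(a, b) = rootedForests N q := by
  rw [rootedForests, ← hU, ← card_filter_graphsOn_image hf (P := fun E => CrossingFree X E ∧
    s(a, b) ∉ E ∧ IsTreeOn U (insert s(a, b) E))]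
  · have hins : ∀ E ∈ graphsOn U, insert s(a, b) E ∈ graphsOn U := by
      intro E hE
      rw [mem_graphsOn]
      intro x y h
      rw [mem_insert, Sym2.eq_iff] at h
      rcases h with (⟨rfl, rfl⟩ | ⟨rfl, rfl⟩) | h
      exacts [⟨ha, hb, hab⟩, ⟨hb, ha, hab.symm⟩, mem_graphsOn.1 hE x y h]
    -- Deleting and reinserting `ab` are inverse; reinserting is harmless because `ab` crosses
    -- nothing inside `U`.
    refine card_nbij' (fun E => E.erase s(a, b)) (fun E => insert s(a, b) E) ?_ ?_ ?_ ?_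
    · intro E hE
      rw [mem_coe, mem_filter] at hE ⊢
      obtain ⟨hE, hc, ht, hm⟩ := hE
      refine ⟨graphsOn_subset (erase_subset _ _) hE, hc.mono (erase_subset _ _),
        notMem_erase _ _, ?_⟩
      rwa [insert_erase hm]
    · intro E hE
      rw [mem_coe, mem_filter] at hE ⊢
      obtain ⟨hE, hc, hm, ht⟩ := hE
      refine ⟨hins E hE, ?_, ht, mem_insert_self _ _⟩
      dsimp only
      rw [insert_eq]
      refine crossingFree_union hX (hX.not_self a b) hc fun x y z t h h' hx => ?_
      obtain ⟨hz, htU, -⟩ := mem_graphsOn.1 hE z t h'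
      rw [mem_singleton, Sym2.eq_iff] at h
      rcases h with ⟨rfl, rfl⟩ | ⟨rfl, rfl⟩
      exacts [hno z hz t htU hx, hno z hz t htU (hX.swap hx)]
    · intro E hE
      rw [mem_coe, mem_filter] at hE
      exact insert_erase hE.2.2.2
    · intro E hE
      rw [mem_coe, mem_filter] at hE
      exact erase_insert hE.2.2.1
  · intro E hE
    have h1 : s(0, q) ∈ E.image (Sym2.map f) ↔ s(a, b) ∈ E := by
      rw [← hfa, ← hfb, mem_image_map hf hE ha hb]
    have h2 : insert s(0, q) (E.image (Sym2.map f)) = (insert s(a, b) E).image (Sym2.map f) := by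
      rw [image_insert, Sym2.map_mk, hfa, hfb]
    have h3 : insert s(a, b) E ∈ graphsOn U := by
      rw [mem_graphsOn]
      intro x y h
      rw [mem_insert, Sym2.eq_iff] at h
      rcases h with (⟨rfl, rfl⟩ | ⟨rfl, rfl⟩) | h
      exacts [⟨ha, hb, hab⟩, ⟨hb, ha, hab.symm⟩, mem_graphsOn.1 hE x y h]
    rw [h1, h2, isTreeOn_image hf h3, and_left_comm, and_left_comm (b := s(a, b) ∉ E)]
    refine and_congr_right fun hn => and_congr_left fun _ => ?_
    rw [crossingFree_image hE]
    intro x y z t hxy hzt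
    obtain ⟨hx, hy, -⟩ := mem_graphsOn.1 hE x y hxy
    obtain ⟨hz, ht, -⟩ := mem_graphsOn.1 hE z t hzt
    exact hXf x hx y hy z hz t ht (fun h => hn (h ▸ hxy)) (fun h => hn (h ▸ hzt))

lemma convexTrees_one : convexTrees 1 = 1 := by
  rw [convexTrees, treeCount, card_eq_one]
  refine ⟨∅, ?_⟩
  ext E
  rw [mem_filter, mem_singleton]
  constructor
  · rintro ⟨hE, -, -, h⟩
    rw [card_range, Nat.add_eq_right, card_eq_zero] at h
    exact h
  · rintro rfl
    refine ⟨?_, ?_, isTreeOn_singleton 0⟩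
    · rw [mem_graphsOn]
      intro a b h
      exact absurd h (notMem_empty _)
    · intro a b c d h
      exact absurd h (notMem_empty _)

/-- Let `i` be the largest neighbour of `0`. No edge crosses `0i` and no later vertex is adjacent to
`0`, so the tree splits at the vertex `i` into a tree on `0, …, i` through the hull edge `0i` and a
tree on `i, …, N - 1`. -/
lemma convexTrees_eq {N : ℕ} (hN : 2 ≤ N) :
    convexTrees N = ∑ i ∈ Ico 1 N, rootedForests (i + 1) i * convexTrees (N - i) := by
  rw [convexTrees, treeCount, card_filter_exists (I := Ico 1 N) (p := fun i E =>
    CrossingFree DiagonalsCross E ∧ IsTreeOn (range N) E ∧ s(0, i) ∈ E ∧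
      ∀ x y, s(x, y) ∈ E → (x ∈ range (i + 1) ∧ y ∈ range (i + 1)) ∨ (x ∈ Ico i N ∧ y ∈ Ico i N))]
  · refine sum_congr rfl fun i hi => ?_
    rw [mem_Ico] at hi
    have hU : range N = range (i + 1) ∪ Ico i N := by
      ext x
      simp only [mem_range, mem_union, mem_Ico]
      omega
    have hI : range (i + 1) ∩ Ico i N = {i} := by
      ext x
      simp only [mem_range, mem_inter, mem_Ico, mem_singleton]
      omega
    have hW : treeCountWith DiagonalsCross (range (i + 1)) s(0, i) = rootedForests (i + 1) i := by
      refine treeCountWith_eq_rootedForests isCrossing_diagonalsCross (f := id)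
        Function.injective_id.injOn (by simp) (by simp) (by omega) (by simp) rfl rfl ?_ ?_
      · simp only [mem_range, DiagonalsCross, Between]
        intros
        omega
      · intros
        rfl
    rw [← hW, ← Nat.card_Ico, ← treeCount_diagonalsCross, ← card_trees_glue_vertex isCrossing_diagonalsCross hI, ← hU]
    · rw [mk_mem_sym2_iff]; simp
    · simp only [mem_range, mem_Ico, DiagonalsCross, Between]
      intros
      omega
  · intro E hE
    have g := mem_graphsOn.1 hE
    constructor
    · rintro ⟨hc, ht⟩
      -- The cut `{0}` is crossed, so `0` has a neighbour.
      have hne : ({i ∈ range N | s(0, i) ∈ E}).Nonempty := by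
        obtain ⟨u, v, huv, hu, hv⟩ := ht.1 {0} 0 (mem_range.2 (by omega)) rfl 1
          (mem_range.2 (by omega)) (by simp)
        rw [Set.mem_singleton_iff] at hu
        subst hu
        exact ⟨v, mem_filter.2 ⟨(g _ _ huv).2.1, huv⟩⟩
      set B := {i ∈ range N | s(0, i) ∈ E} with hB
      have hmax := mem_filter.1 (B.max'_mem hne)
      have hle : ∀ y, s(0, y) ∈ E → y ≤ B.max' hne := fun y hy =>
        B.le_max' y (mem_filter.2 ⟨(g _ _ hy).2.1, hy⟩)
      set i := B.max' hne
      have h0i := (g _ _ hmax.2).2.2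
      refine ⟨i, ?_, hc, ht, hmax.2, fun x y hxy => ?_⟩
      · rw [mem_Ico]
        exact ⟨by omega, mem_range.1 hmax.1⟩
      · obtain ⟨hx, hy, hne⟩ := g x y hxy
        have hcr := hc _ _ _ _ hmax.2 hxy
        have k1 : x = 0 → y ≤ i := by rintro rfl; exact hle y hxy
        have k2 : y = 0 → x ≤ i := by rintro rfl; exact hle x (by rwa [Sym2.eq_swap])
        simp only [mem_range, mem_Ico, DiagonalsCross, Between] at *
        omega
    · rintro ⟨i, hi, hc, ht, -⟩
      exact ⟨hc, ht⟩
  · rintro E hE i hi j hj ⟨-, -, h1, h2⟩ ⟨-, -, h3, h4⟩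
    have k1 := h2 _ _ h3
    have k2 := h4 _ _ h1
    simp only [mem_range, mem_Ico] at *
    omega

/-! ### Log-convexity of the number of matchings -/

/-- The generating function of the crossing-free matchings in convex position. -/
noncomputable def matchingSeries : PowerSeries ℤ :=
  PowerSeries.mk fun n => (convexMatchings n : ℤ)

lemma matchingSeries_eq : matchingSeries =
    1 + PowerSeries.X * matchingSeries + PowerSeries.X ^ 2 * matchingSeries ^ 2 := by
  ext n
  rcases n with _ | n
  · simp [matchingSeries, convexMatchings_zero]
  · rw [map_add, map_add, PowerSeries.coeff_succ_X_mul, PowerSeries.coeff_one,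
      if_neg (Nat.succ_ne_zero n), zero_add, matchingSeries, PowerSeries.coeff_mk,
      PowerSeries.coeff_mk, convexMatchings_succ, Nat.cast_add, add_right_inj]
    rcases n with _ | n
    · rw [PowerSeries.coeff_X_pow_mul', if_neg (by omega)]
      simp
    · rw [show n + 1 + 1 = n + 2 from rfl, PowerSeries.coeff_X_pow_mul, sq, PowerSeries.coeff_mul,
        Nat.sum_antidiagonal_eq_sum_range_succ_mk]
      push_cast
      refine sum_congr rfl fun i _ => ?_
      rw [PowerSeries.coeff_mk, PowerSeries.coeff_mk]

/-- The number of Motzkin path prefixes of length `n` and height `h`. -/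
noncomputable def motzkinPrefix (n h : ℕ) : ℤ :=
  PowerSeries.coeff n (PowerSeries.X ^ h * matchingSeries ^ (h + 1))

lemma motzkinPrefix_zero_right (n : ℕ) : motzkinPrefix n 0 = convexMatchings n := by
  simp [motzkinPrefix, matchingSeries]

lemma motzkinPrefix_zero_left (h : ℕ) : motzkinPrefix 0 (h + 1) = 0 := by
  rw [motzkinPrefix, PowerSeries.coeff_X_pow_mul', if_neg (by omega)]

/-- The last step of a prefix that ends at height `0` is level or comes down from height `1`. In
series form this is the functional equation itself. -/
lemma motzkinPrefix_succ_zero (n : ℕ) :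
    motzkinPrefix (n + 1) 0 = motzkinPrefix n 0 + motzkinPrefix n 1 := by
  have h : PowerSeries.X ^ 0 * matchingSeries ^ (0 + 1) = 1 + PowerSeries.X *
      (PowerSeries.X ^ 0 * matchingSeries ^ (0 + 1) +
        PowerSeries.X ^ 1 * matchingSeries ^ (1 + 1)) := by
    linear_combination matchingSeries_eq
  rw [motzkinPrefix, h, map_add, PowerSeries.coeff_succ_X_mul, map_add, PowerSeries.coeff_one,
    if_neg (Nat.succ_ne_zero n), zero_add]
  rfl

/-- Classification by the last step: up, level or down. The proof multiplies the functional equation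
by `X ^ (h + 1) * matchingSeries ^ (h + 1)`. -/
lemma motzkinPrefix_succ_succ (n h : ℕ) : motzkinPrefix (n + 1) (h + 1) =
    motzkinPrefix n h + motzkinPrefix n (h + 1) + motzkinPrefix n (h + 2) := by
  have h : PowerSeries.X ^ (h + 1) * matchingSeries ^ (h + 1 + 1) = PowerSeries.X *
      (PowerSeries.X ^ h * matchingSeries ^ (h + 1) +
        PowerSeries.X ^ (h + 1) * matchingSeries ^ (h + 1 + 1) +
        PowerSeries.X ^ (h + 2) * matchingSeries ^ (h + 2 + 1)) := by
    linear_combination PowerSeries.X ^ (h + 1) * matchingSeries ^ (h + 1) * matchingSeries_eq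
  rw [motzkinPrefix, h, PowerSeries.coeff_succ_X_mul, map_add, map_add]
  rfl

/-- The two-by-two minors of consecutive rows are nonnegative. By the three-term recurrence a minor
of the next rows is a sum of minors of the previous ones; the only possible one with columns in the
wrong order cancels against its mirror image. -/
lemma motzkinPrefix_minor (n : ℕ) : ∀ h h' : ℕ, h ≤ h' →
    motzkinPrefix n h' * motzkinPrefix (n + 1) h ≤ motzkinPrefix n h * motzkinPrefix (n + 1) h' := by
  induction n with
  | zero =>
    intro h h' hh
    have hnn : ∀ h, 0 ≤ motzkinPrefix 0 h := by
      rintro (_ | h)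
      · rw [motzkinPrefix_zero_right]; positivity
      · rw [motzkinPrefix_zero_left]
    rcases hh.eq_or_lt with rfl | hh
    · exact le_rfl
    obtain ⟨h', rfl⟩ : ∃ k, h' = k + 1 := ⟨h' - 1, by omega⟩
    have h1 : 0 ≤ motzkinPrefix 1 (h' + 1) := by
      rw [motzkinPrefix_succ_succ]
      have := hnn h'
      have := hnn (h' + 1)
      have := hnn (h' + 2)
      positivity
    rw [motzkinPrefix_zero_left, zero_mul]
    exact mul_nonneg (hnn h) h1
  | succ n ih =>
    intro h h' hh
    rcases hh.eq_or_lt with rfl | hh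
    · exact le_rfl
    obtain ⟨k, rfl⟩ : ∃ k, h' = k + 1 := ⟨h' - 1, by omega⟩
    have e1 := motzkinPrefix_succ_succ n k
    have e2 := motzkinPrefix_succ_succ (n + 1) k
    rcases h with _ | h
    · have e3 := motzkinPrefix_succ_zero n
      have e4 := motzkinPrefix_succ_zero (n + 1)
      rw [e1, e2, e3, e4]
      -- For `k = 0` the reversed column pair `(1, 0)` occurs and cancels against `(0, 1)`.
      rcases k with _ | k
      · have := ih 0 1 (by omega)
        have := ih 0 2 (by omega)
        have := ih 1 2 (by omega)
        simp only [zero_add] at *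
        linarith
      · have := ih 0 (k + 1) (by omega)
        have := ih 0 (k + 2) (by omega)
        have := ih 0 (k + 3) (by omega)
        have := ih 1 (k + 1) (by omega)
        have := ih 1 (k + 2) (by omega)
        have := ih 1 (k + 3) (by omega)
        simp only [add_assoc, Nat.reduceAdd] at *
        linarith
    · have e3 := motzkinPrefix_succ_succ n h
      have e4 := motzkinPrefix_succ_succ (n + 1) h
      rw [e1, e2, e3, e4]
      have := ih h k (by omega)
      have := ih h (k + 1) (by omega)
      have := ih h (k + 2) (by omega)
      have := ih (h + 1) k (by omega)
      have := ih (h + 1) (k + 1) (by omega)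
      have := ih (h + 1) (k + 2) (by omega)
      have := ih (h + 2) (k + 1) (by omega)
      have := ih (h + 2) (k + 2) (by omega)
      -- For `k = h + 1` the column pair `(h + 2, k)` is reversed and cancels against `(h + 1, k +
      -- 1)`.
      rcases (show h + 1 ≤ k by omega).eq_or_lt with rfl | hk
      · linarith
      · have := ih (h + 2) k (by omega)
        linarith

lemma convexMatchings_pos (n : ℕ) : 0 < convexMatchings n := by
  induction n with
  | zero => rw [convexMatchings_zero]; exact one_pos
  | succ n ih => rw [convexMatchings_succ]; omega

/-- The minor with columns `0` and `1`: the entries of column `1` are the differences of consecutive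
entries of column `0`, so this minor is exactly the log-convexity defect. -/
lemma convexMatchings_sq_le (n : ℕ) :
    convexMatchings (n + 1) * convexMatchings (n + 1) ≤
      convexMatchings n * convexMatchings (n + 2) := by
  have h := motzkinPrefix_minor n 0 1 zero_le_one
  have e1 := motzkinPrefix_succ_zero n
  have e2 := motzkinPrefix_succ_zero (n + 1)
  simp only [motzkinPrefix_zero_right] at h e1 e2
  zify
  rw [show n + 2 = n + 1 + 1 from rfl]
  generalize motzkinPrefix n 1 = a at *
  generalize motzkinPrefix (n + 1) 1 = b at *
  obtain rfl : a = convexMatchings (n + 1) - convexMatchings n := by linarith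
  obtain rfl : b = convexMatchings (n + 1 + 1) - convexMatchings (n + 1) := by linarith
  linarith

/-- The number of crossing-free matchings of points in convex position is log-convex. -/
lemma convexMatchings_mul_le {k m : ℕ} (h : k ≤ m) :
    convexMatchings (k + 1) * convexMatchings m ≤ convexMatchings k * convexMatchings (m + 1) := by
  induction m, h using Nat.le_induction with
  | base => exact (mul_comm _ _).le
  | succ m _ ih =>
    refine Nat.le_of_mul_le_mul_right ?_ (convexMatchings_pos m)
    calc convexMatchings (k + 1) * convexMatchings (m + 1) * convexMatchings m
        = convexMatchings (k + 1) * convexMatchings m * convexMatchings (m + 1) := by ring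
      _ ≤ convexMatchings k * convexMatchings (m + 1) * convexMatchings (m + 1) := by gcongr
      _ = convexMatchings k * (convexMatchings (m + 1) * convexMatchings (m + 1)) := by ring
      _ ≤ convexMatchings k * (convexMatchings m * convexMatchings (m + 2)) :=
          Nat.mul_le_mul_left _ (convexMatchings_sq_le m)
      _ = convexMatchings k * convexMatchings (m + 1 + 1) * convexMatchings m := by ring_nf

/-! ### The number of trees -/

/-- The generating function of the crossing-free spanning trees in convex position. -/
noncomputable def treeSeries : PowerSeries ℕ := PowerSeries.mk fun n => convexTrees (n + 1)

/-- For the last vertex `q` the interval must end at `q`, and the sum over its start is a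
convolution of the tree numbers. -/
lemma rootedForests_last (k : ℕ) :
    rootedForests (k + 2) (k + 1) = PowerSeries.coeff k (treeSeries ^ 2) := by
  rw [rootedForests_eq (by omega) (by omega), sum_product, sq, PowerSeries.coeff_mul,
    Nat.sum_antidiagonal_eq_sum_range_succ_mk, show Icc 1 (k + 1) = Ico 1 (k + 2) from rfl,
    sum_Ico_eq_sum_range]
  refine sum_congr rfl fun i hi => ?_
  rw [mem_range] at hi
  rw [show Ico (k + 1) (k + 2) = {k + 1} by ext; simp, sum_singleton, treeSeries,
    PowerSeries.coeff_mk, PowerSeries.coeff_mk]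
  dsimp only
  congr 2 <;> omega

lemma convexTrees_add_two (k : ℕ) :
    convexTrees (k + 2) = PowerSeries.coeff k (treeSeries ^ 3) := by
  rw [convexTrees_eq (by omega), pow_succ, PowerSeries.coeff_mul,
    Nat.sum_antidiagonal_eq_sum_range_succ_mk, sum_Ico_eq_sum_range]
  refine sum_congr rfl fun i hi => ?_
  rw [mem_range] at hi
  rw [← rootedForests_last, treeSeries, PowerSeries.coeff_mk, add_comm 1 i]
  congr 2
  omega

lemma treeSeries_eq : treeSeries = 1 + PowerSeries.X * treeSeries ^ 3 := by
  ext n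
  rcases n with _ | n
  · simp [treeSeries, convexTrees_one]
  · rw [map_add, PowerSeries.coeff_succ_X_mul, PowerSeries.coeff_one,
      if_neg (Nat.succ_ne_zero n), zero_add, ← convexTrees_add_two, treeSeries,
      PowerSeries.coeff_mk]

/-- The interval ends at `q` or at the one vertex after it. The two cases are the convolutions `T ^
3 * T` and `T * T ^ 3`, because a tree number with index at least `2` is a coefficient of `T ^ 3`.
-/
lemma rootedForests_last_but_one (k : ℕ) :
    rootedForests (k + 3) (k + 1) = 2 * PowerSeries.coeff k (treeSeries ^ 4) := by
  have h1 : PowerSeries.coeff k (treeSeries ^ 4) =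
      ∑ i ∈ range (k + 1), convexTrees (i + 2) * convexTrees (k - i + 1) := by
    rw [pow_succ, PowerSeries.coeff_mul, Nat.sum_antidiagonal_eq_sum_range_succ_mk]
    refine sum_congr rfl fun i hi => ?_
    rw [← convexTrees_add_two, treeSeries, PowerSeries.coeff_mk]
  have h2 : PowerSeries.coeff k (treeSeries ^ 4) =
      ∑ i ∈ range (k + 1), convexTrees (i + 1) * convexTrees (k - i + 2) := by
    rw [pow_succ', PowerSeries.coeff_mul, Nat.sum_antidiagonal_eq_sum_range_succ_mk]
    refine sum_congr rfl fun i hi => ?_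
    rw [← convexTrees_add_two, treeSeries, PowerSeries.coeff_mk]
  rw [two_mul]
  nth_rw 1 [h1]
  rw [h2, ← sum_add_distrib, rootedForests_eq (by omega) (by omega), sum_product,
    show Icc 1 (k + 1) = Ico 1 (k + 2) from rfl, sum_Ico_eq_sum_range]
  refine sum_congr rfl fun i hi => ?_
  rw [mem_range] at hi
  rw [show Ico (k + 1) (k + 3) = {k + 1, k + 2} by ext; simp; omega, sum_pair (by omega)]
  dsimp only
  congr 3 <;> omega

/-- The functional equation times `T ^ r`. It drives the double induction, on the degree and then on
the exponent, that proves the Fuss-Catalan formula. -/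
lemma coeff_treeSeries_pow_succ (r k : ℕ) : PowerSeries.coeff (k + 1) (treeSeries ^ (r + 1)) =
    PowerSeries.coeff (k + 1) (treeSeries ^ r) + PowerSeries.coeff k (treeSeries ^ (r + 3)) := by
  have h : treeSeries ^ (r + 1) = treeSeries ^ r + PowerSeries.X * treeSeries ^ (r + 3) := by
    rw [pow_succ]
    nth_rw 2 [treeSeries_eq]
    ring
  rw [h, map_add, PowerSeries.coeff_succ_X_mul]

lemma coeff_zero_treeSeries_pow (r : ℕ) : PowerSeries.coeff 0 (treeSeries ^ r) = 1 := by
  rw [PowerSeries.coeff_zero_eq_constantCoeff_apply, map_pow,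
    ← PowerSeries.coeff_zero_eq_constantCoeff_apply, treeSeries, PowerSeries.coeff_mk,
    convexTrees_one, one_pow]

/-- The Fuss-Catalan formula. -/
lemma coeff_treeSeries_pow (k : ℕ) : ∀ r : ℕ,
    (k + 1) * PowerSeries.coeff (k + 1) (treeSeries ^ r) = r * (3 * k + r + 2).choose k := by
  induction k with
  | zero =>
    intro r
    induction r with
    | zero => simp
    | succ r ih =>
      rw [coeff_treeSeries_pow_succ, mul_add, ih, coeff_zero_treeSeries_pow]
      simp
  | succ k ihk =>
    intro r
    induction r with
    | zero => simp
    | succ r ih =>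
      have hk := ihk (r + 3)
      rw [coeff_treeSeries_pow_succ, mul_add, ih]
      have e1 := Nat.choose_succ_succ (3 * k + r + 5) k
      have e2 := Nat.choose_succ_right_eq (3 * k + r + 5) k
      rw [show 3 * (k + 1) + r + 2 = 3 * k + r + 5 by ring,
        show 3 * (k + 1) + (r + 1) + 2 = 3 * k + r + 5 + 1 by ring, e1]
      rw [show 3 * k + (r + 3) + 2 = 3 * k + r + 5 by ring] at hk
      rw [show 3 * k + r + 5 - k = 2 * k + r + 5 by omega] at e2
      generalize (3 * k + r + 5).choose k = x at *
      rw [Nat.succ_eq_add_one] at *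
      generalize (3 * k + r + 5).choose (k + 1) = y at *
      generalize PowerSeries.coeff (k + 1) (treeSeries ^ (r + 3)) = g at *
      refine Nat.eq_of_mul_eq_mul_left (Nat.succ_pos k) ?_
      zify at *
      linear_combination (k + 2 : ℤ) * hk + (-1 : ℤ) * e2

/-- Both sides are explicit by the Fuss-Catalan formula. This gives the quotient of the two
coefficients as a rational function of `k`, whose growth decides the sign for trees. -/
lemma coeff_treeSeries_four (k : ℕ) :
    (k + 2) * (2 * k + 3) * PowerSeries.coeff k (treeSeries ^ 4) =
      3 * (k + 1) * (3 * k + 2) * PowerSeries.coeff k (treeSeries ^ 2) := by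
  rcases k with _ | k
  · simp [coeff_zero_treeSeries_pow]
  · have h4 := coeff_treeSeries_pow k 4
    have h2 := coeff_treeSeries_pow k 2
    have c1 := Nat.choose_mul_succ_eq (3 * k + 4) k
    have c2 := Nat.choose_mul_succ_eq (3 * k + 5) k
    rw [show 3 * k + 4 + 1 - k = 2 * k + 5 by omega] at c1
    rw [show 3 * k + 5 + 1 - k = 2 * k + 6 by omega] at c2
    rw [show 3 * k + 4 + 2 = 3 * k + 5 + 1 by ring] at h4
    rw [show 3 * k + 2 + 2 = 3 * k + 4 by ring] at h2
    rw [show 3 * k + 4 + 1 = 3 * k + 5 by ring] at c1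
    generalize (3 * k + 4).choose k = x at *
    generalize (3 * k + 5).choose k = y at *
    generalize (3 * k + 5 + 1).choose k = z at *
    generalize PowerSeries.coeff (k + 1) (treeSeries ^ 4) = g4 at *
    generalize PowerSeries.coeff (k + 1) (treeSeries ^ 2) = g2 at *
    refine Nat.eq_of_mul_eq_mul_left (Nat.succ_pos k) ?_
    zify at *
    linear_combination ((k : ℤ) + 3) * (2 * k + 5) * h4 - 3 * (k + 2) * (3 * k + 5) * h2 -
      2 * (2 * k + 5) * c2 - 2 * (3 * k + 6) * c1

/-- The ratio of forests with and without the extra vertex is increasing. -/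
lemma rootedForests_mul_le {k m : ℕ} (h : k ≤ m) :
    rootedForests (k + 3) (k + 1) * rootedForests (m + 2) (m + 1) ≤
      rootedForests (k + 2) (k + 1) * rootedForests (m + 3) (m + 1) := by
  simp only [rootedForests_last, rootedForests_last_but_one]
  have hk := coeff_treeSeries_four k
  have hm := coeff_treeSeries_four m
  generalize PowerSeries.coeff k (treeSeries ^ 4) = a at *
  generalize PowerSeries.coeff k (treeSeries ^ 2) = b at *
  generalize PowerSeries.coeff m (treeSeries ^ 4) = c at *
  generalize PowerSeries.coeff m (treeSeries ^ 2) = d at *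
  obtain ⟨l, rfl⟩ := Nat.exists_eq_add_of_le h
  -- Monotonicity of `(k + 1) * (3 * k + 2) / ((k + 2) * (2 * k + 3))`, with denominators cleared
  -- and `m = k + l`.
  have key : (k + 1) * (3 * k + 2) * ((k + l + 2) * (2 * (k + l) + 3)) ≤
      (k + l + 1) * (3 * (k + l) + 2) * ((k + 2) * (2 * k + 3)) := by
    zify
    nlinarith [Nat.zero_le (k * l)]
  refine Nat.le_of_mul_le_mul_left (c := (k + 2) * (2 * k + 3) * ((k + l + 2) * (2 * (k + l) + 3)))
    ?_ (by positivity)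
  calc (k + 2) * (2 * k + 3) * ((k + l + 2) * (2 * (k + l) + 3)) * (2 * a * d)
      = ((k + 2) * (2 * k + 3) * a) * ((k + l + 2) * (2 * (k + l) + 3)) * (2 * d) := by ring
    _ = 6 * b * d * ((k + 1) * (3 * k + 2) * ((k + l + 2) * (2 * (k + l) + 3))) := by rw [hk]; ring
    _ ≤ 6 * b * d * ((k + l + 1) * (3 * (k + l) + 2) * ((k + 2) * (2 * k + 3))) :=
        Nat.mul_le_mul_left _ key
    _ = 2 * b * ((k + 2) * (2 * k + 3)) * (3 * (k + l + 1) * (3 * (k + l) + 2) * d) := by ring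
    _ = _ := by rw [← hm]; ring

section Position

/-! ### Position of the extra point relative to the polygon -/

/-- `S` records a consistent position of an extra point relative to the convex polygon
`0, …, n - 1`: it consists of the pairs `a < b` for which the extra point lies on the same side of
the diagonal `ab` as the vertices between `a` and `b`. -/
structure IsPosition (n : ℕ) (S : Finset (ℕ × ℕ)) : Prop where
  lt : ∀ {a b}, (a, b) ∈ S → a < b ∧ b < n
  up : ∀ {a b c d}, (a, b) ∈ S → c ≤ a → b ≤ d → d < n → (c, d) ∈ S
  inter : ∀ {a b c d}, (a, b) ∈ S → (c, d) ∈ S → c < b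

/-- `x` lies on the same side of the diagonal `ab` as the vertices between `a` and `b`; the vertex
`n` is the extra point. -/
def OnCap (n : ℕ) (S : Finset (ℕ × ℕ)) (a b x : ℕ) : Prop :=
  if x = n then (min a b, max a b) ∈ S else Between a b x

/-- The crossing relation of the segments between the points of a conowheel set. -/
def WheelCross (n : ℕ) (S : Finset (ℕ × ℕ)) (a b c d : ℕ) : Prop :=
  (a ≠ c ∧ a ≠ d ∧ b ≠ c ∧ b ≠ d) ∧
    ((a ≠ n ∧ b ≠ n ∧ (OnCap n S a b c ↔ ¬ OnCap n S a b d)) ∨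
      (c ≠ n ∧ d ≠ n ∧ (OnCap n S c d a ↔ ¬ OnCap n S c d b)))

variable {n : ℕ} {S : Finset (ℕ × ℕ)} {a b : ℕ}

lemma between_comm (a b x : ℕ) : Between a b x ↔ Between b a x := by
  unfold Between
  tauto

lemma onCap_comm (n : ℕ) (S : Finset (ℕ × ℕ)) (a b x : ℕ) :
    OnCap n S a b x ↔ OnCap n S b a x := by
  unfold OnCap
  rw [min_comm, max_comm, between_comm]

lemma isCrossing_wheelCross (n : ℕ) (S : Finset (ℕ × ℕ)) : IsCrossing (WheelCross n S) where
  swap := by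
    intro a b c d h
    unfold WheelCross at *
    rw [onCap_comm n S b a c, onCap_comm n S b a d]
    tauto
  symm := by
    intro a b c d h
    unfold WheelCross at *
    have := h.1
    tauto
  ne := fun h => h.1.1

lemma wheelCross_of_ne {x y z t : ℕ} (hx : x ≠ n) (hy : y ≠ n) (hz : z ≠ n) (ht : t ≠ n) :
    WheelCross n S x y z t ↔ DiagonalsCross x y z t := by
  simp only [WheelCross, OnCap, hx, hy, hz, ht, if_false, DiagonalsCross, Between]
  omega

lemma wheelCross_extra {x y t : ℕ} (hx : x ≠ n) (hy : y ≠ n) (hxt : x ≠ t) (hyt : y ≠ t)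
    (ht : t ≠ n) (hxy : x < y) : WheelCross n S x y n t ↔ ((x, y) ∈ S ↔ ¬ Between x y t) := by
  simp [WheelCross, OnCap, hx, hy, hxt, hyt, ht, min_eq_left hxy.le, max_eq_right hxy.le]

lemma wheelCross_comm (x y z t : ℕ) : WheelCross n S x y z t ↔ WheelCross n S z t x y :=
  ⟨(isCrossing_wheelCross n S).symm, (isCrossing_wheelCross n S).symm⟩

lemma wheelCross_swap (x y z t : ℕ) : WheelCross n S x y z t ↔ WheelCross n S y x z t :=
  ⟨(isCrossing_wheelCross n S).swap, (isCrossing_wheelCross n S).swap⟩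

/-- Two crossing relations agree as soon as they agree up to the obvious symmetries. -/
lemma wheelCross_iff_of_extra {X : ℕ → ℕ → ℕ → ℕ → Prop} (hX : IsCrossing X)
    (hloop : ∀ x z t, ¬ X x x z t) {U : Finset ℕ} (hS : IsPosition n S) {R : Sym2 ℕ → Prop}
    (h : ∀ x ∈ U, ∀ y ∈ U, ∀ z ∈ U, ∀ t ∈ U, x ≠ n → y ≠ n → z ≠ n → t ≠ n →
      R s(x, y) → R s(z, t) → (DiagonalsCross x y z t ↔ X x y z t))
    (hn : n ∈ U → ∀ x ∈ U, ∀ y ∈ U, ∀ t ∈ U, y ≠ n → t ≠ n → x ≠ t → y ≠ t → x < y → R s(x, y) →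
      (((x, y) ∈ S ↔ ¬ Between x y t) ↔ X x y n t)) :
    ∀ x ∈ U, ∀ y ∈ U, ∀ z ∈ U, ∀ t ∈ U, R s(x, y) → R s(z, t) →
      (WheelCross n S x y z t ↔ X x y z t) := by
  have hW := isCrossing_wheelCross n S
  have comm : ∀ {x y z t}, X x y z t ↔ X z t x y := ⟨hX.symm, hX.symm⟩
  have swap : ∀ {x y z t}, X x y z t ↔ X y x z t := ⟨hX.swap, hX.swap⟩
  have neX : ∀ {x y z t}, X x y z t → x ≠ z ∧ x ≠ t ∧ y ≠ z ∧ y ≠ t := by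
    intro x y z t hx
    have h1 := hX.swap hx
    have h2 := hX.symm (hX.swap (hX.symm hx))
    exact ⟨hX.ne hx, hX.ne h2, hX.ne h1, hX.ne (hX.swap h2)⟩
  have loopW : ∀ x z t, ¬ WheelCross n S x x z t := by
    intro x z t
    have hb : ∀ u, ¬ OnCap n S x x u := by
      intro u
      unfold OnCap Between
      split_ifs
      · rw [min_self, max_self]
        exact fun h => absurd (hS.lt h).1 (lt_irrefl x)
      · omega
    unfold WheelCross
    have := hb z
    have := hb t
    tauto
  have key : n ∈ U → ∀ x ∈ U, ∀ y ∈ U, ∀ t ∈ U, R s(x, y) →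
      (WheelCross n S x y n t ↔ X x y n t) := by
    intro hnU x hx y hy t ht hR
    by_cases hd : x ≠ n ∧ y ≠ n ∧ x ≠ t ∧ y ≠ t
    · obtain ⟨h1, h2, h3, h4⟩ := hd
      by_cases htn : t = n
      · subst htn
        rw [wheelCross_comm, comm]
        exact iff_of_false (loopW _ _ _) (hloop _ _ _)
      rcases lt_trichotomy x y with hxy | rfl | hxy
      · rw [wheelCross_extra h1 h2 h3 h4 htn hxy]
        exact hn hnU x hx y hy t ht h2 htn h3 h4 hxy hR
      · exact iff_of_false (loopW _ _ _) (hloop _ _ _)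
      · rw [wheelCross_swap, wheelCross_extra h2 h1 h4 h3 htn hxy, swap]
        exact hn hnU y hy x hx t ht h1 htn h4 h3 hxy (by rwa [Sym2.eq_swap])
    · refine iff_of_false (fun hw => hd ?_) (fun hw => hd ?_)
      · have := hw.1
        tauto
      · have := neX hw
        tauto
  intro x hx y hy z hz t ht hR hR'
  by_cases hzn : z = n
  · subst hzn
    exact key hz x hx y hy t ht hR
  by_cases htn : t = n
  · subst htn
    rw [wheelCross_comm, wheelCross_swap, wheelCross_comm, comm, swap, comm]
    exact key ht x hx y hy z hz hR
  by_cases hxn : x = n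
  · subst hxn
    rw [wheelCross_comm, comm]
    exact key hx z hz t ht y hy hR'
  by_cases hyn : y = n
  · subst hyn
    rw [wheelCross_swap, wheelCross_comm, swap, comm]
    exact key hy z hz t ht x hx hR'
  rw [wheelCross_of_ne hxn hyn hzn htn]
  exact h x hx y hy z hz t ht hxn hyn hzn htn hR hR'

/-! ### Minimal caps: the extra point next to a diagonal. -/

/-- `(a, b)` is an inclusion-minimal member of the position `S`. -/
structure IsMinimalCap (n : ℕ) (S : Finset (ℕ × ℕ)) (a b : ℕ) : Prop where
  pos : IsPosition n S
  mem : (a, b) ∈ S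
  minimal : ∀ {c d}, (c, d) ∈ S → a ≤ c → d ≤ b → c = a ∧ d = b

/-- Seen from the pairs outside the open cap, the extra point sits where the diagonal `ab` is: any
member of `S` must overlap `(a, b)` on both sides. -/
lemma IsMinimalCap.mem_outer (h : IsMinimalCap n S a b) {x y : ℕ} (hy : y < n)
    (hx' : ¬ (a < x ∧ x < b)) (hy' : ¬ (a < y ∧ y < b)) : (x, y) ∈ S ↔ x ≤ a ∧ b ≤ y := by
  constructor
  · intro hm
    have h1 := h.pos.inter hm h.mem
    have h2 := h.pos.inter h.mem hm
    omega
  · rintro ⟨h1, h2⟩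
    exact h.pos.up h.mem h1 h2 hy

lemma IsMinimalCap.mem_inner (h : IsMinimalCap n S a b) {x y : ℕ} (hx : a ≤ x) (hy : y ≤ b) :
    (x, y) ∈ S ↔ x = a ∧ y = b := by
  constructor
  · intro hm
    exact h.minimal hm hx hy
  · rintro ⟨rfl, rfl⟩
    exact h.mem

lemma mem_erase_pair {x y : ℕ} : (x, y) ∈ S.erase (a, b) ↔ ¬ (x = a ∧ y = b) ∧ (x, y) ∈ S := by
  rw [mem_erase, Ne, Prod.mk.injEq]

/-- Minimality is what keeps the set upward closed. -/
lemma IsMinimalCap.erase (h : IsMinimalCap n S a b) : IsPosition n (S.erase (a, b)) where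
  lt := fun hm => h.pos.lt (mem_of_mem_erase hm)
  up := by
    intro c d c' d' hm h1 h2 h3
    rw [mem_erase_pair] at hm ⊢
    refine ⟨?_, h.pos.up hm.2 h1 h2 h3⟩
    rintro ⟨rfl, rfl⟩
    exact hm.1 (h.minimal hm.2 h1 h2)
  inter := fun h1 h2 => h.pos.inter (mem_of_mem_erase h1) (mem_of_mem_erase h2)

lemma IsMinimalCap.onCap_erase (h : IsMinimalCap n S a b) {x y z : ℕ} (hxy : s(x, y) ≠ s(a, b)) :
    OnCap n (S.erase (a, b)) x y z ↔ OnCap n S x y z := by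
  unfold OnCap
  have hab := (h.pos.lt h.mem).1
  rw [Ne, Sym2.eq_iff] at hxy
  split_ifs
  · rw [mem_erase_pair, and_iff_right]
    omega
  · exact Iff.rfl

lemma IsMinimalCap.wheelCross_erase (h : IsMinimalCap n S a b) {x y z t : ℕ}
    (hxy : s(x, y) ≠ s(a, b)) (hzt : s(z, t) ≠ s(a, b)) :
    WheelCross n (S.erase (a, b)) x y z t ↔ WheelCross n S x y z t := by
  unfold WheelCross
  rw [h.onCap_erase hxy, h.onCap_erase hxy, h.onCap_erase hzt, h.onCap_erase hzt]

lemma IsMinimalCap.crossingFree_erase (h : IsMinimalCap n S a b) {E : Finset (Sym2 ℕ)}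
    (hE : s(a, b) ∉ E) :
    CrossingFree (WheelCross n (S.erase (a, b))) E ↔ CrossingFree (WheelCross n S) E := by
  constructor
  · intro hc x y z t hxy hzt hX
    exact hc x y z t hxy hzt
      ((h.wheelCross_erase (fun h => hE (h ▸ hxy)) (fun h => hE (h ▸ hzt))).2 hX)
  · intro hc x y z t hxy hzt hX
    exact hc x y z t hxy hzt
      ((h.wheelCross_erase (fun h => hE (h ▸ hxy)) (fun h => hE (h ▸ hzt))).1 hX)

/-! ### The change of the number of matchings -/

lemma diagonalsCross_loop (x z t : ℕ) : ¬ DiagonalsCross x x z t := by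
  unfold DiagonalsCross Between
  omega

/-- A criterion for two parts not to interfere: their polygon vertices do not, and relative to every
diagonal of `U₂` the extra point is on the side of all other vertices of `U₁`. -/
lemma not_wheelCross_of (hS : IsPosition n S) {U₁ U₂ : Finset ℕ} (hn₂ : n ∉ U₂)
    (h : ∀ x ∈ U₁, ∀ y ∈ U₁, ∀ z ∈ U₂, ∀ t ∈ U₂, x ≠ n → y ≠ n → ¬ DiagonalsCross x y z t)
    (hn : n ∈ U₁ → ∀ t ∈ U₁, t ≠ n → ∀ x ∈ U₂, ∀ y ∈ U₂, x < y → x ≠ t → y ≠ t →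
      ((x, y) ∈ S ↔ Between x y t)) :
    ∀ x ∈ U₁, ∀ y ∈ U₁, ∀ z ∈ U₂, ∀ t ∈ U₂, ¬ WheelCross n S x y z t := by
  have hb : ∀ u v, ¬ OnCap n S u u v := by
    intro u v
    unfold OnCap Between
    split_ifs
    · rw [min_self, max_self]
      exact fun h => absurd (hS.lt h).1 (lt_irrefl u)
    · omega
  have key : n ∈ U₁ → ∀ t ∈ U₁, ∀ x ∈ U₂, ∀ y ∈ U₂, ¬ WheelCross n S x y n t := by
    intro hn₁ t ht x hx y hy hw
    have hxn : x ≠ n := fun h => hn₂ (h ▸ hx)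
    have hyn : y ≠ n := fun h => hn₂ (h ▸ hy)
    have hw1 := hw.1
    have htn : t ≠ n := by
      rintro rfl
      have := hw.2
      tauto
    rcases lt_trichotomy x y with hxy | rfl | hxy
    · rw [wheelCross_extra hxn hyn hw1.2.1 hw1.2.2.2 htn hxy,
        hn hn₁ t ht htn x hx y hy hxy hw1.2.1 hw1.2.2.2] at hw
      tauto
    · have := hw.2
      have := hb x n
      have := hb x t
      tauto
    · rw [wheelCross_swap, wheelCross_extra hyn hxn hw1.2.2.2 hw1.2.1 htn hxy,
        hn hn₁ t ht htn y hy x hx hxy hw1.2.2.2 hw1.2.1] at hw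
      tauto
  intro x hx y hy z hz t ht hw
  have hzn : z ≠ n := fun h => hn₂ (h ▸ hz)
  have htn : t ≠ n := fun h => hn₂ (h ▸ ht)
  by_cases hxn : x = n
  · subst hxn
    exact key hx y hy z hz t ht ((wheelCross_comm _ _ _ _).1 hw)
  by_cases hyn : y = n
  · subst hyn
    exact key hy x hx z hz t ht ((wheelCross_comm _ _ _ _).1 ((wheelCross_swap _ _ _ _).1 hw))
  rw [wheelCross_of_ne hxn hyn hzn htn] at hw
  exact h x hx y hy z hz t ht hxn hyn hw

/-- Matchings without `ab` cancel. Those with `ab` split into the two sides of `ab`, and the extra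
point counts for the cap before the erasure and for the opposite side after it. -/
lemma matchCount_jump (h : IsMinimalCap n S a b) :
    (matchCount (WheelCross n S) (range (n + 1)) : ℤ) -
      matchCount (WheelCross n (S.erase (a, b))) (range (n + 1)) =
      convexMatchings (b - a) * convexMatchings (n - 1 - (b - a)) -
        convexMatchings (b - a - 1) * convexMatchings (n - (b - a)) := by
  obtain ⟨hab, hbn⟩ := h.pos.lt h.mem
  have hS₀ := h.erase
  have split : ∀ T : Finset (ℕ × ℕ), matchCount (WheelCross n T) (range (n + 1)) =
      #{E ∈ graphsOn (range (n + 1)) |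
        (CrossingFree (WheelCross n T) E ∧ IsMatchingSet E) ∧ s(a, b) ∈ E} +
      #{E ∈ graphsOn (range (n + 1)) |
        (CrossingFree (WheelCross n T) E ∧ IsMatchingSet E) ∧ s(a, b) ∉ E} := by
    intro T
    rw [matchCount, ← card_filter_add_card_filter_not (p := fun E => s(a, b) ∈ E), filter_filter,
      filter_filter]
  have hsame : #{E ∈ graphsOn (range (n + 1)) |
        (CrossingFree (WheelCross n (S.erase (a, b))) E ∧ IsMatchingSet E) ∧ s(a, b) ∉ E} =
      #{E ∈ graphsOn (range (n + 1)) |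
        (CrossingFree (WheelCross n S) E ∧ IsMatchingSet E) ∧ s(a, b) ∉ E} := by
    congr 1
    refine filter_congr fun E _ => and_congr_left fun hE => ?_
    rw [h.crossingFree_erase hE]
  have hcap : #(Ioo a b) = b - a - 1 := Nat.card_Ioo a b
  have hout : #(range n \ Icc a b) = n - 1 - (b - a) := by
    rw [card_range_sdiff_Icc hab.le hbn]
    omega
  have h₁ : #{E ∈ graphsOn (range (n + 1)) |
      (CrossingFree (WheelCross n S) E ∧ IsMatchingSet E) ∧ s(a, b) ∈ E} =
      convexMatchings (b - a) * convexMatchings (n - 1 - (b - a)) := by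
    have hU : range (n + 1) = insert a (insert b (insert n (Ioo a b) ∪ range n \ Icc a b)) := by
      ext x
      simp only [mem_range, mem_insert, mem_union, Finset.mem_sdiff, mem_Icc, mem_Ioo]
      omega
    -- By minimality no diagonal inside the open cap belongs to `S`, so the extra point and the cap
    -- vertices are in convex position, with label `n` last.
    have c₁ : matchCount (WheelCross n S) (insert n (Ioo a b)) = convexMatchings (b - a) := by
      rw [matchCount_image (f := id) (Y := DiagonalsCross) Function.injective_id.injOn, image_id,
        matchCount_diagonalsCross, card_insert_of_notMem (by simp; omega), hcap]
      · congr 1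
        omega
      · intro x hx y hy z hz t ht
        refine wheelCross_iff_of_extra isCrossing_diagonalsCross diagonalsCross_loop h.pos
          (R := fun _ => True) (U := insert n (Ioo a b)) (fun _ _ _ _ _ _ _ _ _ _ _ _ _ _ =>
          Iff.rfl) ?_ x hx y hy z hz t ht trivial trivial
        intro _ x hx y hy t ht hyn htn hxt hyt hxy _
        simp only [mem_insert, mem_Ioo] at hx hy ht
        rw [h.mem_inner (by omega) (by omega)]
        unfold DiagonalsCross Between
        omega
    have c₂ : matchCount (WheelCross n S) (range n \ Icc a b) =
        convexMatchings (n - 1 - (b - a)) := by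
      rw [matchCount_image (f := id) (Y := DiagonalsCross) Function.injective_id.injOn, image_id,
        matchCount_diagonalsCross, hout]
      intro x hx y hy z hz t ht
      simp only [Finset.mem_sdiff, mem_range] at hx hy hz ht
      exact wheelCross_of_ne (by omega) (by omega) (by omega) (by omega)
    rw [hU, card_matchings_with (isCrossing_wheelCross n S) hab.ne, c₁, c₂]
    · simp; omega
    · simp; omega
    · simp; omega
    · simp; omega
    · rw [disjoint_left]
      simp only [mem_insert, Finset.mem_sdiff, mem_range, mem_Icc, mem_Ioo]
      intros
      omega
    · intro x hx y hy
      simp only [mem_insert, mem_Ioo, Finset.mem_sdiff, mem_range, mem_Icc] at hx hy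
      by_cases hxn : x = n
      · subst hxn
        rw [wheelCross_extra (by omega) (by omega) (by omega) (by omega) (by omega) hab]
        unfold Between
        have := h.mem
        simp only [this, true_iff]
        omega
      · rw [wheelCross_of_ne (by omega) (by omega) (by omega) (by omega)]
        unfold DiagonalsCross Between
        omega
    · intro x hx y hy hw
      refine not_wheelCross_of h.pos (U₁ := insert n (Ioo a b)) (U₂ := {a, b}) ?_ ?_ ?_ x hx y hy
        a (by simp) b (by simp) ((wheelCross_comm _ _ _ _).1 hw)
      · simp; omega
      · simp only [mem_insert, mem_singleton, mem_Ioo, DiagonalsCross, Between]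
        intros
        omega
      · simp only [mem_insert, mem_singleton, mem_Ioo]
        intro _ t ht htn x hx y hy hxy hxt hyt
        rw [h.mem_inner (by omega) (by omega)]
        unfold Between
        omega
    · intro x hx y hy
      simp only [Finset.mem_sdiff, mem_range, mem_Icc] at hx hy
      rw [wheelCross_of_ne (by omega) (by omega) (by omega) (by omega)]
      unfold DiagonalsCross Between
      omega
    · refine not_wheelCross_of h.pos (by simp) ?_ ?_
      · simp only [mem_insert, Finset.mem_sdiff, mem_range, mem_Icc, mem_Ioo, DiagonalsCross,
          Between]
        intros
        omega
      · simp only [mem_insert, Finset.mem_sdiff, mem_range, mem_Icc, mem_Ioo]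
        intro _ t ht htn x hx y hy hxy hxt hyt
        rw [h.mem_outer (by omega) (by omega) (by omega)]
        unfold Between
        omega
  have h₂ : #{E ∈ graphsOn (range (n + 1)) |
      (CrossingFree (WheelCross n (S.erase (a, b))) E ∧ IsMatchingSet E) ∧ s(a, b) ∈ E} =
      convexMatchings (n - (b - a)) * convexMatchings (b - a - 1) := by
    have hU : range (n + 1) = insert a (insert b (insert n (range n \ Icc a b) ∪ Ioo a b)) := by
      ext x
      simp only [mem_range, mem_insert, mem_union, Finset.mem_sdiff, mem_Icc, mem_Ioo]
      omega
    have c₁ : matchCount (WheelCross n (S.erase (a, b))) (insert n (range n \ Icc a b)) =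
        convexMatchings (n - (b - a)) := by
      -- The extra point is just outside the cap, next to `ab`. Since `a` itself is not among these
      -- vertices, its label is free for the extra point.
      have hf : Set.InjOn (fun x => if x = n then a else x)
          ((insert n (range n \ Icc a b) : Finset ℕ) : Set ℕ) := by
        intro x hx y hy hxy
        simp only [coe_insert, Set.mem_insert_iff, mem_coe, Finset.mem_sdiff, mem_range,
          mem_Icc] at hx hy
        dsimp only at hxy
        split_ifs at hxy <;> omega
      rw [matchCount_image hf (Y := DiagonalsCross), matchCount_diagonalsCross,
        card_image_of_injOn hf, card_insert_of_notMem (by simp), hout]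
      · congr 1
        omega
      · intro x hx y hy z hz t ht
        have hR : ∀ u v, u ∈ insert n (range n \ Icc a b) → s(u, v) ≠ s(a, b) := by
          intro u v hu he
          simp only [mem_insert, Finset.mem_sdiff, mem_range, mem_Icc] at hu
          rw [Sym2.eq_iff] at he
          omega
        refine wheelCross_iff_of_extra (X := fun x y z t => DiagonalsCross
          (if x = n then a else x) (if y = n then a else y) (if z = n then a else z)
          (if t = n then a else t)) ⟨fun h => isCrossing_diagonalsCross.swap h,
          fun h => isCrossing_diagonalsCross.symm h, fun h he => ?_⟩ (fun _ _ _ =>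
          diagonalsCross_loop _ _ _) hS₀ (R := fun e => e ≠ s(a, b))
          (U := insert n (range n \ Icc a b)) ?_ ?_ x hx y hy z hz t ht (hR _ _ hx) (hR _ _ hz)
        · exact isCrossing_diagonalsCross.ne h (by rw [he])
        · intro x _ y _ z _ t _ h1 h2 h3 h4 _ _
          rw [if_neg h1, if_neg h2, if_neg h3, if_neg h4]
        · intro _ x hx y hy t ht hyn htn hxt hyt hxy _
          simp only [mem_insert, Finset.mem_sdiff, mem_range, mem_Icc] at hx hy ht
          rw [mem_erase_pair, h.mem_outer (by omega) (by omega) (by omega), if_pos rfl,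
            if_neg hyn, if_neg htn, if_neg (show x ≠ n by omega)]
          unfold DiagonalsCross Between
          omega
    have c₂ : matchCount (WheelCross n (S.erase (a, b))) (Ioo a b) =
        convexMatchings (b - a - 1) := by
      rw [matchCount_image (f := id) (Y := DiagonalsCross) Function.injective_id.injOn, image_id,
        matchCount_diagonalsCross, hcap]
      intro x hx y hy z hz t ht
      simp only [mem_Ioo] at hx hy hz ht
      exact wheelCross_of_ne (by omega) (by omega) (by omega) (by omega)
    rw [hU, card_matchings_with (isCrossing_wheelCross n _) hab.ne, c₁, c₂]
    · simp; omega
    · simp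
    · simp; omega
    · simp
    · rw [disjoint_left]
      simp only [mem_insert, Finset.mem_sdiff, mem_range, mem_Icc, mem_Ioo]
      intros
      omega
    · intro x hx y hy
      simp only [mem_insert, mem_Ioo, Finset.mem_sdiff, mem_range, mem_Icc] at hx hy
      by_cases hxn : x = n
      · subst hxn
        rw [wheelCross_extra (by omega) (by omega) (by omega) (by omega) (by omega) hab,
          mem_erase_pair]
        unfold Between
        omega
      · rw [wheelCross_of_ne (by omega) (by omega) (by omega) (by omega)]
        unfold DiagonalsCross Between
        omega
    · intro x hx y hy hw
      refine not_wheelCross_of hS₀ (U₁ := insert n (range n \ Icc a b)) (U₂ := {a, b}) ?_ ?_ ?_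
        x hx y hy a (by simp) b (by simp) ((wheelCross_comm _ _ _ _).1 hw)
      · simp; omega
      · simp only [mem_insert, mem_singleton, Finset.mem_sdiff, mem_range, mem_Icc,
          DiagonalsCross, Between]
        intros
        omega
      · simp only [mem_insert, mem_singleton, Finset.mem_sdiff, mem_range, mem_Icc]
        intro _ t ht htn x hx y hy hxy hxt hyt
        rw [mem_erase_pair, h.mem_inner (by omega) (by omega)]
        unfold Between
        omega
    · intro x hx y hy
      simp only [mem_Ioo] at hx hy
      rw [wheelCross_of_ne (by omega) (by omega) (by omega) (by omega)]
      unfold DiagonalsCross Between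
      omega
    · refine not_wheelCross_of hS₀ (by simp; omega) ?_ ?_
      · simp only [mem_insert, Finset.mem_sdiff, mem_range, mem_Icc, mem_Ioo, DiagonalsCross,
          Between]
        intros
        omega
      · simp only [mem_insert, Finset.mem_sdiff, mem_range, mem_Icc, mem_Ioo]
        intro _ t ht htn x hx y hy hxy hxt hyt
        rw [mem_erase_pair, h.mem_inner (by omega) (by omega)]
        unfold Between
        omega
  rw [split S, split (S.erase (a, b)), hsame, h₁, h₂]
  push_cast
  ring

/-! ### The change of the number of trees -/

lemma not_wheelCross_of_mem (U : Finset ℕ) {a b : ℕ} {T : Finset (ℕ × ℕ)}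
    (ha : a ∈ U) (hb : b ∈ U) {U' : Finset ℕ}
    (h : ∀ x ∈ U', ∀ y ∈ U', ∀ z ∈ U, ∀ t ∈ U, ¬ WheelCross n T x y z t) :
    ∀ z ∈ U', ∀ t ∈ U', ¬ WheelCross n T a b z t :=
  fun z hz t ht hw => h z hz t ht a ha b hb ((wheelCross_comm _ _ _ _).1 hw)

/-- The relabelling of the vertices inside a cap, the extra point becomes the last one. -/
def capLabel (n a b x : ℕ) : ℕ := if x = n then b - a + 1 else x - a

/-- The rotation of `0, …, n - 1` that moves `b` to `0`. -/
def rotate (n b x : ℕ) : ℕ := if b ≤ x then x - b else x + n - b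

/-- The relabelling of the vertices outside a cap, the extra point becomes the last one. -/
def outerLabel (n a b x : ℕ) : ℕ :=
  if x = n then n - (b - a) + 1 else rotate n b x

lemma diagonalsCross_last {x y z t : ℕ} (hx : x < z) (hy : y < z) :
    DiagonalsCross x y z t ↔ Between x y t := by
  unfold DiagonalsCross Between
  omega

/-- Rotation replaces betweenness by its negation exactly when the cyclic cut at `b` separates `x`
from `y`, so separation by the diagonal `xy` is unaffected. -/
lemma between_rotate {x y z : ℕ} (hb : b ≤ n) (hx : x < n) (hy : y < n) (hz : z < n) (hxz : x ≠ z)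
    (hyz : y ≠ z) : Between (rotate n b x) (rotate n b y) (rotate n b z) ↔
      (Between x y z ↔ (b ≤ x ↔ b ≤ y)) := by
  unfold Between rotate
  by_cases h1 : b ≤ x <;> by_cases h2 : b ≤ y <;> by_cases h3 : b ≤ z <;>
    simp only [h1, h2, h3, if_true, if_false, iff_true, iff_false, not_true] <;>
    omega

lemma rotate_ne {x y : ℕ} (hb : b ≤ n) (hx : x < n) (hy : y < n) :
    rotate n b x ≠ rotate n b y ↔ x ≠ y := by
  unfold rotate
  split_ifs <;> omega

lemma diagonalsCross_rotate {x y z t : ℕ} (hb : b ≤ n) (hx : x < n) (hy : y < n) (hz : z < n)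
    (ht : t < n) : DiagonalsCross x y z t ↔
      DiagonalsCross (rotate n b x) (rotate n b y) (rotate n b z) (rotate n b t) := by
  unfold DiagonalsCross
  rw [rotate_ne hb hx hz, rotate_ne hb hx ht, rotate_ne hb hy hz, rotate_ne hb hy ht]
  refine and_congr_right fun h1 => and_congr_right fun h2 => and_congr_right fun h3 =>
    and_congr_right fun h4 => ?_
  rw [between_rotate hb hx hy hz h1 h3, between_rotate hb hx hy ht h2 h4]
  by_cases hr : (b ≤ x ↔ b ≤ y) <;> simp only [hr, iff_true, iff_false]
  exact not_iff_not.symm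

lemma outer_iff_between {x y t : ℕ} (hb : b ≤ n) (hab : a < b) (hxy : x < y) (hy : y < n)
    (ht : t < n) (hxo : x ≤ a ∨ b ≤ x) (hyo : y ≤ a ∨ b ≤ y) (hto : t ≤ a ∨ b ≤ t) (hxt : x ≠ t)
    (hyt : y ≠ t) (hne : ¬ (x = a ∧ y = b)) :
    ((¬ (x = a ∧ y = b) ∧ x ≤ a ∧ b ≤ y) ↔ ¬ Between x y t) ↔
      Between (rotate n b x) (rotate n b y) (rotate n b t) := by
  rw [between_rotate hb (hxy.trans hy) hy ht hxt hyt, and_iff_right hne]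
  have : (x ≤ a ∧ b ≤ y) ↔ ¬ (b ≤ x ↔ b ≤ y) := by omega
  rw [this]
  by_cases hr : (b ≤ x ↔ b ≤ y) <;> simp [hr]

lemma isCrossing_comp (f : ℕ → ℕ) :
    IsCrossing fun x y z t => DiagonalsCross (f x) (f y) (f z) (f t) where
  swap := fun h => isCrossing_diagonalsCross.swap h
  symm := fun h => isCrossing_diagonalsCross.symm h
  ne := fun h he => isCrossing_diagonalsCross.ne h (by rw [he])

/-- The extra point is on the inner side of `ab`, but the remaining edges cannot tell. It may be
pushed out across `ab`, where it becomes the vertex after `b` of a convex polygon whose root edge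
joins `0` to `b - a`. -/
lemma IsMinimalCap.treeCountWith_cap (h : IsMinimalCap n S a b)
    (hno : ∀ z ∈ insert n (Icc a b), ∀ t ∈ insert n (Icc a b), ¬ WheelCross n S a b z t) :
    treeCountWith (WheelCross n S) (insert n (Icc a b)) s(a, b) =
      rootedForests (b - a + 2) (b - a) := by
  obtain ⟨hab, hbn⟩ := h.pos.lt h.mem
  have hf : Set.InjOn (capLabel n a b) ((insert n (Icc a b) : Finset ℕ) : Set ℕ) := by
    intro x hx y hy hxy
    simp only [coe_insert, Set.mem_insert_iff, mem_coe, mem_Icc] at hx hy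
    unfold capLabel at hxy
    split_ifs at hxy <;> omega
  refine treeCountWith_eq_rootedForests (isCrossing_wheelCross n S) hf (by simp; omega)
    (by simp; omega) hab.ne ?_ ?_ ?_ hno ?_
  · ext x
    simp only [mem_image, mem_insert, mem_Icc, mem_range]
    constructor
    · rintro ⟨y, hy, rfl⟩
      unfold capLabel
      split_ifs <;> omega
    · intro hx
      by_cases hxl : x = b - a + 1
      · exact ⟨n, Or.inl rfl, by simp [capLabel, hxl]⟩
      · refine ⟨x + a, by omega, ?_⟩
        rw [capLabel, if_neg (by omega)]
        omega
  · rw [capLabel, if_neg (by omega), Nat.sub_self]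
  · rw [capLabel, if_neg (by omega)]
  · refine wheelCross_iff_of_extra (isCrossing_comp _) (fun _ _ _ => diagonalsCross_loop _ _ _)
      h.pos (R := fun e => e ≠ s(a, b)) ?_ ?_
    · intro x hx y hy z hz t ht h1 h2 h3 h4 _ _
      simp only [mem_insert, mem_Icc] at hx hy hz ht
      have hm : ∀ u v, a ≤ u → a ≤ v → ((u < v ↔ u - a < v - a) ∧ (u ≠ v ↔ u - a ≠ v - a)) := by
        intros
        omega
      have hx : a ≤ x := by omega
      have hy : a ≤ y := by omega
      have hz : a ≤ z := by omega
      have ht : a ≤ t := by omega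
      simp only [capLabel, h1, h2, h3, h4, if_false]
      unfold DiagonalsCross Between
      rw [(hm x z hx hz).1, (hm z x hz hx).1, (hm x t hx ht).1, (hm t x ht hx).1,
        (hm y z hy hz).1, (hm z y hz hy).1, (hm y t hy ht).1, (hm t y ht hy).1,
        (hm x z hx hz).2, (hm x t hx ht).2, (hm y z hy hz).2, (hm y t hy ht).2]
    · intro _ x hx y hy t ht hyn htn hxt hyt hxy hR
      simp only [mem_insert, mem_Icc] at hx hy ht
      rw [Ne, Sym2.eq_iff] at hR
      have hxn : x ≠ n := by omega
      rw [h.mem_inner (by omega) (by omega)]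
      simp only [capLabel, hxn, hyn, htn, if_false, if_true]
      rw [diagonalsCross_last (by omega) (by omega)]
      unfold Between
      omega

/-- The mirror situation: after the erasure the extra point is pushed into the empty cap across
`ab`. The rotation makes `b` the vertex `0` and `a` the vertex `n - (b - a)`, followed by the extra
point. -/
lemma IsMinimalCap.treeCountWith_outer_insert (h : IsMinimalCap n S a b)
    (hno : ∀ z ∈ insert n (range n \ Ioo a b), ∀ t ∈ insert n (range n \ Ioo a b),
      ¬ WheelCross n (S.erase (a, b)) a b z t) :
    treeCountWith (WheelCross n (S.erase (a, b))) (insert n (range n \ Ioo a b)) s(a, b) =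
      rootedForests (n - (b - a) + 2) (n - (b - a)) := by
  obtain ⟨hab, hbn⟩ := h.pos.lt h.mem
  have hf : Set.InjOn (outerLabel n a b) ((insert n (range n \ Ioo a b) : Finset ℕ) : Set ℕ) := by
    intro x hx y hy hxy
    simp only [coe_insert, Set.mem_insert_iff, mem_coe, Finset.mem_sdiff, mem_range,
      mem_Ioo] at hx hy
    unfold outerLabel rotate at hxy
    split_ifs at hxy <;> omega
  rw [Sym2.eq_swap]
  refine treeCountWith_eq_rootedForests (isCrossing_wheelCross n _) hf (by simp; omega)
    (by simp; omega) hab.ne' ?_ ?_ ?_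
    (fun z hz t ht hw => hno z hz t ht ((wheelCross_swap _ _ _ _).1 hw)) ?_
  · ext x
    simp only [mem_image, mem_insert, Finset.mem_sdiff, mem_Ioo, mem_range]
    constructor
    · rintro ⟨y, hy, rfl⟩
      unfold outerLabel rotate
      split_ifs <;> omega
    · intro hx
      by_cases hxl : x = n - (b - a) + 1
      · exact ⟨n, Or.inl rfl, by simp [outerLabel, hxl]⟩
      by_cases hxb : x + b < n
      · refine ⟨x + b, by omega, ?_⟩
        rw [outerLabel, if_neg (by omega), rotate, if_pos (by omega)]
        omega
      · refine ⟨x + b - n, by omega, ?_⟩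
        rw [outerLabel, if_neg (by omega), rotate, if_neg (by omega)]
        omega
  · rw [outerLabel, if_neg (by omega), rotate, if_pos le_rfl, Nat.sub_self]
  · rw [outerLabel, if_neg (by omega), rotate, if_neg (by omega)]
    omega
  · refine wheelCross_iff_of_extra (isCrossing_comp _) (fun _ _ _ => diagonalsCross_loop _ _ _)
      h.erase (R := fun e => e ≠ s(b, a)) ?_ ?_
    · intro x hx y hy z hz t ht h1 h2 h3 h4 _ _
      simp only [mem_insert, Finset.mem_sdiff, mem_range, mem_Ioo] at hx hy hz ht
      simp only [outerLabel, h1, h2, h3, h4, if_false]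
      exact diagonalsCross_rotate hbn.le (by omega) (by omega) (by omega) (by omega)
    · intro _ x hx y hy t ht hyn htn hxt hyt hxy hR
      simp only [mem_insert, Finset.mem_sdiff, mem_range, mem_Ioo] at hx hy ht
      rw [Ne, Sym2.eq_iff] at hR
      have hxn : x ≠ n := by omega
      rw [mem_erase_pair, h.mem_outer (by omega) (by omega) (by omega)]
      simp only [outerLabel, hxn, hyn, htn, if_false, if_true]
      rw [diagonalsCross_last (by unfold rotate; split_ifs <;> omega)
        (by unfold rotate; split_ifs <;> omega)]
      exact outer_iff_between hbn.le hab hxy (by omega) (by omega) (by omega) (by omega) (by omega)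
        hxt hyt (by omega)

lemma treeCountWith_Icc {T : Finset (ℕ × ℕ)} (hab : a < b) (hbn : b < n) :
    treeCountWith (WheelCross n T) (Icc a b) s(a, b) = rootedForests (b - a + 1) (b - a) := by
  have hW : ∀ x ∈ Icc a b, ∀ y ∈ Icc a b, ∀ z ∈ Icc a b, ∀ t ∈ Icc a b,
      (WheelCross n T x y z t ↔ DiagonalsCross x y z t) := by
    intro x hx y hy z hz t ht
    rw [mem_Icc] at hx hy hz ht
    exact wheelCross_of_ne (by omega) (by omega) (by omega) (by omega)
  refine treeCountWith_eq_rootedForests (isCrossing_wheelCross n T) (f := fun x => x - a) ?_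
    (by simp; omega) (by simp; omega) hab.ne ?_ (Nat.sub_self a) rfl ?_ ?_
  · intro x hx y hy hxy
    simp only [coe_Icc, Set.mem_Icc] at hx hy hxy
    omega
  · ext x
    simp only [mem_image, mem_Icc, mem_range]
    constructor
    · rintro ⟨y, hy, rfl⟩
      omega
    · intro hx
      exact ⟨x + a, by omega, by omega⟩
  · intro z hz t ht
    rw [hW a (by simp; omega) b (by simp; omega) z hz t ht]
    rw [mem_Icc] at hz ht
    unfold DiagonalsCross Between
    omega
  · intro x hx y hy z hz t ht _ _
    rw [hW x hx y hy z hz t ht]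
    rw [mem_Icc] at hx hy hz ht
    unfold DiagonalsCross Between
    omega

lemma treeCountWith_outer {T : Finset (ℕ × ℕ)} (hab : a < b) (hbn : b < n) :
    treeCountWith (WheelCross n T) (range n \ Ioo a b) s(a, b) =
      rootedForests (n - (b - a) + 1) (n - (b - a)) := by
  have hW : ∀ x ∈ range n \ Ioo a b, ∀ y ∈ range n \ Ioo a b, ∀ z ∈ range n \ Ioo a b,
      ∀ t ∈ range n \ Ioo a b, (WheelCross n T x y z t ↔ DiagonalsCross x y z t) := by
    intro x hx y hy z hz t ht
    simp only [Finset.mem_sdiff, mem_range] at hx hy hz ht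
    exact wheelCross_of_ne (by omega) (by omega) (by omega) (by omega)
  rw [Sym2.eq_swap]
  refine treeCountWith_eq_rootedForests (isCrossing_wheelCross n T)
    (f := rotate n b) ?_
    (by simp; omega) (by simp; omega) hab.ne' ?_ (by simp [rotate]) ?_ ?_ ?_
  · intro x hx y hy hxy
    simp only [mem_coe, Finset.mem_sdiff, mem_range, mem_Ioo] at hx hy hxy
    unfold rotate at hxy
    split_ifs at hxy <;> omega
  · ext x
    simp only [mem_image, Finset.mem_sdiff, mem_Ioo, mem_range]
    constructor
    · rintro ⟨y, hy, rfl⟩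
      unfold rotate
      split_ifs <;> omega
    · intro hx
      by_cases hxb : x + b < n
      · refine ⟨x + b, by omega, ?_⟩
        rw [rotate, if_pos (by omega)]
        omega
      · refine ⟨x + b - n, by omega, ?_⟩
        rw [rotate, if_neg (by omega)]
        omega
  · rw [rotate, if_neg (by omega)]
    omega
  · intro z hz t ht
    rw [hW b (by simp; omega) a (by simp; omega) z hz t ht]
    simp only [Finset.mem_sdiff, mem_range, mem_Ioo] at hz ht
    unfold DiagonalsCross Between
    omega
  · intro x hx y hy z hz t ht _ _
    rw [hW x hx y hy z hz t ht]
    simp only [Finset.mem_sdiff, mem_range, mem_Ioo] at hx hy hz ht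
    exact diagonalsCross_rotate hbn.le (by omega) (by omega) (by omega) (by omega)

/-- Trees without `ab` cancel. A tree with `ab` is the union of two trees that share exactly this
edge, one on each side, and the extra point changes sides. -/
lemma treeCount_jump (h : IsMinimalCap n S a b) :
    (treeCount (WheelCross n S) (range (n + 1)) : ℤ) -
      treeCount (WheelCross n (S.erase (a, b))) (range (n + 1)) =
      rootedForests (b - a + 2) (b - a) * rootedForests (n - (b - a) + 1) (n - (b - a)) -
        rootedForests (b - a + 1) (b - a) * rootedForests (n - (b - a) + 2) (n - (b - a)) := by
  obtain ⟨hab, hbn⟩ := h.pos.lt h.mem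
  have hS₀ := h.erase
  have split : ∀ T : Finset (ℕ × ℕ), treeCount (WheelCross n T) (range (n + 1)) =
      treeCountWith (WheelCross n T) (range (n + 1)) s(a, b) +
      #{E ∈ graphsOn (range (n + 1)) |
        (CrossingFree (WheelCross n T) E ∧ IsTreeOn (range (n + 1)) E) ∧ s(a, b) ∉ E} := by
    intro T
    rw [treeCount, ← card_filter_add_card_filter_not (p := fun E => s(a, b) ∈ E), filter_filter,
      filter_filter, treeCountWith]
    simp only [and_assoc]
  have hsame : #{E ∈ graphsOn (range (n + 1)) |
        (CrossingFree (WheelCross n (S.erase (a, b))) E ∧ IsTreeOn (range (n + 1)) E) ∧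
          s(a, b) ∉ E} =
      #{E ∈ graphsOn (range (n + 1)) |
        (CrossingFree (WheelCross n S) E ∧ IsTreeOn (range (n + 1)) E) ∧ s(a, b) ∉ E} := by
    congr 1
    refine filter_congr fun E _ => and_congr_left fun hE => ?_
    rw [h.crossingFree_erase hE]
  have h₁ : treeCountWith (WheelCross n S) (range (n + 1)) s(a, b) =
      rootedForests (b - a + 2) (b - a) * rootedForests (n - (b - a) + 1) (n - (b - a)) := by
    have hU : range (n + 1) = insert n (Icc a b) ∪ range n \ Ioo a b := by
      ext x
      simp only [mem_range, mem_insert, mem_union, Finset.mem_sdiff, mem_Icc, mem_Ioo]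
      omega
    have h₁₂ : ∀ x ∈ insert n (Icc a b), ∀ y ∈ insert n (Icc a b), ∀ z ∈ range n \ Ioo a b,
        ∀ t ∈ range n \ Ioo a b, ¬ WheelCross n S x y z t := by
      refine not_wheelCross_of h.pos (by simp) ?_ ?_
      · simp only [mem_insert, Finset.mem_sdiff, mem_range, mem_Icc, mem_Ioo, DiagonalsCross,
          Between]
        intros
        omega
      · simp only [mem_insert, Finset.mem_sdiff, mem_range, mem_Icc, mem_Ioo]
        intro _ t ht htn x hx y hy hxy hxt hyt
        rw [h.mem_outer (by omega) (by omega) (by omega)]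
        unfold Between
        omega
    rw [hU, treeCountWith_union (isCrossing_wheelCross n S) hab.ne _ _ h₁₂, h.treeCountWith_cap,
      treeCountWith_outer hab hbn]
    · exact not_wheelCross_of_mem (range n \ Ioo a b) (by simp; omega) (by simp; omega) h₁₂
    · ext x
      simp only [mem_range, mem_insert, mem_inter, Finset.mem_sdiff, mem_Icc, mem_Ioo,
        mem_singleton]
      omega
    · intro x hx hx' y hy hy'
      simp only [mem_insert, mem_Icc, mem_Ioo, Finset.mem_sdiff, mem_range] at hx hx' hy hy'
      by_cases hxn : x = n
      · subst hxn
        rw [wheelCross_extra (by omega) (by omega) (by omega) (by omega) (by omega) hab]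
        unfold Between
        have := h.mem
        simp only [this, true_iff]
        omega
      · rw [wheelCross_of_ne (by omega) (by omega) (by omega) (by omega)]
        unfold DiagonalsCross Between
        omega
  have h₂ : treeCountWith (WheelCross n (S.erase (a, b))) (range (n + 1)) s(a, b) =
      rootedForests (n - (b - a) + 2) (n - (b - a)) * rootedForests (b - a + 1) (b - a) := by
    have hU : range (n + 1) = insert n (range n \ Ioo a b) ∪ Icc a b := by
      ext x
      simp only [mem_range, mem_insert, mem_union, Finset.mem_sdiff, mem_Icc, mem_Ioo]
      omega
    have h₁₂ : ∀ x ∈ insert n (range n \ Ioo a b), ∀ y ∈ insert n (range n \ Ioo a b),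
        ∀ z ∈ Icc a b, ∀ t ∈ Icc a b, ¬ WheelCross n (S.erase (a, b)) x y z t := by
      refine not_wheelCross_of hS₀ (by simp; omega) ?_ ?_
      · simp only [mem_insert, Finset.mem_sdiff, mem_range, mem_Icc, mem_Ioo, DiagonalsCross,
          Between]
        intros
        omega
      · simp only [mem_insert, Finset.mem_sdiff, mem_range, mem_Icc, mem_Ioo]
        intro _ t ht htn x hx y hy hxy hxt hyt
        rw [mem_erase_pair, h.mem_inner (by omega) (by omega)]
        unfold Between
        omega
    rw [hU, treeCountWith_union (isCrossing_wheelCross n _) hab.ne _ _ h₁₂,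
      h.treeCountWith_outer_insert, treeCountWith_Icc hab hbn]
    · exact not_wheelCross_of_mem (Icc a b) (by simp; omega) (by simp; omega) h₁₂
    · ext x
      simp only [mem_range, mem_insert, mem_inter, Finset.mem_sdiff, mem_Icc, mem_Ioo,
        mem_singleton]
      omega
    · intro x hx hx' y hy hy'
      simp only [mem_insert, mem_Icc, mem_Ioo, Finset.mem_sdiff, mem_range] at hx hx' hy hy'
      by_cases hxn : x = n
      · subst hxn
        rw [wheelCross_extra (by omega) (by omega) (by omega) (by omega) (by omega) hab,
          mem_erase_pair]
        unfold Between
        omega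
      · rw [wheelCross_of_ne (by omega) (by omega) (by omega) (by omega)]
        unfold DiagonalsCross Between
        omega
  rw [split S, split (S.erase (a, b)), hsame, h₁, h₂]
  push_cast
  ring

/-! ### The change of the number of embracing triangles -/

/-- The triangles that contain the extra point. -/
def embracingTriples (n : ℕ) (S : Finset (ℕ × ℕ)) : Finset (ℕ × ℕ × ℕ) :=
  {p ∈ range n ×ˢ range n ×ˢ range n | (p.1 < p.2.1 ∧ p.2.1 < p.2.2) ∧
    (p.1, p.2.1) ∉ S ∧ (p.2.1, p.2.2) ∉ S ∧ (p.1, p.2.2) ∈ S}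

lemma mem_embracingTriples {x y z : ℕ} : (x, y, z) ∈ embracingTriples n S ↔
    (x < n ∧ y < n ∧ z < n) ∧ (x < y ∧ y < z) ∧ (x, y) ∉ S ∧ (y, z) ∉ S ∧ (x, z) ∈ S := by
  simp only [embracingTriples, mem_filter, mem_product, mem_range]

/-- Only triangles with the side `ab` change. Those with apex in the cap, `b - a - 1` of them,
embrace the extra point before the erasure; those with apex outside, `n - 1 - (b - a)` of them, do
so after it. -/
lemma embracingTriples_jump (h : IsMinimalCap n S a b) :
    (#(embracingTriples n S) : ℤ) - #(embracingTriples n (S.erase (a, b))) =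
      2 * (b - a : ℕ) - n := by
  obtain ⟨hab, hbn⟩ := h.pos.lt h.mem
  have h₁ : embracingTriples n S \ embracingTriples n (S.erase (a, b)) =
      (Ioo a b).image fun x => (a, x, b) := by
    ext ⟨x, y, z⟩
    simp only [Finset.mem_sdiff, mem_embracingTriples, mem_erase_pair, mem_image, mem_Ioo,
      Prod.mk.injEq]
    constructor
    · rintro ⟨⟨h1, h2, h3, h4, h5⟩, h6⟩
      have : x = a ∧ z = b := by tauto
      obtain ⟨rfl, rfl⟩ := this
      exact ⟨y, h2, rfl, rfl, rfl⟩
    · rintro ⟨u, hu, rfl, rfl, rfl⟩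
      have h1 : (a, u) ∉ S := fun hm => by have := h.minimal hm le_rfl hu.2.le; omega
      have h2 : (u, b) ∉ S := fun hm => by have := h.minimal hm hu.1.le le_rfl; omega
      have h3 := h.mem
      refine ⟨⟨by omega, hu, h1, h2, h3⟩, ?_⟩
      tauto
  have h₂ : embracingTriples n (S.erase (a, b)) \ embracingTriples n S =
      (range n \ Icc a b).image fun x => if x < a then (x, a, b) else (a, b, x) := by
    ext ⟨x, y, z⟩
    simp only [Finset.mem_sdiff, mem_embracingTriples, mem_erase_pair, mem_image, mem_range,
      mem_Icc]
    constructor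
    · rintro ⟨⟨h1, h2, h3, h4, h5⟩, h6⟩
      have : (x = a ∧ y = b) ∨ (y = a ∧ z = b) := by tauto
      rcases this with ⟨rfl, rfl⟩ | ⟨rfl, rfl⟩
      · exact ⟨z, by omega, by rw [if_neg (by omega)]⟩
      · exact ⟨x, by omega, by rw [if_pos (by omega)]⟩
    · rintro ⟨u, hu, heq⟩
      have h3 := h.mem
      split_ifs at heq with hua
      · simp only [Prod.mk.injEq] at heq
        obtain ⟨rfl, rfl, rfl⟩ := heq
        have h1 : (u, a) ∉ S := fun hm => absurd (h.pos.inter hm h.mem) (lt_irrefl a)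
        have h2 : (u, b) ∈ S := h.pos.up h.mem hua.le le_rfl hbn
        have : u ≠ a := by omega
        refine ⟨⟨by omega, by omega, ?_⟩, ?_⟩ <;> tauto
      · simp only [Prod.mk.injEq] at heq
        obtain ⟨rfl, rfl, rfl⟩ := heq
        have h1 : (b, u) ∉ S := fun hm => absurd (h.pos.inter h.mem hm) (lt_irrefl b)
        have h2 : (a, u) ∈ S := h.pos.up h.mem le_rfl (by omega) hu.1
        have : u ≠ b := by omega
        refine ⟨⟨by omega, by omega, ?_⟩, ?_⟩ <;> tauto
  have c₁ := card_sdiff_add_card_inter (embracingTriples n S) (embracingTriples n (S.erase (a, b)))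
  have c₂ := card_sdiff_add_card_inter (embracingTriples n (S.erase (a, b))) (embracingTriples n S)
  rw [inter_comm] at c₂
  rw [h₁, card_image_of_injective _ (fun x y hxy => by simpa using hxy), Nat.card_Ioo] at c₁
  rw [h₂, card_image_of_injOn, card_range_sdiff_Icc hab.le hbn] at c₂
  · omega
  · intro x hx y hy hxy
    simp only [mem_coe, Finset.mem_sdiff, mem_range, mem_Icc] at hx hy
    dsimp only at hxy
    split_ifs at hxy <;> simp only [Prod.mk.injEq] at hxy <;> omega

/-! ### Comparison of positions -/

lemma eq_add_sum_of_jump {F : Finset (ℕ × ℕ) → ℤ} {Δ : ℕ → ℤ}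
    (hF : ∀ S a b, IsMinimalCap n S a b → F S - F (S.erase (a, b)) = Δ (b - a))
    {S : Finset (ℕ × ℕ)} (hS : IsPosition n S) : F S = F ∅ + ∑ p ∈ S, Δ (p.2 - p.1) := by
  induction hk : #S generalizing S with
  | zero =>
    rw [card_eq_zero] at hk
    subst hk
    simp
  | succ k ih =>
    have hne : S.Nonempty := by
      rw [← card_pos]
      omega
    -- A pair with the smallest difference is inclusion-minimal.
    obtain ⟨⟨a, b⟩, hab, hmin⟩ := exists_min_image S (fun p => p.2 - p.1) hne
    have hcap : IsMinimalCap n S a b := by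
      refine ⟨hS, hab, fun {c d} hcd h1 h2 => ?_⟩
      have h3 := hmin _ hcd
      have h4 := hS.lt hcd
      dsimp only at h3
      omega
    have h1 := ih hcap.erase (by rw [card_erase_of_mem hab]; omega)
    have h2 := hF S a b hcap
    rw [← add_sum_erase S _ hab]
    dsimp only
    linarith

/-- In a balanced position the extra point lies on the larger side of every diagonal. -/
def IsBalanced (n : ℕ) (T : Finset (ℕ × ℕ)) : Prop :=
  ∀ a b, a < b → b < n → (n < 2 * (b - a) → (a, b) ∈ T) ∧ (2 * (b - a) < n → (a, b) ∉ T)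

/-- Pairs in `S \ T` have `2 * d ≤ n` and pairs in `T \ S` have `2 * d ≥ n`, so passing from `S` to
`T` drops nonpositive terms and adds nonnegative ones. Diameters with `2 * d = n` are left free by
balance; both sign conditions apply to them, so their terms vanish. -/
lemma le_of_isBalanced {F : Finset (ℕ × ℕ) → ℤ} {Δ : ℕ → ℤ}
    (hF : ∀ S a b, IsMinimalCap n S a b → F S - F (S.erase (a, b)) = Δ (b - a))
    (hpos : ∀ d, 0 < d → d < n → n ≤ 2 * d → 0 ≤ Δ d)
    (hneg : ∀ d, 0 < d → d < n → 2 * d ≤ n → Δ d ≤ 0)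
    {S T : Finset (ℕ × ℕ)} (hS : IsPosition n S) (hT : IsPosition n T) (hbal : IsBalanced n T) :
    F S ≤ F T := by
  rw [eq_add_sum_of_jump hF hS, eq_add_sum_of_jump hF hT, add_le_add_iff_left]
  have h1 : ∑ p ∈ S \ T, Δ (p.2 - p.1) ≤ 0 := by
    refine sum_nonpos fun p hp => ?_
    obtain ⟨a, b⟩ := p
    rw [Finset.mem_sdiff] at hp
    obtain ⟨h1, h2⟩ := hS.lt hp.1
    have := hbal a b h1 h2
    refine hneg _ (Nat.sub_pos_of_lt h1) (by dsimp only; omega) ?_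
    by_contra! hlt
    exact hp.2 (this.1 hlt)
  have h2 : 0 ≤ ∑ p ∈ T \ S, Δ (p.2 - p.1) := by
    refine sum_nonneg fun p hp => ?_
    obtain ⟨a, b⟩ := p
    rw [Finset.mem_sdiff] at hp
    obtain ⟨h1, h2⟩ := hT.lt hp.1
    have := hbal a b h1 h2
    refine hpos _ (Nat.sub_pos_of_lt h1) (by dsimp only; omega) ?_
    by_contra! hlt
    exact this.2 hlt hp.1
  have h3 := sum_inter_add_sum_sdiff S T fun p => Δ (p.2 - p.1)
  have h4 := sum_inter_add_sum_sdiff T S fun p => Δ (p.2 - p.1)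
  rw [inter_comm] at h4
  linarith

theorem embracingTriples_le {S T : Finset (ℕ × ℕ)} (hS : IsPosition n S) (hT : IsPosition n T)
    (hbal : IsBalanced n T) : #(embracingTriples n S) ≤ #(embracingTriples n T) := by
  have := le_of_isBalanced (F := fun S => (#(embracingTriples n S) : ℤ))
    (Δ := fun d => 2 * (d : ℤ) - n) (fun S a b h => embracingTriples_jump h)
    (fun d _ _ h => by omega) (fun d _ _ h => by omega) hS hT hbal
  exact_mod_cast this

theorem matchCount_le {S T : Finset (ℕ × ℕ)} (hS : IsPosition n S) (hT : IsPosition n T)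
    (hbal : IsBalanced n T) : matchCount (WheelCross n S) (range (n + 1)) ≤
      matchCount (WheelCross n T) (range (n + 1)) := by
  have := le_of_isBalanced (F := fun S => (matchCount (WheelCross n S) (range (n + 1)) : ℤ))
    (Δ := fun d => convexMatchings d * convexMatchings (n - 1 - d) -
      convexMatchings (d - 1) * convexMatchings (n - d)) (fun S a b h => matchCount_jump h)
    ?_ ?_ hS hT hbal
  · exact_mod_cast this
  · intro d h1 h2 h3
    -- The hypothesis `n ≤ 2 * d` is precisely the inequality `n - 1 - d ≤ d - 1` of the two
    -- indices.
    have := convexMatchings_mul_le (k := n - 1 - d) (m := d - 1) (by omega)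
    rw [show n - 1 - d + 1 = n - d by omega, Nat.sub_add_cancel h1] at this
    zify at this
    linarith
  · intro d h1 h2 h3
    have := convexMatchings_mul_le (k := d - 1) (m := n - 1 - d) (by omega)
    rw [show n - 1 - d + 1 = n - d by omega, Nat.sub_add_cancel h1] at this
    zify at this
    linarith

theorem treeCount_le {S T : Finset (ℕ × ℕ)} (hS : IsPosition n S) (hT : IsPosition n T)
    (hbal : IsBalanced n T) : treeCount (WheelCross n S) (range (n + 1)) ≤
      treeCount (WheelCross n T) (range (n + 1)) := by
  have := le_of_isBalanced (F := fun S => (treeCount (WheelCross n S) (range (n + 1)) : ℤ))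
    (Δ := fun d => rootedForests (d + 2) d * rootedForests (n - d + 1) (n - d) -
      rootedForests (d + 1) d * rootedForests (n - d + 2) (n - d)) (fun S a b h => treeCount_jump h)
    ?_ ?_ hS hT hbal
  · exact_mod_cast this
  · intro d h1 h2 h3
    -- The two sides of the diagonal have lengths `k + 1` and `m + 1`, and `n ≤ 2 * d` becomes `m ≤
    -- k`.
    obtain ⟨k, rfl⟩ : ∃ k, d = k + 1 := ⟨d - 1, by omega⟩
    obtain ⟨m, hm⟩ : ∃ m, n - (k + 1) = m + 1 := ⟨n - (k + 1) - 1, by omega⟩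
    have := rootedForests_mul_le (k := m) (m := k) (by omega)
    rw [hm]
    zify at this
    linarith
  · intro d h1 h2 h3
    obtain ⟨k, rfl⟩ : ∃ k, d = k + 1 := ⟨d - 1, by omega⟩
    obtain ⟨m, hm⟩ : ∃ m, n - (k + 1) = m + 1 := ⟨n - (k + 1) - 1, by omega⟩
    have := rootedForests_mul_le (k := k) (m := m) (by omega)
    rw [hm]
    zify at this
    linarith

end Position

/-! ### Orientation -/

/-- Twice the signed area of the triangle `abc`. -/
def orient (a b c : ℂ) : ℝ := (b.re - a.re) * (c.im - a.im) - (b.im - a.im) * (c.re - a.re)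

lemma orient_rotate (a b c : ℂ) : orient a b c = orient b c a := by unfold orient; ring

lemma orient_swap (a b c : ℂ) : orient a c b = -orient a b c := by unfold orient; ring

lemma orient_swap_left (a b c : ℂ) : orient b a c = -orient a b c := by unfold orient; ring

lemma orient_self_left (a c : ℂ) : orient a a c = 0 := by unfold orient; ring

lemma orient_self_right (a c : ℂ) : orient a c c = 0 := by unfold orient; ring

lemma orient_self_outer (a c : ℂ) : orient a c a = 0 := by unfold orient; ring

lemma orient_combo (a b x y : ℂ) {s t : ℝ} (h : s + t = 1) :
    orient a b (s • x + t • y) = s * orient a b x + t * orient a b y := by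
  obtain rfl : t = 1 - s := by linarith
  simp only [orient, Complex.add_re, Complex.add_im, Complex.real_smul, Complex.mul_re,
    Complex.mul_im, Complex.ofReal_re, Complex.ofReal_im]
  ring

lemma exists_eq_of_orient_eq_zero {a b c : ℂ} (hab : a ≠ b) (h : orient a b c = 0) :
    ∃ t : ℝ, c = a + t • (b - a) := by
  have hpos : 0 < (b.re - a.re) ^ 2 + (b.im - a.im) ^ 2 := by
    by_contra! hle
    refine hab (Complex.ext ?_ ?_) <;> nlinarith [sq_nonneg (b.re - a.re), sq_nonneg (b.im - a.im)]
  unfold orient at h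
  refine ⟨((b.re - a.re) * (c.re - a.re) + (b.im - a.im) * (c.im - a.im)) /
    ((b.re - a.re) ^ 2 + (b.im - a.im) ^ 2), Complex.ext ?_ ?_⟩
  · simp only [Complex.add_re, Complex.real_smul, Complex.mul_re, Complex.ofReal_re,
      Complex.ofReal_im, Complex.sub_re, zero_mul, sub_zero]
    field_simp
    linear_combination (-(b.im - a.im)) * h
  · simp only [Complex.add_im, Complex.real_smul, Complex.mul_im, Complex.ofReal_re,
      Complex.ofReal_im, Complex.sub_im, zero_mul, add_zero]
    field_simp
    linear_combination (b.re - a.re) * h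

lemma collinear_of_orient_eq_zero {a b c : ℂ} (hab : a ≠ b) (h : orient a b c = 0) :
    Collinear ℝ ({a, b, c} : Set ℂ) := by
  obtain ⟨t, rfl⟩ := exists_eq_of_orient_eq_zero hab h
  rw [collinear_iff_of_mem (p₀ := a) (by simp)]
  refine ⟨b - a, ?_⟩
  simp only [Set.mem_insert_iff, Set.mem_singleton_iff, vadd_eq_add]
  rintro p (rfl | rfl | rfl)
  · exact ⟨0, by simp⟩
  · exact ⟨1, by simp⟩
  · exact ⟨t, by rw [add_comm]⟩

/-- The three signed areas are the unnormalized barycentric coordinates of `a` in the triangle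
`xyz`. Regrouping the weights of `y` and `z` gives the point `q` of the opposite side. -/
lemma exists_mem_openSegment {K : Set ℂ} (hK : Convex ℝ K) {a x y z : ℂ} (hy : y ∈ K)
    (hz : z ∈ K) (h₁ : 0 < orient a x y) (h₂ : 0 < orient a y z) (h₃ : 0 < orient a z x) :
    ∃ q ∈ K, a ∈ openSegment ℝ x q := by
  have hne : orient a z x + orient a x y ≠ 0 := by positivity
  have hne' : orient a y z + (orient a z x + orient a x y) ≠ 0 := by positivity
  refine ⟨(orient a z x / (orient a z x + orient a x y)) • y +
    (orient a x y / (orient a z x + orient a x y)) • z, ?_, ?_⟩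
  · exact hK hy hz (by positivity) (by positivity) (by field_simp)
  · refine ⟨orient a y z / (orient a y z + (orient a z x + orient a x y)),
      (orient a z x + orient a x y) / (orient a y z + (orient a z x + orient a x y)),
      by positivity, by positivity, by field_simp, ?_⟩
    have e1 : (orient a z x + orient a x y) /
        (orient a y z + (orient a z x + orient a x y)) *
        (orient a z x / (orient a z x + orient a x y)) =
        orient a z x / (orient a y z + (orient a z x + orient a x y)) := by field_simp
    have e2 : (orient a z x + orient a x y) /
        (orient a y z + (orient a z x + orient a x y)) *
        (orient a x y / (orient a z x + orient a x y)) =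
        orient a x y / (orient a y z + (orient a z x + orient a x y)) := by field_simp
    rw [smul_add, smul_smul, smul_smul, e1, e2]
    apply Complex.ext
    · simp only [Complex.add_re, Complex.real_smul, Complex.mul_re, Complex.ofReal_re,
        Complex.ofReal_im, zero_mul, sub_zero]
      field_simp
      unfold orient
      ring
    · simp only [Complex.add_im, Complex.real_smul, Complex.mul_im, Complex.ofReal_re,
        Complex.ofReal_im, zero_mul, add_zero]
      field_simp
      unfold orient
      ring

lemma convex_orient_nonneg (a b : ℂ) : Convex ℝ {q | 0 ≤ orient a b q} := by
  intro x hx y hy s t hs ht hst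
  have hx' : 0 ≤ orient a b x := hx
  have hy' : 0 ≤ orient a b y := hy
  change 0 ≤ orient a b (s • x + t • y)
  rw [orient_combo a b x y hst]
  positivity

/-! ### Conowheel sets -/

section Conowheel

variable {H : Finset ℂ} {w : ℂ}

lemma _root_.IsConowheelSet.orient_ne_zero (hH : IsConowheelSet H w) {a b c : ℂ}
    (ha : a ∈ insert w H) (hb : b ∈ insert w H) (hc : c ∈ insert w H) (hab : a ≠ b) (hac : a ≠ c)
    (hbc : b ≠ c) : orient a b c ≠ 0 := fun h =>
  hH.generalPosition a ha b hb c hc hab hac hbc (collinear_of_orient_eq_zero hab h)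

/-- An extreme point is not strictly inside a triangle of points of the set. This is the only form
in which extremeness enters the orderings and the position axioms. -/
lemma _root_.IsConowheelSet.not_surrounded (hH : IsConowheelSet H w) {a x y z : ℂ} (ha : a ∈ H)
    (hx : x ∈ insert w H) (hy : y ∈ insert w H) (hz : z ∈ insert w H) (h₁ : 0 < orient a x y)
    (h₂ : 0 < orient a y z) (h₃ : 0 < orient a z x) : False := by
  obtain ⟨q, hq, haq⟩ := exists_mem_openSegment (convex_convexHull ℝ _)
    (subset_convexHull ℝ _ (mem_coe.2 hy)) (subset_convexHull ℝ _ (mem_coe.2 hz)) h₁ h₂ h₃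
  have := (mem_extremePoints.1 (hH.extreme a ha)).2 x (subset_convexHull ℝ _ (mem_coe.2 hx)) q hq
    haq
  rw [this.1, orient_self_left] at h₁
  exact lt_irrefl _ h₁

/-- Two disjoint segments cross iff the ends of one lie on different sides of the other, provided
that the ends of the latter are extreme. -/
lemma _root_.IsConowheelSet.not_disjoint_iff (hH : IsConowheelSet H w) {a b x y : ℂ} (ha : a ∈ H)
    (hb : b ∈ H) (hx : x ∈ insert w H) (hy : y ∈ insert w H) (hab : a ≠ b) (hax : a ≠ x)
    (hay : a ≠ y) (hbx : b ≠ x) (hby : b ≠ y) :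
    ¬ Disjoint (openSegment ℝ a b) (openSegment ℝ x y) ↔
      (orient a b x < 0 ↔ ¬ orient a b y < 0) := by
  have ha' := mem_insert_of_mem (b := w) ha
  have hb' := mem_insert_of_mem (b := w) hb
  have hx0 := hH.orient_ne_zero ha' hb' hx hab hax hbx
  have hy0 := hH.orient_ne_zero ha' hb' hy hab hay hby
  rw [Set.not_disjoint_iff]
  constructor
  · rintro ⟨q, ⟨s, t, hs, ht, hst, rfl⟩, ⟨s', t', hs', ht', hst', hq⟩⟩
    have h1 : orient a b (s • a + t • b) = 0 := by
      rw [orient_combo a b a b hst, orient_self_outer, orient_self_right]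
      ring
    rw [← hq, orient_combo a b x y hst'] at h1
    constructor
    · intro h h'
      have := mul_neg_of_pos_of_neg hs' h
      have := mul_neg_of_pos_of_neg ht' h'
      linarith
    · intro h
      have h2 : 0 < orient a b y := lt_of_le_of_ne (not_lt.1 h) hy0.symm
      by_contra h3
      have h4 : 0 < orient a b x := lt_of_le_of_ne (not_lt.1 h3) hx0.symm
      have := mul_pos hs' h4
      have := mul_pos ht' h2
      linarith
  · intro h
    have hprod : orient a b x * orient a b y < 0 := by
      rcases lt_or_gt_of_ne hx0 with h1 | h1
      · exact mul_neg_of_neg_of_pos h1 (lt_of_le_of_ne (not_lt.1 (h.1 h1)) hy0.symm)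
      · refine mul_neg_of_pos_of_neg h1 ?_
        by_contra h2
        exact absurd (h.2 h2) h1.not_gt
    -- The point of the segment `xy` on the line `ab`, with weights proportional to the distances of
    -- `y` and `x` from that line.
    obtain ⟨s, t, hs, ht, hst, hq0⟩ : ∃ s t : ℝ, 0 < s ∧ 0 < t ∧ s + t = 1 ∧
        s * orient a b x + t * orient a b y = 0 := by
      have hne : orient a b x - orient a b y ≠ 0 := by
        intro h0
        have h1 : orient a b x = orient a b y := by linarith
        rw [h1] at hprod
        nlinarith [sq_nonneg (orient a b y)]
      refine ⟨-orient a b y / (orient a b x - orient a b y),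
        orient a b x / (orient a b x - orient a b y), ?_, ?_, by field_simp; ring,
        by field_simp; ring⟩
      · rcases lt_or_gt_of_ne hx0 with h1 | h1
        · have : 0 < orient a b y := by by_contra! h2; nlinarith
          exact div_pos_of_neg_of_neg (by linarith) (by linarith)
        · have : orient a b y < 0 := by by_contra! h2; nlinarith
          exact div_pos (by linarith) (by linarith)
      · rcases lt_or_gt_of_ne hx0 with h1 | h1
        · have : 0 < orient a b y := by by_contra! h2; nlinarith
          exact div_pos_of_neg_of_neg (by linarith) (by linarith)
        · have : orient a b y < 0 := by by_contra! h2; nlinarith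
          exact div_pos (by linarith) (by linarith)
    have hqs : s • x + t • y ∈ openSegment ℝ x y := ⟨s, t, hs, ht, hst, rfl⟩
    refine ⟨s • x + t • y, ?_, hqs⟩
    have hqK : s • x + t • y ∈ convexHull ℝ ((insert w H : Finset ℂ) : Set ℂ) :=
      convex_convexHull ℝ _ (subset_convexHull ℝ _ (mem_coe.2 hx))
        (subset_convexHull ℝ _ (mem_coe.2 hy)) hs.le ht.le hst
    have hqo : orient a b (s • x + t • y) = 0 := by rw [orient_combo a b x y hst, hq0]
    obtain ⟨r, hr⟩ := exists_eq_of_orient_eq_zero hab hqo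
    have hxK := subset_convexHull ℝ ((insert w H : Finset ℂ) : Set ℂ) (mem_coe.2 hx)
    have hyK := subset_convexHull ℝ ((insert w H : Finset ℂ) : Set ℂ) (mem_coe.2 hy)
    have haK := subset_convexHull ℝ ((insert w H : Finset ℂ) : Set ℂ) (mem_coe.2 ha')
    have hbK := subset_convexHull ℝ ((insert w H : Finset ℂ) : Set ℂ) (mem_coe.2 hb')
    have hae := (mem_extremePoints.1 (hH.extreme a ha)).2
    have hbe := (mem_extremePoints.1 (hH.extreme b hb)).2
    generalize hqq : s • x + t • y = q at *
    have hqa : q ≠ a := by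
      rintro rfl
      exact hax (hae x hxK y hyK hqs).1.symm
    have hqb : q ≠ b := by
      rintro rfl
      exact hbx (hbe x hxK y hyK hqs).1.symm
    -- If the point were beyond `a`, then `a` would lie strictly between it and `b`, contrary to
    -- extremeness; likewise `r < 1` because `b` is extreme.
    have hr0 : 0 < r := by
      by_contra! hle
      rcases hle.eq_or_lt with rfl | hlt
      · exact hqa (by rw [hr]; simp)
      · refine hqa (hae q hqK b hbK ⟨1 / (1 - r), -r / (1 - r), ?_, ?_, ?_, ?_⟩).1
        · exact div_pos one_pos (by linarith)
        · exact div_pos (by linarith) (by linarith)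
        · rw [← add_div]
          exact div_self (by linarith)
        · have h1 : 1 - r ≠ 0 := by linarith
          rw [hr]
          match_scalars <;> field_simp <;> ring
    have hr1 : r < 1 := by
      by_contra! hle
      rcases hle.eq_or_lt with rfl | hlt
      · exact hqb (by rw [hr]; simp)
      · refine hqb (hbe q hqK a haK ⟨1 / r, (r - 1) / r, ?_, ?_, ?_, ?_⟩).1
        · exact div_pos one_pos hr0
        · exact div_pos (by linarith) hr0
        · rw [← add_div]
          field_simp
          ring
        · rw [hr]
          match_scalars <;> field_simp
          ring
    refine ⟨1 - r, r, by linarith, hr0, by ring, ?_⟩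
    rw [hr]
    simp only [Complex.real_smul]
    push_cast
    ring

lemma _root_.IsConowheelSet.disjoint_of_common (hH : IsConowheelSet H w) {a b c : ℂ}
    (ha : a ∈ insert w H) (hb : b ∈ insert w H) (hc : c ∈ insert w H) (hab : a ≠ b)
    (hac : a ≠ c) (hbc : b ≠ c) :
    Disjoint (openSegment ℝ a b) (openSegment ℝ a c) := by
  rw [Set.disjoint_left]
  rintro q ⟨s, t, hs, ht, hst, rfl⟩ ⟨s', t', hs', ht', hst', hq⟩
  have h1 : orient a b (s • a + t • b) = 0 := by
    rw [orient_combo a b a b hst, orient_self_outer, orient_self_right]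
    ring
  rw [← hq, orient_combo a b a c hst', orient_self_outer, mul_zero, zero_add] at h1
  exact hH.orient_ne_zero ha hb hc hab hac hbc ((mul_eq_zero.1 h1).resolve_left ht'.ne')

/-! ### Labellings -/

/-- A labelling of the points of `H ∪ {w}`: the points of `H` in counterclockwise order, and `w`
last. -/
structure IsLabelling (n : ℕ) (H : Finset ℂ) (w : ℂ) (p : ℕ → ℂ) : Prop where
  image : (range n).image p = H
  inj : Set.InjOn p (range n)
  orient_pos : ∀ {i j k}, i < j → j < k → k < n → 0 < orient (p i) (p j) (p k)
  last : p n = w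

/-- Transitivity and totality are required only on `s`, since the angular order is a strict total
order only on the other vertices. The list is built by removing a largest element at each step. -/
lemma exists_enumeration {α : Type*} [DecidableEq α] {r : α → α → Prop} (s : Finset α)
    (htrans : ∀ x ∈ s, ∀ y ∈ s, ∀ z ∈ s, r x y → r y z → r x z)
    (htot : ∀ x ∈ s, ∀ y ∈ s, x ≠ y → r x y ∨ r y x) (a : α) :
    ∃ e : ℕ → α, (range #s).image e = s ∧ ∀ i j, i < j → j < #s → r (e i) (e j) := by
  have hmax : ∀ t : Finset α, t ⊆ s → t.Nonempty → ∃ m ∈ t, ∀ x ∈ t, x ≠ m → r x m := by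
    intro t
    induction t using Finset.induction_on with
    | empty => intro _ h; exact absurd h (by simp)
    | insert b t hb ih =>
      intro hs _
      rcases t.eq_empty_or_nonempty with rfl | hne
      · exact ⟨b, by simp, by simp⟩
      obtain ⟨m, hm, hmx⟩ := ih ((subset_insert b t).trans hs) hne
      have hbs := hs (mem_insert_self b t)
      have hts : ∀ x ∈ t, x ∈ s := fun x hx => hs (mem_insert_of_mem hx)
      rcases htot b hbs m (hts m hm) (fun h => hb (h ▸ hm)) with h | h
      · refine ⟨m, mem_insert_of_mem hm, fun x hx hxm => ?_⟩
        rcases mem_insert.1 hx with rfl | hx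
        exacts [h, hmx x hx hxm]
      · refine ⟨b, mem_insert_self b t, fun x hx hxb => ?_⟩
        have hx := (mem_insert.1 hx).resolve_left hxb
        by_cases hxm : x = m
        · rwa [hxm]
        · exact htrans x (hts x hx) m (hts m hm) b hbs (hmx x hx hxm) h
  induction hk : #s generalizing s with
  | zero =>
    rw [card_eq_zero] at hk
    subst hk
    exact ⟨fun _ => a, by simp, by omega⟩
  | succ k ih =>
    obtain ⟨m, hm, hmx⟩ := hmax s subset_rfl (card_pos.1 (by omega))
    have hsub := erase_subset m s
    obtain ⟨e, he, hr⟩ := ih (s.erase m)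
      (fun x hx y hy z hz => htrans x (hsub hx) y (hsub hy) z (hsub hz))
      (fun x hx y hy => htot x (hsub hx) y (hsub hy))
      (fun t ht => hmax t (ht.trans hsub)) (by rw [card_erase_of_mem hm]; omega)
    have hei : ∀ i, i < k → e i ∈ s.erase m := fun i hi => by
      rw [← he]
      exact mem_image_of_mem e (mem_range.2 hi)
    refine ⟨fun i => if i = k then m else e i, ?_, fun i j hij hj => ?_⟩
    · rw [range_add_one, image_insert, if_pos rfl, ← insert_erase hm]
      congr 1
      rw [← he]
      refine image_congr fun i hi => ?_
      rw [mem_coe, mem_range] at hi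
      exact if_neg hi.ne
    · dsimp only
      rw [if_neg (by omega)]
      split_ifs with h
      · have := mem_erase.1 (hei i (by omega))
        exact hmx _ this.2 this.1
      · exact hr i j hij (by omega)

/-- The other vertices are sorted by angle around a vertex `a`; this is transitive because `a` is
not surrounded. A clockwise triple `i < j < k` away from `a` would surround its middle vertex. -/
lemma exists_isLabelling (hH : IsConowheelSet H w) (hne : H.Nonempty) :
    ∃ p, IsLabelling #H H w p := by
  obtain ⟨a, ha⟩ := hne
  have hmem : ∀ x ∈ H, x ∈ insert w H := fun x hx => mem_insert_of_mem hx
  have haw := hmem a ha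
  have hsub : ∀ x ∈ H.erase a, x ∈ insert w H ∧ a ≠ x := fun x hx =>
    ⟨hmem x (mem_of_mem_erase hx), (ne_of_mem_erase hx).symm⟩
  obtain ⟨e, he, hr⟩ := exists_enumeration (r := fun x y => 0 < orient a x y) (H.erase a) (by
      intro x hx y hy z hz hxy hyz
      obtain ⟨hx', hax⟩ := hsub x hx
      obtain ⟨hy', hay⟩ := hsub y hy
      obtain ⟨hz', haz⟩ := hsub z hz
      have hxz : x ≠ z := by
        rintro rfl
        rw [orient_swap] at hyz
        linarith
      by_contra! hle
      have h0 := hH.orient_ne_zero haw hx' hz' hax haz hxz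
      have : 0 < orient a z x := by
        rw [orient_swap]
        exact neg_pos.2 (lt_of_le_of_ne hle h0)
      exact hH.not_surrounded ha hx' hy' hz' hxy hyz this) (by
      intro x hx y hy hxy
      obtain ⟨hx', hax⟩ := hsub x hx
      obtain ⟨hy', hay⟩ := hsub y hy
      rw [orient_swap a x y]
      rcases lt_or_gt_of_ne (hH.orient_ne_zero haw hx' hy' hax hay hxy) with h | h
      exacts [Or.inr (neg_pos.2 h), Or.inl h]) a
  rw [card_erase_of_mem ha] at he hr
  have hpos : 0 < #H := card_pos.2 ⟨a, ha⟩
  set n := #H with hn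
  have hei : ∀ i, 0 < i → i < n → e (i - 1) ∈ H.erase a := fun i h1 h2 => by
    rw [← he]
    exact mem_image_of_mem e (mem_range.2 (by omega))
  let p : ℕ → ℂ := fun i => if i = n then w else if i = 0 then a else e (i - 1)
  have hp0 : p 0 = a := by simp [p, hpos.ne]
  have hpi : ∀ i, 0 < i → i < n → p i = e (i - 1) := fun i h1 h2 => by
    simp only [p]
    rw [if_neg h2.ne, if_neg h1.ne']
  have himg : (range n).image p = H := by
    ext x
    rw [mem_image]
    constructor
    · rintro ⟨i, hi, rfl⟩
      rw [mem_range] at hi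
      rcases Nat.eq_zero_or_pos i with rfl | h
      · rwa [hp0]
      · rw [hpi i h hi]
        exact mem_of_mem_erase (hei i h hi)
    · intro hx
      by_cases hxa : x = a
      · exact ⟨0, mem_range.2 hpos, by rw [hp0, hxa]⟩
      · have : x ∈ H.erase a := mem_erase.2 ⟨hxa, hx⟩
        rw [← he] at this
        obtain ⟨i, hi, rfl⟩ := mem_image.1 this
        rw [mem_range] at hi
        exact ⟨i + 1, mem_range.2 (by omega), by rw [hpi _ (by omega) (by omega)]; simp⟩
  have hinj : Set.InjOn p (range n) := by
    rw [← card_image_iff, himg, card_range]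
  have hpH : ∀ i, i < n → p i ∈ H := fun i hi => by
    rw [← himg]
    exact mem_image_of_mem p (mem_range.2 hi)
  have h0 : ∀ i j, 0 < i → i < j → j < n → 0 < orient a (p i) (p j) := by
    intro i j h1 h2 h3
    rw [hpi i h1 (by omega), hpi j (by omega) h3]
    exact hr _ _ (by omega) (by omega)
  refine ⟨p, himg, hinj, fun {i j k} hij hjk hk => ?_, by simp [p]⟩
  rcases Nat.eq_zero_or_pos i with rfl | hi
  · rw [hp0]
    exact h0 j k hij hjk hk
  · by_contra! hle
    have hne : ∀ x y, x < n → y < n → x ≠ y → p x ≠ p y := fun x y hx hy hxy h =>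
      hxy (hinj (mem_coe.2 (mem_range.2 hx)) (mem_coe.2 (mem_range.2 hy)) h)
    have hz := hH.orient_ne_zero (hmem _ (hpH i (by omega))) (hmem _ (hpH j (by omega)))
      (hmem _ (hpH k hk)) (hne i j (by omega) (by omega) (by omega))
      (hne i k (by omega) (by omega) (by omega)) (hne j k (by omega) (by omega) (by omega))
    have hlt : orient (p i) (p j) (p k) < 0 := lt_of_le_of_ne hle hz
    -- The middle vertex would be strictly inside the triangle formed by `a`, `p i` and `p k`.
    refine hH.not_surrounded (hpH j (by omega)) haw (hmem _ (hpH i (by omega)))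
      (hmem _ (hpH k hk)) ?_ ?_ ?_
    · rw [orient_rotate]
      exact h0 i j hi hij (by omega)
    · rw [orient_swap, ← orient_rotate]
      linarith
    · rw [← orient_rotate, ← orient_rotate, ← orient_rotate, ← orient_rotate]
      exact h0 j k (by omega) hjk hk

/-- The pairs of polygon vertices that have the extra point on their right. -/
noncomputable def capSet (n : ℕ) (p : ℕ → ℂ) : Finset (ℕ × ℕ) :=
  {e ∈ range n ×ˢ range n | e.1 < e.2 ∧ orient (p e.1) (p e.2) (p n) < 0}

lemma mem_capSet {n : ℕ} {p : ℕ → ℂ} {i j : ℕ} :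
    (i, j) ∈ capSet n p ↔ i < j ∧ j < n ∧ orient (p i) (p j) (p n) < 0 := by
  simp only [capSet, mem_filter, mem_product, mem_range]
  constructor
  · rintro ⟨⟨-, h1⟩, h2, h3⟩
    exact ⟨h2, h1, h3⟩
  · rintro ⟨h1, h2, h3⟩
    exact ⟨⟨h1.trans h2, h2⟩, h1, h3⟩

variable {n : ℕ} {p : ℕ → ℂ}

lemma IsLabelling.mem (hp : IsLabelling n H w p) {i : ℕ} (hi : i < n) : p i ∈ H := by
  rw [← hp.image]
  exact mem_image_of_mem p (mem_range.2 hi)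

lemma IsLabelling.mem_insert (hp : IsLabelling n H w p) {i : ℕ} (hi : i ≤ n) :
    p i ∈ insert w H := by
  rcases hi.eq_or_lt with rfl | hi
  · rw [hp.last]
    exact mem_insert_self _ _
  · exact mem_insert_of_mem (hp.mem hi)

lemma IsLabelling.ne (hp : IsLabelling n H w p) (hH : IsConowheelSet H w) {i j : ℕ} (hi : i ≤ n)
    (hj : j ≤ n) (hij : i ≠ j) : p i ≠ p j := by
  intro h
  rcases hi.eq_or_lt with rfl | hi <;> rcases hj.eq_or_lt with rfl | hj
  · exact hij rfl
  · rw [hp.last] at h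
    exact hH.notMem (h ▸ hp.mem hj)
  · rw [hp.last] at h
    exact hH.notMem (h ▸ hp.mem hi)
  · exact hij (hp.inj (mem_coe.2 (mem_range.2 hi)) (mem_coe.2 (mem_range.2 hj)) h)

lemma IsLabelling.orient_ne_zero (hp : IsLabelling n H w p) (hH : IsConowheelSet H w)
    {i j k : ℕ} (hi : i ≤ n) (hj : j ≤ n) (hk : k ≤ n) (hij : i ≠ j) (hik : i ≠ k) (hjk : j ≠ k) :
    orient (p i) (p j) (p k) ≠ 0 :=
  hH.orient_ne_zero (hp.mem_insert hi) (hp.mem_insert hj) (hp.mem_insert hk) (hp.ne hH hi hj hij)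
    (hp.ne hH hi hk hik) (hp.ne hH hj hk hjk)

/-- Each violation surrounds a vertex. Moving the right end of a member from `b` to `d` could fail
only if `a` were surrounded by `b`, `d` and the extra point, and similarly for the left end. Two
members that lie side by side would surround `c` by `a`, the extra point and `d`. -/
lemma IsLabelling.isPosition (hp : IsLabelling n H w p) (hH : IsConowheelSet H w) :
    IsPosition n (capSet n p) := by
  have right : ∀ {a b d}, (a, b) ∈ capSet n p → b ≤ d → d < n → (a, d) ∈ capSet n p := by
    intro a b d hab hbd hd
    rw [mem_capSet] at hab ⊢
    obtain ⟨h1, h2, h3⟩ := hab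
    refine ⟨by omega, hd, ?_⟩
    rcases hbd.eq_or_lt with rfl | hbd
    · exact h3
    by_contra! hle
    have hpos : 0 < orient (p a) (p d) (p n) := lt_of_le_of_ne hle
      (hp.orient_ne_zero hH (by omega) (by omega) le_rfl (by omega) (by omega) (by omega)).symm
    refine hH.not_surrounded (hp.mem (by omega)) (hp.mem_insert h2.le) (hp.mem_insert hd.le)
      (hp.mem_insert le_rfl) (hp.orient_pos h1 hbd hd) hpos ?_
    rw [orient_swap]
    linarith
  have left : ∀ {a c d}, (a, d) ∈ capSet n p → c ≤ a → (c, d) ∈ capSet n p := by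
    intro a c d had hca
    rw [mem_capSet] at had ⊢
    obtain ⟨h1, h2, h3⟩ := had
    refine ⟨by omega, h2, ?_⟩
    rcases hca.eq_or_lt with rfl | hca
    · exact h3
    by_contra! hle
    have hpos : 0 < orient (p c) (p d) (p n) := lt_of_le_of_ne hle
      (hp.orient_ne_zero hH (by omega) (by omega) le_rfl (by omega) (by omega) (by omega)).symm
    refine hH.not_surrounded (hp.mem h2) (hp.mem_insert (i := c) (by omega))
      (hp.mem_insert (i := a) (by omega)) (hp.mem_insert le_rfl) ?_ ?_ ?_
    · rw [orient_rotate]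
      exact hp.orient_pos hca h1 h2
    · rw [orient_swap_left]
      linarith
    · rw [← orient_rotate]
      exact hpos
  refine ⟨fun h => ?_, fun h h1 h2 h3 => left (right h h2 h3) h1, fun {a b c d} h h' => ?_⟩
  · rw [mem_capSet] at h
    exact ⟨h.1, h.2.1⟩
  · by_contra! hle
    have hc := (mem_capSet.1 h').1.trans (mem_capSet.1 h').2.1
    have h1 := mem_capSet.1 (right h hle hc)
    have h2 := mem_capSet.1 h'
    refine hH.not_surrounded (hp.mem hc) (hp.mem_insert (i := a) (by omega))
      (hp.mem_insert le_rfl) (hp.mem_insert h2.2.1.le) ?_ ?_ ?_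
    · rw [orient_swap_left, orient_swap, orient_swap]
      linarith
    · rw [orient_swap]
      linarith
    · rw [orient_rotate, orient_rotate]
      exact hp.orient_pos h1.1 h2.1 h2.2.1

lemma IsLabelling.onCap_iff (hp : IsLabelling n H w p) {a b x : ℕ}
    (hab : a < b) (hb : b < n) (hx : x ≤ n) (hax : a ≠ x) (hbx : b ≠ x) :
    OnCap n (capSet n p) a b x ↔ orient (p a) (p b) (p x) < 0 := by
  unfold OnCap
  split_ifs with hxn
  · subst hxn
    rw [min_eq_left hab.le, max_eq_right hab.le, mem_capSet]
    tauto
  · have hxn : x < n := by omega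
    unfold Between
    rcases lt_or_gt_of_ne hax with h1 | h1
    · rcases lt_or_gt_of_ne hbx with h2 | h2
      · refine iff_of_false (by omega) (not_lt.2 (hp.orient_pos hab h2 hxn).le)
      · refine iff_of_true (by omega) ?_
        rw [orient_swap]
        linarith [hp.orient_pos h1 h2 hb]
    · refine iff_of_false (by omega) (not_lt.2 ?_)
      rw [← orient_rotate]
      exact (hp.orient_pos h1 hab hb).le

lemma IsLabelling.not_disjoint_iff_onCap (hp : IsLabelling n H w p) (hH : IsConowheelSet H w)
    {a b x y : ℕ} (ha : a < n) (hb : b < n) (hx : x ≤ n) (hy : y ≤ n) (hab : a ≠ b)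
    (hax : a ≠ x) (hay : a ≠ y) (hbx : b ≠ x) (hby : b ≠ y) :
    ¬ Disjoint (openSegment ℝ (p a) (p b)) (openSegment ℝ (p x) (p y)) ↔
      (OnCap n (capSet n p) a b x ↔ ¬ OnCap n (capSet n p) a b y) := by
  rcases lt_or_gt_of_ne hab with h | h
  · rw [hp.onCap_iff h hb hx hax hbx, hp.onCap_iff h hb hy hay hby]
    exact hH.not_disjoint_iff (hp.mem ha) (hp.mem hb) (hp.mem_insert hx) (hp.mem_insert hy)
      (hp.ne hH ha.le hb.le hab) (hp.ne hH ha.le hx hax) (hp.ne hH ha.le hy hay)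
      (hp.ne hH hb.le hx hbx) (hp.ne hH hb.le hy hby)
  · rw [onCap_comm, onCap_comm n _ a b y, hp.onCap_iff h ha hx hbx hax,
      hp.onCap_iff h ha hy hby hay, openSegment_symm ℝ (p a)]
    exact hH.not_disjoint_iff (hp.mem hb) (hp.mem ha) (hp.mem_insert hx) (hp.mem_insert hy)
      (hp.ne hH hb.le ha.le hab.symm) (hp.ne hH hb.le hx hbx) (hp.ne hH hb.le hy hby)
      (hp.ne hH ha.le hx hax) (hp.ne hH ha.le hy hay)

/-- Of two edges without a common end, at least one avoids the extra point, so its ends are extreme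
and the one-sided criterion applies. Edges with a common end never cross, by general position. -/
lemma IsLabelling.not_disjoint_iff_wheelCross (hp : IsLabelling n H w p)
    (hH : IsConowheelSet H w) {a b x y : ℕ} (ha : a ≤ n) (hb : b ≤ n) (hx : x ≤ n) (hy : y ≤ n)
    (hab : a ≠ b) (hxy : x ≠ y) (hne : s(a, b) ≠ s(x, y)) :
    ¬ Disjoint (openSegment ℝ (p a) (p b)) (openSegment ℝ (p x) (p y)) ↔
      WheelCross n (capSet n p) a b x y := by
  by_cases hd : a ≠ x ∧ a ≠ y ∧ b ≠ x ∧ b ≠ y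
  · obtain ⟨h1, h2, h3, h4⟩ := hd
    have e1 : a ≠ n → b ≠ n → (¬ Disjoint (openSegment ℝ (p a) (p b)) (openSegment ℝ (p x) (p y)) ↔
        (OnCap n (capSet n p) a b x ↔ ¬ OnCap n (capSet n p) a b y)) := fun han hbn =>
      hp.not_disjoint_iff_onCap hH (by omega) (by omega) hx hy hab h1 h2 h3 h4
    have e2 : x ≠ n → y ≠ n → (¬ Disjoint (openSegment ℝ (p a) (p b)) (openSegment ℝ (p x) (p y)) ↔
        (OnCap n (capSet n p) x y a ↔ ¬ OnCap n (capSet n p) x y b)) := fun hxn hyn => by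
      rw [disjoint_comm]
      exact hp.not_disjoint_iff_onCap hH (by omega) (by omega) ha hb hxy h1.symm h3.symm h2.symm
        h4.symm
    have e3 : (a ≠ n ∧ b ≠ n) ∨ (x ≠ n ∧ y ≠ n) := by omega
    unfold WheelCross
    constructor
    · intro h
      refine ⟨⟨h1, h2, h3, h4⟩, ?_⟩
      rcases e3 with e3 | e3
      · exact Or.inl ⟨e3.1, e3.2, (e1 e3.1 e3.2).1 h⟩
      · exact Or.inr ⟨e3.1, e3.2, (e2 e3.1 e3.2).1 h⟩
    · rintro ⟨-, ⟨h5, h6, h7⟩ | ⟨h5, h6, h7⟩⟩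
      exacts [(e1 h5 h6).2 h7, (e2 h5 h6).2 h7]
  · refine iff_of_false (not_not.2 ?_) (fun h => hd h.1)
    rw [Ne, Sym2.eq_iff] at hne
    have key : ∀ {u v t : ℕ}, u ≤ n → v ≤ n → t ≤ n → u ≠ v → u ≠ t → v ≠ t →
        Disjoint (openSegment ℝ (p u) (p v)) (openSegment ℝ (p u) (p t)) := by
      intro u v t hu hv ht huv hut hvt
      exact hH.disjoint_of_common (hp.mem_insert hu) (hp.mem_insert hv) (hp.mem_insert ht)
        (hp.ne hH hu hv huv) (hp.ne hH hu ht hut) (hp.ne hH hv ht hvt)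
    by_cases h1 : a = x
    · subst h1
      exact key ha hb hy hab hxy (by tauto)
    by_cases h2 : a = y
    · subst h2
      rw [openSegment_symm ℝ (p x)]
      exact key ha hb hx hab hxy.symm (by tauto)
    by_cases h3 : b = x
    · subst h3
      rw [openSegment_symm ℝ (p a)]
      exact key hb ha hy hab.symm hxy (by tauto)
    · obtain rfl : b = y := by tauto
      rw [openSegment_symm ℝ (p a), openSegment_symm ℝ (p x)]
      exact key hb ha hx hab.symm hxy.symm (by tauto)

end Conowheel

/-! ### Transfer of the counts -/

section Transfer

variable {H : Finset ℂ} {w : ℂ} {n : ℕ} {p : ℕ → ℂ}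

lemma IsLabelling.exists_label (hp : IsLabelling n H w p) (hH : IsConowheelSet H w) :
    ∃ lab : ↥(insert w H) → ℕ, Function.Injective lab ∧ univ.image lab = range (n + 1) ∧
      ∀ x, p (lab x) = x := by
  have hsurj : ∀ x : ↥(insert w H), ∃ i, i ≤ n ∧ p i = x := by
    rintro ⟨x, hx⟩
    rcases Finset.mem_insert.1 hx with rfl | hx
    · exact ⟨n, le_rfl, hp.last⟩
    · rw [← hp.image] at hx
      obtain ⟨i, hi, rfl⟩ := mem_image.1 hx
      exact ⟨i, (mem_range.1 hi).le, rfl⟩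
  choose lab h1 h2 using hsurj
  refine ⟨lab, fun x y hxy => Subtype.ext ?_, ?_, h2⟩
  · rw [← h2 x, hxy, h2 y]
  · ext i
    simp only [mem_image, mem_univ, true_and, mem_range]
    constructor
    · rintro ⟨x, rfl⟩
      have := h1 x
      omega
    · intro hi
      refine ⟨⟨p i, hp.mem_insert (by omega)⟩, ?_⟩
      by_contra hne
      exact hp.ne hH (h1 _) (by omega) hne (h2 _)

lemma IsLabelling.isCrossingFree_iff (hp : IsLabelling n H w p) (hH : IsConowheelSet H w)
    {lab : ↥(insert w H) → ℕ} (hlab : Function.Injective lab)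
    (himg : univ.image lab = range (n + 1)) (hlp : ∀ x, p (lab x) = x)
    (G : SimpleGraph ↥(insert w H)) :
    IsCrossingFree G ↔ CrossingFree (WheelCross n (capSet n p)) (edgeImage lab G) := by
  have hle : ∀ x, lab x ≤ n := fun x => by
    have : lab x ∈ range (n + 1) := himg ▸ mem_image_of_mem lab (mem_univ x)
    rw [mem_range] at this
    omega
  have key : ∀ x y z t, G.Adj x y → G.Adj z t → s(x, y) ≠ s(z, t) →
      (¬ Disjoint (openSegment ℝ (x : ℂ) (y : ℂ)) (openSegment ℝ (z : ℂ) (t : ℂ)) ↔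
        WheelCross n (capSet n p) (lab x) (lab y) (lab z) (lab t)) := by
    intro x y z t hxy hzt hne
    rw [← hlp x, ← hlp y, ← hlp z, ← hlp t]
    refine hp.not_disjoint_iff_wheelCross hH (hle x) (hle y) (hle z) (hle t) (hlab.ne hxy.ne)
      (hlab.ne hzt.ne) fun h => hne ?_
    rw [← Sym2.map_mk, ← Sym2.map_mk] at h
    exact Sym2.map.injective hlab h
  constructor
  · intro h a b c d hab hcd hX
    obtain ⟨x, y, rfl, rfl, hxy⟩ := exists_of_mem_edgeImage hab
    obtain ⟨z, t, rfl, rfl, hzt⟩ := exists_of_mem_edgeImage hcd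
    have hne : s(x, y) ≠ s(z, t) := by
      intro he
      have := hX.1
      rw [Sym2.eq_iff] at he
      rcases he with ⟨rfl, rfl⟩ | ⟨rfl, rfl⟩ <;> tauto
    exact (key x y z t hxy hzt hne).2 hX (h x y z t hxy hzt hne)
  · intro h x y z t hxy hzt hne
    by_contra hd
    exact h _ _ _ _ ((mem_edgeImage hlab).2 hxy) ((mem_edgeImage hlab).2 hzt)
      ((key x y z t hxy hzt hne).1 hd)

lemma IsLabelling.numCrossingFreeMatchings_eq (hp : IsLabelling n H w p)
    (hH : IsConowheelSet H w) : numCrossingFreeMatchings (insert w H) =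
      matchCount (WheelCross n (capSet n p)) (range (n + 1)) := by
  obtain ⟨lab, hlab, himg, hlp⟩ := hp.exists_label hH
  rw [numCrossingFreeMatchings, matchCount, ← himg]
  refine ncard_simpleGraph hlab fun G => ?_
  rw [hp.isCrossingFree_iff hH hlab himg hlp, isMatchingGraph_iff hlab]

lemma IsLabelling.numCrossingFreeSpanningTrees_eq (hp : IsLabelling n H w p)
    (hH : IsConowheelSet H w) : numCrossingFreeSpanningTrees (insert w H) =
      treeCount (WheelCross n (capSet n p)) (range (n + 1)) := by
  obtain ⟨lab, hlab, himg, hlp⟩ := hp.exists_label hH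
  have : Nonempty ↥(insert w H) := ⟨⟨w, mem_insert_self w H⟩⟩
  rw [numCrossingFreeSpanningTrees, treeCount, ← himg]
  refine ncard_simpleGraph hlab fun G => ?_
  rw [hp.isCrossingFree_iff hH hlab himg hlp, isTree_iff_isTreeOn hlab]

lemma exists_sorted_triple {T : Finset ℕ} (hT : #T = 3) :
    ∃ i j k, i < j ∧ j < k ∧ T = {i, j, k} := by
  obtain ⟨x, y, z, hxy, hxz, hyz, rfl⟩ := card_eq_three.1 hT
  rcases lt_or_gt_of_ne hxy with h1 | h1 <;> rcases lt_or_gt_of_ne hxz with h2 | h2 <;>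
    rcases lt_or_gt_of_ne hyz with h3 | h3
  · exact ⟨x, y, z, h1, h3, rfl⟩
  · exact ⟨x, z, y, h2, h3, by ext; simp; tauto⟩
  · omega
  · exact ⟨z, x, y, h2, h1, by ext; simp; tauto⟩
  · exact ⟨y, x, z, h1, h2, by ext; simp; tauto⟩
  · omega
  · exact ⟨y, z, x, h3, h2, by ext; simp; tauto⟩
  · exact ⟨z, y, x, h3, h1, by ext; simp; tauto⟩

/-- The triangle is counterclockwise, so containing the extra point means having it on the left of
all three directed sides. The third side runs from `k` to `i`, hence the reversed condition on `(i,
k)`. -/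
lemma IsLabelling.mem_convexHull_iff (hp : IsLabelling n H w p) (hH : IsConowheelSet H w)
    {i j k : ℕ} (hij : i < j) (hjk : j < k) (hk : k < n) :
    w ∈ convexHull ℝ ({p i, p j, p k} : Set ℂ) ↔
      (i, j) ∉ capSet n p ∧ (j, k) ∉ capSet n p ∧ (i, k) ∈ capSet n p := by
  have hij0 := hp.orient_ne_zero hH (i := i) (j := j) (k := n) (by omega) (by omega) le_rfl
    (by omega) (by omega) (by omega)
  have hjk0 := hp.orient_ne_zero hH (i := j) (j := k) (k := n) (by omega) (by omega) le_rfl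
    (by omega) (by omega) (by omega)
  have hik0 := hp.orient_ne_zero hH (i := i) (j := k) (k := n) (by omega) (by omega) le_rfl
    (by omega) (by omega) (by omega)
  have hpos := hp.orient_pos hij hjk hk
  rw [mem_capSet, mem_capSet, mem_capSet, ← hp.last]
  have hsub : ∀ a b : ℂ, 0 ≤ orient a b (p i) → 0 ≤ orient a b (p j) → 0 ≤ orient a b (p k) →
      p n ∈ convexHull ℝ ({p i, p j, p k} : Set ℂ) → 0 ≤ orient a b (p n) := by
    intro a b h1 h2 h3 h
    refine convexHull_min ?_ (convex_orient_nonneg a b) h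
    simp only [Set.insert_subset_iff, Set.singleton_subset_iff]
    exact ⟨h1, h2, h3⟩
  constructor
  · intro h
    have h1 := hsub (p i) (p j) (orient_self_outer _ _).ge (orient_self_right _ _).ge hpos.le h
    have h2 := hsub (p j) (p k) (by rw [← orient_rotate]; exact hpos.le)
      (orient_self_outer _ _).ge (orient_self_right _ _).ge h
    have h3 := hsub (p k) (p i) (orient_self_right _ _).ge
      (by rw [orient_rotate]; exact hpos.le) (orient_self_outer _ _).ge h
    rw [orient_swap_left] at h3
    refine ⟨fun h => ?_, fun h => ?_, by omega, hk, lt_of_le_of_ne (by linarith) hik0⟩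
    · linarith [h.2.2]
    · linarith [h.2.2]
  · rintro ⟨h1, h2, h3⟩
    have h1' : 0 < orient (p i) (p j) (p n) :=
      lt_of_le_of_ne (not_lt.1 fun h => h1 ⟨hij, by omega, h⟩) hij0.symm
    have h2' : 0 < orient (p j) (p k) (p n) :=
      lt_of_le_of_ne (not_lt.1 fun h => h2 ⟨hjk, hk, h⟩) hjk0.symm
    have h3' := h3.2.2
    have hmem : ∀ x ∈ ({p i, p j, p k} : Set ℂ), x ∈ convexHull ℝ ({p i, p j, p k} : Set ℂ) :=
      fun x hx => subset_convexHull ℝ _ hx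
    obtain ⟨q, hq, hw⟩ := exists_mem_openSegment (convex_convexHull ℝ ({p i, p j, p k} : Set ℂ))
      (a := p n) (x := p i) (y := p j) (z := p k) (hmem _ (by simp)) (hmem _ (by simp))
      (by rw [orient_rotate]; exact h1') (by rw [orient_rotate]; exact h2')
      (by rw [orient_rotate, orient_swap_left]; linarith)
    exact (convex_convexHull ℝ _).openSegment_subset (hmem _ (by simp)) hq hw

lemma IsLabelling.numEmbracingTriangles_eq (hp : IsLabelling n H w p) (hH : IsConowheelSet H w) :
    numEmbracingTriangles H w = #(embracingTriples n (capSet n p)) := by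
  have hcoe : ∀ i j k, ((({i, j, k} : Finset ℕ).image p : Finset ℂ) : Set ℂ) =
      {p i, p j, p k} := by
    intro i j k
    simp
  have hinj : Set.InjOn (fun t : ℕ × ℕ × ℕ => ({t.1, t.2.1, t.2.2} : Finset ℕ).image p)
      (embracingTriples n (capSet n p)) := by
    rintro ⟨i, j, k⟩ h ⟨i', j', k'⟩ h' heq
    rw [mem_coe, mem_embracingTriples] at h h'
    obtain ⟨⟨h1, h2, h3⟩, ⟨h4, h5⟩, -⟩ := h
    obtain ⟨⟨h1', h2', h3'⟩, ⟨h4', h5'⟩, -⟩ := h'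
    have hs : ({i, j, k} : Finset ℕ) = {i', j', k'} := by
      have key : ∀ A B : Finset ℕ, A ⊆ range n → B ⊆ range n → A.image p = B.image p → A ⊆ B := by
        intro A B hA hB hAB x hx
        have := mem_image_of_mem p hx
        rw [hAB] at this
        obtain ⟨y, hy, hyx⟩ := mem_image.1 this
        rwa [← hp.inj (mem_coe.2 (hB hy)) (mem_coe.2 (hA hx)) hyx]
      have hA : ({i, j, k} : Finset ℕ) ⊆ range n := by
        intro x hx
        simp only [Finset.mem_insert, mem_singleton] at hx
        rw [mem_range]
        omega
      have hB : ({i', j', k'} : Finset ℕ) ⊆ range n := by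
        intro x hx
        simp only [Finset.mem_insert, mem_singleton] at hx
        rw [mem_range]
        omega
      exact (key _ _ hA hB heq).antisymm (key _ _ hB hA heq.symm)
    have m : ∀ x, (x = i ∨ x = j ∨ x = k) ↔ (x = i' ∨ x = j' ∨ x = k') := by
      intro x
      have := Finset.ext_iff.1 hs x
      simpa only [Finset.mem_insert, mem_singleton] using this
    have m1 := m i
    have m2 := m j
    have m3 := m k
    have m4 := m i'
    have m6 := m k'
    rw [Prod.mk.injEq, Prod.mk.injEq]
    omega
  rw [numEmbracingTriangles, ← card_image_of_injOn hinj, ← Set.ncard_coe_finset]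
  congr 1
  ext T
  rw [mem_coe, mem_image]
  constructor
  · rintro ⟨hTH, hT3, hw⟩
    have hT : ({i ∈ range n | p i ∈ T}).image p = T := by
      ext x
      rw [mem_image]
      constructor
      · rintro ⟨i, hi, rfl⟩
        exact (mem_filter.1 hi).2
      · intro hx
        have := hTH hx
        rw [← hp.image] at this
        obtain ⟨i, hi, rfl⟩ := mem_image.1 this
        exact ⟨i, mem_filter.2 ⟨hi, hx⟩, rfl⟩
    have hc : #({i ∈ range n | p i ∈ T}) = 3 := by
      rw [← hT3, ← card_image_of_injOn (f := p) (s := {i ∈ range n | p i ∈ T}), hT]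
      exact hp.inj.mono (coe_subset.2 (filter_subset _ _))
    obtain ⟨i, j, k, hij, hjk, heq⟩ := exists_sorted_triple hc
    have hk : k < n := by
      have : k ∈ ({i ∈ range n | p i ∈ T}) := by rw [heq]; simp
      exact mem_range.1 (mem_filter.1 this).1
    rw [heq] at hT
    rw [← hT, hcoe, hp.mem_convexHull_iff hH hij hjk hk] at hw
    exact ⟨(i, j, k), mem_embracingTriples.2 ⟨by omega, ⟨hij, hjk⟩, hw⟩, hT⟩
  · rintro ⟨⟨i, j, k⟩, ht, rfl⟩
    rw [mem_embracingTriples] at ht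
    obtain ⟨⟨h1, h2, h3⟩, ⟨h4, h5⟩, h6⟩ := ht
    have hA : ({i, j, k} : Finset ℕ) ⊆ range n := by
      intro x hx
      simp only [Finset.mem_insert, mem_singleton] at hx
      rw [mem_range]
      omega
    refine ⟨?_, ?_, ?_⟩
    · rw [← hp.image]
      exact image_subset_image hA
    · rw [card_image_of_injOn (hp.inj.mono (coe_subset.2 hA)), card_eq_three]
      exact ⟨i, j, k, by omega, by omega, by omega, rfl⟩
    · dsimp only
      rw [hcoe]
      exact (hp.mem_convexHull_iff hH h4 h5 h3).2 h6

end Transfer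

/-! ### The regular polygon -/

section Regular

variable {n : ℕ} {c z : ℂ}

/-- The vertices of the regular polygon. -/
noncomputable def polygonVertex (n : ℕ) (c z : ℂ) (k : ℕ) : ℂ :=
  c + z * Complex.exp (2 * Real.pi * Complex.I * (k : ℂ) / (n : ℂ))

/-- The angle of a vertex of the regular polygon. -/
noncomputable def polygonAngle (n k : ℕ) : ℝ := 2 * Real.pi * k / n

lemma polygonVertex_eq (n : ℕ) (c z : ℂ) (k : ℕ) :
    polygonVertex n c z k = c + z * Complex.exp (polygonAngle n k * Complex.I) := by
  unfold polygonVertex polygonAngle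
  congr 3
  push_cast
  ring

lemma polygonVertex_re (n : ℕ) (c z : ℂ) (k : ℕ) : (polygonVertex n c z k).re =
    c.re + (z.re * Real.cos (polygonAngle n k) - z.im * Real.sin (polygonAngle n k)) := by
  rw [polygonVertex_eq, Complex.add_re, Complex.mul_re, Complex.exp_ofReal_mul_I_re,
    Complex.exp_ofReal_mul_I_im]

lemma polygonVertex_im (n : ℕ) (c z : ℂ) (k : ℕ) : (polygonVertex n c z k).im =
    c.im + (z.re * Real.sin (polygonAngle n k) + z.im * Real.cos (polygonAngle n k)) := by
  rw [polygonVertex_eq, Complex.add_im, Complex.mul_im, Complex.exp_ofReal_mul_I_re,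
    Complex.exp_ofReal_mul_I_im]

lemma norm_polygonVertex_sub (n : ℕ) (c z : ℂ) (k : ℕ) : ‖polygonVertex n c z k - c‖ = ‖z‖ := by
  rw [polygonVertex_eq, add_sub_cancel_left, norm_mul, Complex.norm_exp_ofReal_mul_I, mul_one]

lemma orient_center (n : ℕ) (c z : ℂ) (i j : ℕ) :
    orient (polygonVertex n c z i) (polygonVertex n c z j) c =
      (z.re ^ 2 + z.im ^ 2) * Real.sin (polygonAngle n j - polygonAngle n i) := by
  unfold orient
  rw [polygonVertex_re, polygonVertex_im, polygonVertex_re, polygonVertex_im, Real.sin_sub]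
  ring

lemma sq_add_sq_pos (hz : z ≠ 0) : 0 < z.re ^ 2 + z.im ^ 2 := by
  have := Complex.normSq_pos.2 hz
  rw [Complex.normSq_apply] at this
  nlinarith

/-- With half-angles `α`, `β` between consecutive points, the doubled area is `4 * sin α * sin β *
sin (α + β)` times the squared radius, and all three angles lie in `(0, π)`. -/
lemma orient_polygonVertex_pos (hz : z ≠ 0) {i j k : ℕ} (hij : i < j) (hjk : j < k)
    (hk : k < n) :
    0 < orient (polygonVertex n c z i) (polygonVertex n c z j) (polygonVertex n c z k) := by
  set α := (polygonAngle n j - polygonAngle n i) / 2 with hα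
  set β := (polygonAngle n k - polygonAngle n j) / 2 with hβ
  have h : orient (polygonVertex n c z i) (polygonVertex n c z j) (polygonVertex n c z k) =
      (z.re ^ 2 + z.im ^ 2) * (4 * Real.sin α * Real.sin β * Real.sin (α + β)) := by
    have h1 : orient (polygonVertex n c z i) (polygonVertex n c z j) (polygonVertex n c z k) =
        (z.re ^ 2 + z.im ^ 2) * (Real.sin (polygonAngle n j - polygonAngle n i) +
          Real.sin (polygonAngle n k - polygonAngle n j) -
          Real.sin (polygonAngle n k - polygonAngle n i)) := by
      unfold orient
      simp only [polygonVertex_re, polygonVertex_im, Real.sin_sub]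
      ring
    rw [h1, show polygonAngle n j - polygonAngle n i = 2 * α by rw [hα]; ring,
      show polygonAngle n k - polygonAngle n j = 2 * β by rw [hβ]; ring,
      show polygonAngle n k - polygonAngle n i = 2 * α + 2 * β by rw [hα, hβ]; ring, Real.sin_add,
      Real.sin_add, Real.sin_two_mul, Real.sin_two_mul, Real.cos_two_mul, Real.cos_two_mul]
    have e1 := Real.sin_sq_add_cos_sq α
    have e2 := Real.sin_sq_add_cos_sq β
    have e1' : Real.cos α ^ 2 = 1 - Real.sin α ^ 2 := by linarith
    have e2' : Real.cos β ^ 2 = 1 - Real.sin β ^ 2 := by linarith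
    rw [e1', e2']
    ring
  have hn : (0 : ℝ) < n := by exact_mod_cast (by omega : 0 < n)
  have hd : ∀ u v : ℕ, u < v → v < n → 0 < (polygonAngle n v - polygonAngle n u) / 2 ∧
      (polygonAngle n v - polygonAngle n u) / 2 < Real.pi := by
    intro u v huv hv
    have h1 : (polygonAngle n v - polygonAngle n u) / 2 = Real.pi * (((v : ℝ) - u) / n) := by
      unfold polygonAngle
      field_simp
    have h2 : (0 : ℝ) < (v : ℝ) - u := by
      have : (u : ℝ) < v := by exact_mod_cast huv
      linarith
    have h3 : ((v : ℝ) - u) / n < 1 := by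
      rw [div_lt_one hn]
      have : (v : ℝ) < n := by exact_mod_cast hv
      have : (0 : ℝ) ≤ u := Nat.cast_nonneg u
      linarith
    rw [h1]
    have := Real.pi_pos
    exact ⟨by positivity, by nlinarith⟩
  have hα' := hd i j hij (hjk.trans hk)
  have hβ' := hd j k hjk hk
  have hαβ := hd i k (hij.trans hjk) hk
  rw [show (polygonAngle n k - polygonAngle n i) / 2 = α + β by rw [hα, hβ]; ring] at hαβ
  rw [h]
  have h1 := Real.sin_pos_of_pos_of_lt_pi hα'.1 hα'.2
  have h2 := Real.sin_pos_of_pos_of_lt_pi hβ'.1 hβ'.2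
  have h3 := Real.sin_pos_of_pos_of_lt_pi hαβ.1 hαβ.2
  have h4 := sq_add_sq_pos hz
  positivity

/-- The sign is that of `sin (2π (j - i) / n)`, which turns negative once the arc exceeds half the
circle. -/
lemma orient_center_sign (hz : z ≠ 0) {i j : ℕ} (hij : i < j) (hj : j < n) :
    (n < 2 * (j - i) → orient (polygonVertex n c z i) (polygonVertex n c z j) c < 0) ∧
      (2 * (j - i) < n → 0 < orient (polygonVertex n c z i) (polygonVertex n c z j) c) := by
  have hn : (0 : ℝ) < n := by exact_mod_cast (by omega : 0 < n)
  have hang : polygonAngle n j - polygonAngle n i = Real.pi * (2 * ((j - i : ℕ) : ℝ) / n) := by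
    rw [Nat.cast_sub hij.le]
    unfold polygonAngle
    field_simp
  have hpos := sq_add_sq_pos hz
  have hpi := Real.pi_pos
  have hd : (0 : ℝ) < ((j - i : ℕ) : ℝ) := by exact_mod_cast Nat.sub_pos_of_lt hij
  rw [orient_center, hang]
  constructor
  · intro h
    have h1 : (1 : ℝ) < 2 * ((j - i : ℕ) : ℝ) / n := by
      rw [one_lt_div hn]
      exact_mod_cast h
    have h2 : 2 * ((j - i : ℕ) : ℝ) / n < 2 := by
      rw [div_lt_iff₀ hn]
      have : ((j - i : ℕ) : ℝ) < n := by exact_mod_cast (by omega : j - i < n)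
      linarith
    refine mul_neg_of_pos_of_neg hpos ?_
    rw [← Real.sin_sub_two_pi]
    apply Real.sin_neg_of_neg_of_neg_pi_lt <;> nlinarith
  · intro h
    have h1 : 2 * ((j - i : ℕ) : ℝ) / n < 1 := by
      rw [div_lt_one hn]
      exact_mod_cast h
    exact mul_pos hpos (Real.sin_pos_of_pos_of_lt_pi (by positivity) (by nlinarith))

lemma polygonVertex_injOn (hz : z ≠ 0) :
    Set.InjOn (polygonVertex n c z) (range n) := by
  intro i hi j hj hij
  rw [mem_coe, mem_range] at hi hj
  have hn : n ≠ 0 := by omega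
  have h : ∀ k : ℕ, polygonVertex n c z k =
      c + z * Complex.exp (2 * Real.pi * Complex.I / n) ^ k := by
    intro k
    rw [polygonVertex, ← Complex.exp_nat_mul]
    congr 3
    ring
  rw [h, h] at hij
  exact (Complex.isPrimitiveRoot_exp n hn).pow_inj hi hj
    (mul_left_cancel₀ hz (add_left_cancel hij))

lemma image_polygonVertex (n : ℕ) (c z : ℂ) :
    (range n).image (polygonVertex n c z) = regularPolygon n c z := by
  ext x
  simp only [regularPolygon, mem_image, mem_range, mem_univ, true_and]
  constructor
  · rintro ⟨i, hi, rfl⟩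
    exact ⟨⟨i, hi⟩, rfl⟩
  · rintro ⟨i, rfl⟩
    exact ⟨i, i.2, rfl⟩

/-- The labelling of the regular polygon with the extra point `w`. -/
noncomputable def polygonLabel (n : ℕ) (c z w : ℂ) (k : ℕ) : ℂ := if k = n then w else polygonVertex n c z k

lemma isLabelling_regularPolygon (hz : z ≠ 0) (w : ℂ) :
    IsLabelling n (regularPolygon n c z) w (polygonLabel n c z w) := by
  have heq : ∀ k, k < n → polygonLabel n c z w k = polygonVertex n c z k := fun k hk =>
    if_neg hk.ne
  refine ⟨?_, ?_, ?_, if_pos rfl⟩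
  · rw [← image_polygonVertex]
    refine image_congr fun k hk => heq k (mem_range.1 (mem_coe.1 hk))
  · intro i hi j hj hij
    rw [heq i (mem_range.1 (mem_coe.1 hi)), heq j (mem_range.1 (mem_coe.1 hj))] at hij
    exact polygonVertex_injOn hz hi hj hij
  · intro i j k hij hjk hk
    rw [heq i (by omega), heq j (by omega), heq k hk]
    exact orient_polygonVertex_pos hz hij hjk hk

/-- All points lie in a closed disc and the vertices on its boundary circle. By strict convexity
boundary points are extreme in the disc, hence also in the smaller hull. -/
lemma isConowheelSet_regularPolygon (hz : z ≠ 0) {w : ℂ} (hw : ‖w - c‖ < ‖z‖)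
    (hgp : InGeneralPosition (insert w (regularPolygon n c z))) :
    IsConowheelSet (regularPolygon n c z) w := by
  have hnorm : ∀ x ∈ regularPolygon n c z, ‖x - c‖ = ‖z‖ := by
    intro x hx
    rw [← image_polygonVertex] at hx
    obtain ⟨k, -, rfl⟩ := mem_image.1 hx
    exact norm_polygonVertex_sub n c z k
  refine ⟨fun h => absurd (hnorm w h) hw.ne, hgp, fun x hx => ?_⟩
  have hsub : convexHull ℝ ((insert w (regularPolygon n c z) : Finset ℂ) : Set ℂ) ⊆
      Metric.closedBall c ‖z‖ := by
    refine convexHull_min (fun y hy => ?_) (convex_closedBall c ‖z‖)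
    rw [mem_closedBall_iff_norm]
    rcases Finset.mem_insert.1 (mem_coe.1 hy) with rfl | hy
    exacts [hw.le, (hnorm y hy).le]
  refine inter_extremePoints_subset_extremePoints_of_subset hsub
    ⟨subset_convexHull ℝ _ (mem_coe.2 (Finset.mem_insert_of_mem hx)), ?_⟩
  rw [mem_extremePoints]
  have hxz := hnorm x hx
  refine ⟨mem_closedBall_iff_norm.2 hxz.le, fun y hy y' hy' hxy => ?_⟩
  by_cases hne : y = y'
  · subst hne
    rw [openSegment_same] at hxy
    exact ⟨hxy.symm, hxy.symm⟩
  · have hint := (strictConvex_closedBall ℝ c ‖z‖).openSegment_subset hy hy' hne hxy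
    rw [interior_closedBall c (norm_ne_zero_iff.2 hz), mem_ball_iff_norm] at hint
    exact absurd hxz hint.ne

/-- At the center the relevant orientations have strict signs, and finitely many strict inequalities
persist nearby. Diameters, on which the center itself lies, are not constrained by balance. -/
lemma eventually_isBalanced (hz : z ≠ 0) :
    ∀ᶠ w in 𝓝 c, IsBalanced n (capSet n (polygonLabel n c z w)) := by
  have h : ∀ i j, i < j → j < n → ∀ᶠ w in 𝓝 c,
      ((n < 2 * (j - i) → orient (polygonVertex n c z i) (polygonVertex n c z j) w < 0) ∧
        (2 * (j - i) < n → 0 < orient (polygonVertex n c z i) (polygonVertex n c z j) w)) := by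
    intro i j hij hj
    have hcont : Continuous fun w => orient (polygonVertex n c z i) (polygonVertex n c z j) w := by
      unfold orient
      fun_prop
    have hs := orient_center_sign (c := c) hz hij hj
    rw [eventually_and]
    constructor
    · by_cases hlt : n < 2 * (j - i)
      · filter_upwards [(hcont.tendsto c).eventually (gt_mem_nhds (hs.1 hlt))] with w hw _ using hw
      · exact Eventually.of_forall fun w hw => absurd hw hlt
    · by_cases hlt : 2 * (j - i) < n
      · filter_upwards [(hcont.tendsto c).eventually (lt_mem_nhds (hs.2 hlt))] with w hw _ using hw
      · exact Eventually.of_forall fun w hw => absurd hw hlt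
  have h' : ∀ᶠ w in 𝓝 c, ∀ j ∈ range n, ∀ i ∈ range j,
      ((n < 2 * (j - i) → orient (polygonVertex n c z i) (polygonVertex n c z j) w < 0) ∧
        (2 * (j - i) < n → 0 < orient (polygonVertex n c z i) (polygonVertex n c z j) w)) := by
    rw [eventually_all_finset]
    intro j hj
    rw [eventually_all_finset]
    intro i hi
    exact h i j (mem_range.1 hi) (mem_range.1 hj)
  filter_upwards [h'] with w hw i j hij hj
  have := hw j (mem_range.2 hj) i (mem_range.2 hij)
  rw [mem_capSet]
  simp only [polygonLabel]
  rw [if_neg (by omega), if_neg hj.ne, if_true]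
  refine ⟨fun h => ⟨hij, hj, this.1 h⟩, fun h h2 => ?_⟩
  linarith [this.2 h, h2.2.2]

end Regular

end WheelSet

/-! ### The main theorem. -/

open WheelSet
theorem mainTheorem8 (n : ℕ) (hn : 1 ≤ n) (c z : ℂ) (hz : z ≠ 0) :
    ∀ᶠ w in 𝓝 c, InGeneralPosition (insert w (regularPolygon n c z)) →
      IsConowheelSet (regularPolygon n c z) w ∧
      ∀ (H' : Finset ℂ) (w' : ℂ), H'.card = n → IsConowheelSet H' w' →
        numEmbracingTriangles H' w' ≤ numEmbracingTriangles (regularPolygon n c z) w ∧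
        numCrossingFreeMatchings (insert w' H') ≤
          numCrossingFreeMatchings (insert w (regularPolygon n c z)) ∧
        numCrossingFreeSpanningTrees (insert w' H') ≤
          numCrossingFreeSpanningTrees (insert w (regularPolygon n c z)) := by
  have hball : ∀ᶠ w in 𝓝 c, ‖w - c‖ < ‖z‖ := by
    filter_upwards [Metric.ball_mem_nhds c (norm_pos_iff.2 hz)] with w hw
    exact mem_ball_iff_norm.1 hw
  filter_upwards [hball, eventually_isBalanced (n := n) hz] with w hw hbal hgp
  have hH := isConowheelSet_regularPolygon hz hw hgp
  have hp := isLabelling_regularPolygon (n := n) (c := c) hz w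
  refine ⟨hH, fun H' w' hcard hH' => ?_⟩
  -- Here `1 ≤ n` supplies the vertex from which the labelling starts.
  obtain ⟨p', hp'⟩ := exists_isLabelling hH' (Finset.card_pos.1 (by omega))
  rw [hcard] at hp'
  rw [hp'.numEmbracingTriangles_eq hH', hp.numEmbracingTriangles_eq hH,
    hp'.numCrossingFreeMatchings_eq hH', hp.numCrossingFreeMatchings_eq hH,
    hp'.numCrossingFreeSpanningTrees_eq hH', hp.numCrossingFreeSpanningTrees_eq hH]
  have hS := hp'.isPosition hH'
  have hT := hp.isPosition hH
  exact ⟨embracingTriples_le hS hT hbal, matchCount_le hS hT hbal, treeCount_le hS hT hbal⟩
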